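/- **Setting.** Let $d,n\ge 0$ be integers, $C$ a finite (discrete) abelian group and $H=\mathbb R^n\times C$. Let $\Gamma\subset H\times\mathbb R^d$ be a lattice (a discrete cocompact subgroup) such that the projection $\pi^\|:H\times\mathbb R^d\to\mathbb R^d$ is injective on $\Gamma$ and the image of $\Gamma$ under the projection $\pi^\perp:H\times\mathbb R^d\to H$ is dense. Let $W\subset H$ be a nonempty compact set that is the closure of its interior, such that $W+h=W$ only for $h=0$, and that is a finite disjoint union of polyhedra (a polyhedron being a finite union of convex polytopes in one slice $\mathbb R^n\times\{c\}$). For $\xi\in H\times\mathbb R^d$ put $\Lambda_\xi=\{\pi^\|(z): z\in\Gamma+\xi,\ \pi^\perp(z)\in W\}$, and call $\xi$ non-singular if $\pi^\perp(\Gamma+\xi)\cap\partial W=\emptyset$. For $\Lambda\subset\mathbb R^d$, let the hull $\Omega_\Lambda$ be the closure of $\{\Lambda-x:x\in\mathbb R^d\}$ and the transversal $\Xi_\Lambda$ the closure of $\{\Lambda-x:x\in\Lambda\}$, where two point sets are close if they agree on a large ball around $0$ up to a small translation. A polyhedral model set is an element $M$ of the hull of some $\Lambda_\xi$ with $\xi$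 non-singular. The map $\Lambda_\xi\mapsto\xi \bmod \Gamma$ ($\xi$ non-singular) extends continuously to all model sets with window $W$; let $\pi(M)\in(H\times\mathbb R^d)/\Gamma$ be the value of the extension at $M$. The star map $\sigma_M:M\to H$ sends $x$ to the unique $h\in H$ with $(h,x)\bmod\Gamma=\pi(M)$. A function $F:M\to\mathbb R$ is *strongly pattern equivariant* if there is $R>0$ such that $F(x)=F(y)$ whenever $M-x$ and $M-y$ agree on the ball $B_R(0)$. It is *weakly pattern equivariant* if $F(x)=\tilde F(M-x)$ for a continuous $\tilde F:\Xi_M\to\mathbb R$. It is *nonslip* if moreover there is $\varepsilon>0$ such that $\tilde F(M_1)=\tilde F(M_2)$ for all $M_1,M_2\in\Xi_M$ that have the same image in the maximal equicontinuous factor of $(\Omega_M,\mathbb R^d)$ and agree on $B_{1/\varepsilon}(0)$. Let $H^1(M,\mathbb R)$ be the first pattern equivariant cohomology: strongly pattern equivariant $1$-cocycles modulo the coboundaries $\delta F(x,y)=F(y)-F(x)$ of strongly pattern equivariant functions $F:M\to\mathbb R$. Here a $1$-cocycle is a function $c:M\times M\to\mathbb R$ with $c(x,y)+c(y,z)=c(x,z)$;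 it is strongly pattern equivariant if for every $r$ there is $R>0$ such that $c(x,y)=c(x',y')$ whenever $y-x=y'-x'$, $|y-x|\le r$, and $M-x$, $M-x'$ agree on $B_R(0)$. (Equivalently, one may use closed strongly pattern equivariant cellular $1$-cochains of a locally derived polygonal tiling with vertex set $M$.) Consider the following subgroups, each consisting of the classes of those strongly pattern equivariant cocycles that are of the form $\delta F$ for a function $F$ as indicated: - $H^1_{repr}(M,\mathbb R)$: $F=L\circ\sigma_M$ with $L:H\to\mathbb R$ a continuous group homomorphism; - $H^1_{ns}(M,\mathbb R)$: $F$ nonslip; - $H^1_{an}(M,\mathbb R)$: $F$ weakly pattern equivariant. **Theorem 1.2.** If $M$ is a polyhedral model set, then $$H^1_{repr}(M,\mathbb R)=H^1_{ns}(M,\mathbb R)=H^1_{an}(M,\mathbb R).$$ -/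

import Mathlib

open Topology

/-- Physical space `ℝᵈ` with the Euclidean norm. -/
abbrev Eucl (d : ℕ) : Type := EuclideanSpace ℝ (Fin d)

/-! ### Point patterns and their hulls -/

/-- The translate `A - x`. -/
def shift {d : ℕ} (A : Set (Eucl d)) (x : Eucl d) : Set (Eucl d) := {y | y + x ∈ A}

/-- `A` and `B` agree (exactly) out to radius `R` around the origin. -/
def AgreeTo {d : ℕ} (R : ℝ) (A B : Set (Eucl d)) : Prop :=
  A ∩ Metric.closedBall 0 R = B ∩ Metric.closedBall 0 R

/-- `A` and `B` are `ε`-close: they agree out to radius `1/ε` up to a translation of size `< ε`. -/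
def EpsClose {d : ℕ} (ε : ℝ) (A B : Set (Eucl d)) : Prop :=
  ∃ t : Eucl d, ‖t‖ < ε ∧ AgreeTo ε⁻¹ (shift A t) B

theorem AgreeTo.mono {d : ℕ} {R R' : ℝ} (h : R' ≤ R) {A B : Set (Eucl d)}
    (hAB : AgreeTo R A B) : AgreeTo R' A B := by
  have hs : Metric.closedBall (0 : Eucl d) R' ⊆ Metric.closedBall 0 R :=
    Metric.closedBall_subset_closedBall h
  unfold AgreeTo at *
  ext y
  have := Set.ext_iff.1 hAB y
  simp only [Set.mem_inter_iff] at this ⊢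
  constructor
  · rintro ⟨ha, hb⟩
    exact ⟨(this.1 ⟨ha, hs hb⟩).1, hb⟩
  · rintro ⟨ha, hb⟩
    exact ⟨(this.2 ⟨ha, hs hb⟩).1, hb⟩

theorem EpsClose.mono {d : ℕ} {ε ε' : ℝ} (hε : 0 < ε) (h : ε ≤ ε') {A B : Set (Eucl d)}
    (hAB : EpsClose ε A B) : EpsClose ε' A B := by
  obtain ⟨t, ht, hag⟩ := hAB
  exact ⟨t, ht.trans_le h, hag.mono (inv_anti₀ hε h)⟩

/-- The topology on patterns: two patterns are close if, up to a small translation, they agree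
exactly on a large ball around the origin. On Delone sets of finite local complexity it is the
topology of Hausdorff convergence on large balls. -/
instance patternTopology (d : ℕ) : TopologicalSpace (Set (Eucl d)) where
  IsOpen U := ∀ A ∈ U, ∃ ε : ℝ, 0 < ε ∧ ∀ B, EpsClose ε A B → B ∈ U
  isOpen_univ := fun _ _ => ⟨1, one_pos, fun _ _ => trivial⟩
  isOpen_inter := by
    rintro U V hU hV A ⟨hAU, hAV⟩
    obtain ⟨ε, hε, h⟩ := hU A hAU
    obtain ⟨ε', hε', h'⟩ := hV A hAV
    exact ⟨min ε ε', lt_min hε hε', fun B hB =>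
      ⟨h B (hB.mono (lt_min hε hε') (min_le_left _ _)),
       h' B (hB.mono (lt_min hε hε') (min_le_right _ _))⟩⟩
  isOpen_sUnion := by
    rintro S hS A ⟨U, hU, hA⟩
    obtain ⟨ε, hε, h⟩ := hS U hU A hA
    exact ⟨ε, hε, fun B hB => ⟨U, hU, h B hB⟩⟩

/-- The continuous hull `Ω_Λ`: the closure of the translation orbit of `Λ`. -/
def Hull {d : ℕ} (Λ : Set (Eucl d)) : Set (Set (Eucl d)) :=
  closure {A | ∃ x : Eucl d, A = shift Λ x}

/-- The canonical transversal `Ξ_Λ`: the closure of `{Λ - x : x ∈ Λ}`. -/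
def Transversal {d : ℕ} (Λ : Set (Eucl d)) : Set (Set (Eucl d)) :=
  closure {A | ∃ x ∈ Λ, A = shift Λ x}

theorem shift_mem_transversal {d : ℕ} {Λ : Set (Eucl d)} {x : Eucl d} (hx : x ∈ Λ) :
    shift Λ x ∈ Transversal Λ :=
  subset_closure ⟨x, hx, rfl⟩

/-- The relation `R_max` on the hull: `A` and `B` have the same image in the maximal equicontinuous
factor, that is, they have the same image in every equicontinuous factor of `(Ω_Λ, ℝᵈ)`. Here a
factor is a compact Hausdorff space `Y` with a continuous `ℝᵈ`-action and a continuous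
equivariant surjection `p : Ω_Λ → Y`, where `x ∈ ℝᵈ` acts on `Ω_Λ` by `A ↦ A - x`. -/
def MaxEquicontinuousRel {d : ℕ} (Λ A B : Set (Eucl d)) : Prop :=
  ∃ (hA : A ∈ Hull Λ) (hB : B ∈ Hull Λ),
    ∀ (Y : Type) [UniformSpace Y] [CompactSpace Y] [T2Space Y] [AddAction (Eucl d) Y]
      [ContinuousVAdd (Eucl d) Y] (p : Hull Λ → Y),
      UniformEquicontinuous (fun (x : Eucl d) (y : Y) => x +ᵥ y) →
      Continuous p → Function.Surjective p →
      (∀ (P Q : Hull Λ) (x : Eucl d), (Q : Set (Eucl d)) = shift P x → p Q = x +ᵥ p P) →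
      p ⟨A, hA⟩ = p ⟨B, hB⟩

/-! ### Pattern equivariant functions and cohomology -/

/-- Strongly pattern equivariant functions on `Λ`: the value at `x` is determined by the pattern
of `Λ` in a ball of fixed radius around `x`. -/
def SPE {d : ℕ} (Λ : Set (Eucl d)) : Submodule ℝ (Λ → ℝ) where
  carrier := {F | ∃ R : ℝ, 0 < R ∧ ∀ x y : Λ, AgreeTo R (shift Λ x) (shift Λ y) → F x = F y}
  zero_mem' := ⟨1, one_pos, fun _ _ _ => rfl⟩
  add_mem' := by
    rintro F G ⟨R, hR, h⟩ ⟨R', _, h'⟩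
    refine ⟨max R R', lt_max_of_lt_left hR, fun x y hxy => ?_⟩
    simp only [Pi.add_apply]
    rw [h x y (hxy.mono (le_max_left _ _)), h' x y (hxy.mono (le_max_right _ _))]
  smul_mem' := by
    rintro c F ⟨R, hR, h⟩
    refine ⟨R, hR, fun x y hxy => ?_⟩
    simp only [Pi.smul_apply]
    rw [h x y hxy]

/-- The coboundary of a function on the vertices: `δF(x, y) = F(y) - F(x)`. -/
def coboundary {d : ℕ} (Λ : Set (Eucl d)) : (Λ → ℝ) →ₗ[ℝ] (Λ → Λ → ℝ) where
  toFun F := fun x y => F y - F x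
  map_add' := by
    intro F G
    funext x y
    simp only [Pi.add_apply]
    ring
  map_smul' := by
    intro c F
    funext x y
    simp only [Pi.smul_apply, smul_eq_mul, RingHom.id_apply]
    ring

/-- Strongly pattern equivariant `1`-cocycles on `Λ`. A `1`-cochain assigns a real number to every
oriented edge `(x, y)` between points of `Λ`. It is strongly pattern equivariant if its values on
edges of bounded length are determined by the pattern of `Λ` in a ball of fixed radius around the
edge, and closed if its sum along the boundary of every triangle vanishes.

Edges of every length are allowed. For a locally derived polygonal tiling with vertex set `Λ`, a
closed cochain on the edges of the tiling extends uniquely to such a cocycle by summing along edge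
paths, so that no choice of a tiling is needed. -/
def PECocycle {d : ℕ} (Λ : Set (Eucl d)) : Submodule ℝ (Λ → Λ → ℝ) where
  carrier := {c | (∀ r : ℝ, ∃ R : ℝ, 0 < R ∧ ∀ x y x' y' : Λ,
        ‖(y : Eucl d) - x‖ ≤ r → (y' : Eucl d) - x' = (y : Eucl d) - x →
        AgreeTo R (shift Λ x) (shift Λ x') → c x y = c x' y') ∧
      ∀ x y z : Λ, c y z - c x z + c x y = 0}
  zero_mem' := ⟨fun _ => ⟨1, one_pos, fun _ _ _ _ _ _ _ => rfl⟩, fun _ _ _ => by simp⟩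
  add_mem' := by
    rintro b c ⟨hb, hb'⟩ ⟨hc, hc'⟩
    refine ⟨fun r => ?_, fun x y z => ?_⟩
    · obtain ⟨R, hR, h⟩ := hb r
      obtain ⟨R', _, h'⟩ := hc r
      refine ⟨max R R', lt_max_of_lt_left hR, fun x y x' y' hr hd ha => ?_⟩
      simp only [Pi.add_apply]
      rw [h x y x' y' hr hd (ha.mono (le_max_left _ _)),
        h' x y x' y' hr hd (ha.mono (le_max_right _ _))]
    · simp only [Pi.add_apply]
      linarith [hb' x y z, hc' x y z]
  smul_mem' := by
    rintro a c ⟨hc, hc'⟩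
    refine ⟨fun r => ?_, fun x y z => ?_⟩
    · obtain ⟨R, hR, h⟩ := hc r
      refine ⟨R, hR, fun x y x' y' hr hd ha => ?_⟩
      simp only [Pi.smul_apply]
      rw [h x y x' y' hr hd ha]
    · simp only [Pi.smul_apply, smul_eq_mul]
      linear_combination a * hc' x y z

/-- Cocycles that are coboundaries of functions belonging to a given space. -/
def cocyclesOf {d : ℕ} (Λ : Set (Eucl d)) (S : Submodule ℝ (Λ → ℝ)) :
    Submodule ℝ (PECocycle Λ) :=
  (S.map (coboundary Λ)).comap (PECocycle Λ).subtype

/-- The first pattern equivariant cohomology `H¹(Λ, ℝ)`: strongly pattern equivariant cocycles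
modulo coboundaries of strongly pattern equivariant functions. -/
abbrev H1 {d : ℕ} (Λ : Set (Eucl d)) : Type := PECocycle Λ ⧸ cocyclesOf Λ (SPE Λ)

/-- The classes in `H¹(Λ, ℝ)` of the strongly pattern equivariant cochains of the form `δF` with
`F` in a given space of functions on `Λ`. -/
def classesOf {d : ℕ} (Λ : Set (Eucl d)) (S : Submodule ℝ (Λ → ℝ)) : Submodule ℝ (H1 Λ) :=
  (cocyclesOf Λ S).map (cocyclesOf Λ (SPE Λ)).mkQ

/-- `Ft` is a continuous function on the transversal that induces `F`, i.e. `F x = Ft (Λ - x)`. -/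
def Induces {d : ℕ} (Λ : Set (Eucl d)) (Ft : Transversal Λ → ℝ) (F : Λ → ℝ) : Prop :=
  Continuous Ft ∧ ∀ x : Λ, F x = Ft ⟨shift Λ x, shift_mem_transversal x.2⟩

/-- Weakly pattern equivariant functions on `Λ`. -/
def WPE {d : ℕ} (Λ : Set (Eucl d)) : Submodule ℝ (Λ → ℝ) where
  carrier := {F | ∃ Ft, Induces Λ Ft F}
  zero_mem' := ⟨fun _ => 0, continuous_const, fun _ => rfl⟩
  add_mem' := by
    rintro F G ⟨Ft, hF, hF'⟩ ⟨Gt, hG, hG'⟩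
    exact ⟨fun A => Ft A + Gt A, hF.add hG, fun x => by rw [Pi.add_apply, hF' x, hG' x]⟩
  smul_mem' := by
    rintro c F ⟨Ft, hF, hF'⟩
    exact ⟨fun A => c * Ft A, continuous_const.mul hF, fun x => by
      rw [Pi.smul_apply, smul_eq_mul, hF' x]⟩

/-- Nonslip functions: weakly pattern equivariant `F` for which there is `ε > 0` such that the
inducing function takes equal values on any two members of the transversal that have the same
image in the maximal equicontinuous factor and agree out to radius `1/ε`. -/
def Nonslip {d : ℕ} (Λ : Set (Eucl d)) : Submodule ℝ (Λ → ℝ) where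
  carrier := {F | ∃ Ft, Induces Λ Ft F ∧ ∃ ε : ℝ, 0 < ε ∧ ∀ A B : Transversal Λ,
    MaxEquicontinuousRel Λ A B → AgreeTo ε⁻¹ (A : Set (Eucl d)) B → Ft A = Ft B}
  zero_mem' := ⟨fun _ => 0, ⟨continuous_const, fun _ => rfl⟩, 1, one_pos, fun _ _ _ _ => rfl⟩
  add_mem' := by
    rintro F G ⟨Ft, ⟨hF, hF'⟩, ε, hε, h⟩ ⟨Gt, ⟨hG, hG'⟩, ε', hε', h'⟩
    have hm := lt_min hε hε'
    refine ⟨fun A => Ft A + Gt A,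
      ⟨hF.add hG, fun x => by rw [Pi.add_apply, hF' x, hG' x]⟩, min ε ε', hm,
      fun A B hAB hag => ?_⟩
    change Ft A + Gt A = Ft B + Gt B
    rw [h A B hAB (hag.mono (inv_anti₀ hm (min_le_left _ _))),
      h' A B hAB (hag.mono (inv_anti₀ hm (min_le_right _ _)))]
  smul_mem' := by
    rintro c F ⟨Ft, ⟨hF, hF'⟩, ε, hε, h⟩
    refine ⟨fun A => c * Ft A, ⟨continuous_const.mul hF, fun x => by
      rw [Pi.smul_apply, smul_eq_mul, hF' x]⟩, ε, hε, fun A B hAB hag => ?_⟩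
    change c * Ft A = c * Ft B
    rw [h A B hAB hag]

/-- `H¹_an(Λ, ℝ)`: asymptotically negligible classes. -/
def H1an {d : ℕ} (Λ : Set (Eucl d)) : Submodule ℝ (H1 Λ) := classesOf Λ (WPE Λ)

/-- `H¹_ns(Λ, ℝ)`: classes of nonslip generators. -/
def H1ns {d : ℕ} (Λ : Set (Eucl d)) : Submodule ℝ (H1 Λ) := classesOf Λ (Nonslip Λ)

/-! ### Model sets -/

/-- A cut and project scheme: `Γ` is a lattice (discrete and cocompact subgroup) in `H × ℝᵈ`, the
projection to `ℝᵈ` is injective on `Γ`, and the projection of `Γ` to `H` is dense. -/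
structure IsCutProjectScheme {d : ℕ} {H : Type} [AddCommGroup H] [TopologicalSpace H]
    (Γ : AddSubgroup (H × Eucl d)) : Prop where
  discrete : DiscreteTopology Γ
  cocompact : CompactSpace ((H × Eucl d) ⧸ Γ)
  injOn : Set.InjOn Prod.snd (Γ : Set (H × Eucl d))
  dense : Dense (Prod.fst '' (Γ : Set (H × Eucl d)))

/-- A window: a nonempty compact set that is the closure of its interior and is not invariant
under any nontrivial translation. -/
structure IsWindow {H : Type} [AddCommGroup H] [TopologicalSpace H] (W : Set H) : Prop where
  nonempty : W.Nonempty
  compact : IsCompact W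
  closure_interior : closure (interior W) = W
  aperiodic : ∀ h : H, (fun w => w + h) '' W = W → h = 0

/-- The projection set `{π^∥(γ) : γ ∈ (W × ℝᵈ) ∩ (Γ + ξ)}`. -/
def projSet {d : ℕ} {H : Type} [AddCommGroup H] (Γ : AddSubgroup (H × Eucl d)) (W : Set H)
    (ξ : H × Eucl d) : Set (Eucl d) :=
  {x | ∃ γ ∈ Γ, (γ + ξ).1 ∈ W ∧ (γ + ξ).2 = x}

/-- `ξ` is non-singular: `π^⊥(Γ + ξ)` does not meet the boundary of the window. -/
def NonSingular {d : ℕ} {H : Type} [AddCommGroup H] [TopologicalSpace H]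
    (Γ : AddSubgroup (H × Eucl d)) (W : Set H) (ξ : H × Eucl d) : Prop :=
  ∀ γ ∈ Γ, (γ + ξ).1 ∉ frontier W

/-- A model set is an element of the hull of a projection set with non-singular parameter. -/
def IsModelSet {d : ℕ} {H : Type} [AddCommGroup H] [TopologicalSpace H]
    (Γ : AddSubgroup (H × Eucl d)) (W : Set H) (M : Set (Eucl d)) : Prop :=
  ∃ ξ, NonSingular Γ W ξ ∧ M ∈ Hull (projSet Γ W ξ)

/-- The non-singular model sets. -/
def nonSingularSets {d : ℕ} {H : Type} [AddCommGroup H] [TopologicalSpace H]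
    (Γ : AddSubgroup (H × Eucl d)) (W : Set H) : Set (Set (Eucl d)) :=
  {A | ∃ ξ, NonSingular Γ W ξ ∧ A = projSet Γ W ξ}

open Classical in
/-- The parameter, in the torus `(H × ℝᵈ)/Γ`, of a non-singular model set. -/
noncomputable def torusParam {d : ℕ} {H : Type} [AddCommGroup H] [TopologicalSpace H]
    (Γ : AddSubgroup (H × Eucl d)) (W : Set H) (A : Set (Eucl d)) : (H × Eucl d) ⧸ Γ :=
  if h : A ∈ nonSingularSets Γ W then QuotientAddGroup.mk h.choose else 0

/-- The torus parametrization of all model sets with window `W`: the extension by continuity of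
the map sending a non-singular model set to its parameter. -/
noncomputable def torusParametrization {d : ℕ} {H : Type} [AddCommGroup H] [TopologicalSpace H]
    (Γ : AddSubgroup (H × Eucl d)) (W : Set H) : Set (Eucl d) → (H × Eucl d) ⧸ Γ :=
  extendFrom (nonSingularSets Γ W) (torusParam Γ W)

open Classical in
/-- The star map `σ_M`: `σ_M(x)` is the unique `h ∈ H` with `(h, x) ∈ Γ + ξ`, where `ξ` is the
torus parameter of `M`. -/
noncomputable def starMap {d : ℕ} {H : Type} [AddCommGroup H] [TopologicalSpace H]
    (Γ : AddSubgroup (H × Eucl d)) (W : Set H) (M : Set (Eucl d)) (x : Eucl d) : H :=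
  if h : ∃ u : H, (QuotientAddGroup.mk (u, x) : (H × Eucl d) ⧸ Γ) = torusParametrization Γ W M
  then h.choose else 0

/-- Generators of reprojections: `F_L(x) = L(σ_M(x))` for `L : H → ℝ` a continuous group
homomorphism. -/
def Reprojection {d : ℕ} {H : Type} [AddCommGroup H] [TopologicalSpace H]
    (Γ : AddSubgroup (H × Eucl d)) (W : Set H) (M : Set (Eucl d)) : Submodule ℝ (M → ℝ) where
  carrier := {F | ∃ L : H →+ ℝ, Continuous L ∧ ∀ x : M, F x = L (starMap Γ W M x)}
  zero_mem' := ⟨0, continuous_const, fun _ => rfl⟩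
  add_mem' := by
    rintro F G ⟨L, hL, hF⟩ ⟨L', hL', hG⟩
    exact ⟨L + L', hL.add hL', fun x => by rw [Pi.add_apply, hF x, hG x]; rfl⟩
  smul_mem' := by
    rintro c F ⟨L, hL, hF⟩
    exact ⟨(AddMonoidHom.mulLeft c).comp L, continuous_const.mul hL, fun x => by
      rw [Pi.smul_apply, hF x]; rfl⟩

/-- `H¹_repr(M, ℝ)`: classes of reprojections. -/
def H1repr {d : ℕ} {H : Type} [AddCommGroup H] [TopologicalSpace H]
    (Γ : AddSubgroup (H × Eucl d)) (W : Set H) (M : Set (Eucl d)) : Submodule ℝ (H1 M) :=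
  classesOf M (Reprojection Γ W M)

/-- A (compact, not necessarily convex or connected) polyhedron in `ℝⁿ`: a finite union of convex
polytopes. -/
def IsPolyhedron {n : ℕ} (P : Set (Eucl n)) : Prop :=
  ∃ S : Set (Finset (Eucl n)), S.Finite ∧ P = ⋃ s ∈ S, convexHull ℝ (s : Set (Eucl n))

/-- A subset of `ℝⁿ × C` that is a finite disjoint union of polyhedra, each of them contained in
one of the slices `ℝⁿ × {c}`. -/
def IsPolyhedral {n : ℕ} {C : Type} (W : Set (Eucl n × C)) : Prop :=
  ∃ (k : ℕ) (P : Fin k → Set (Eucl n)) (c : Fin k → C),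
    (∀ i, IsPolyhedron (P i)) ∧
    Pairwise (fun i j => Disjoint (P i ×ˢ {c i}) (P j ×ˢ {c j})) ∧
    W = ⋃ i, P i ×ˢ {c i}

/-! ### The pattern topology and compact sets of patterns -/

section Patterns

variable {d : ℕ}

/-! The inclusions repr ⊆ ns ⊆ an are soft. The relation "M lies between the projection sets of the
interior of W and of W with parameter ξ" is closed (`isClosed_torusRel`) and, W being aperiodic,
determines ξ modulo Γ (`Sandwiched.unique`). So it is the graph of a continuous equivariant map from
the hull onto the compact torus (H × ℝᵈ)/Γ. The torus is therefore an equicontinuous factor, and the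
star value at 0 is a continuous function on the transversal that depends on the image in this factor
only.

The content is an ⊆ repr. Let F be weakly pattern equivariant with δF strongly so. Read F as a
function f of the internal parameter in W, off the countably many lattice translates of the
hyperplanes that carry ∂W. Then f is approximated by functions of finite patches, and its increments
along lattice vectors are exactly functions of finite patches (`IsPatternFunction`).

A priori f may jump across any of these hyperplanes; for each normal l it does so for only finitely
many b (`IsPatternFunction.exists_exceptional`). Indeed, some linear functionals on ℝⁿ × ℝᵈ, none
zero on ℝᵈ, depend on the lattice only through l (`exists_transverse_functionals`). Hence the places
where the patterns on the two sides of l = b differ lie in a slab of physical space, for every such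
functional. If one of these slabs is far from the origin, walk away from it: all increments on the
way agree, and at the end even large patches agree, so the values at the end, hence those at the
start, differ by at most ε. Only finitely many b have all their slabs close to the origin.

So f is uniformly continuous off finitely many hyperplanes (`IsPatternFunction.exists_modulus`).
Increments along a lattice vector take finitely many values, hence are constant on connected sets
where f is continuous. As Γ is dense in H, f is locally affine with one linear part L everywhere,
and f - L has finitely many values (`IsPatternFunction.exists_linear`). A continuous function with
finitely many values on the compact transversal is determined by a patch of fixed size, so F and L ∘
σ differ by a strongly pattern equivariant function. -/

@[simp] theorem mem_shift {A : Set (Eucl d)} {x y : Eucl d} : y ∈ shift A x ↔ y + x ∈ A := Iff.rfl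

theorem shift_shift (A : Set (Eucl d)) (x y : Eucl d) :
    shift (shift A x) y = shift A (y + x) := by
  ext z
  simp [add_assoc]

@[simp] theorem shift_zero (A : Set (Eucl d)) : shift A 0 = A := by
  ext z
  simp

theorem agreeTo_iff {R : ℝ} {A B : Set (Eucl d)} :
    AgreeTo R A B ↔ ∀ x, ‖x‖ ≤ R → (x ∈ A ↔ x ∈ B) := by
  unfold AgreeTo
  rw [Set.ext_iff]
  refine forall_congr' fun x => ?_
  simp only [Set.mem_inter_iff, mem_closedBall_zero_iff]
  tauto

theorem AgreeTo.refl (R : ℝ) (A : Set (Eucl d)) : AgreeTo R A A := rfl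

theorem AgreeTo.symm {R : ℝ} {A B : Set (Eucl d)} (h : AgreeTo R A B) : AgreeTo R B A :=
  Eq.symm h

theorem AgreeTo.trans {R : ℝ} {A B D : Set (Eucl d)} (h : AgreeTo R A B) (h' : AgreeTo R B D) :
    AgreeTo R A D :=
  Eq.trans h h'

theorem AgreeTo.shift {R : ℝ} {A B : Set (Eucl d)} (h : AgreeTo R A B) {R' : ℝ} {x : Eucl d}
    (hx : R' + ‖x‖ ≤ R) : AgreeTo R' (shift A x) (shift B x) := by
  rw [agreeTo_iff] at *
  intro y hy
  exact h (y + x) ((norm_add_le _ _).trans (by linarith))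

theorem EpsClose.refl {ε : ℝ} (hε : 0 < ε) (A : Set (Eucl d)) : EpsClose ε A A :=
  ⟨0, by simpa using hε, by rw [shift_zero]; exact AgreeTo.refl _ _⟩

theorem AgreeTo.epsClose {ε : ℝ} (hε : 0 < ε) {A B : Set (Eucl d)} (h : AgreeTo ε⁻¹ A B) :
    EpsClose ε A B :=
  ⟨0, by simpa using hε, by rwa [shift_zero]⟩

theorem EpsClose.trans_agreeTo {ε : ℝ} {A B D : Set (Eucl d)} (h : EpsClose ε A B)
    (h' : AgreeTo ε⁻¹ B D) : EpsClose ε A D := by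
  obtain ⟨t, ht, hag⟩ := h
  exact ⟨t, ht, hag.trans h'⟩

/-- Applying the second translation costs less than 1/2 in radius, which the doubled radius 2/ε
absorbs because 1/ε ≥ 1. -/
theorem EpsClose.trans {ε : ℝ} (hε : 0 < ε) (hε1 : ε ≤ 1) {A B D : Set (Eucl d)}
    (h : EpsClose (ε / 2) A B) (h' : EpsClose (ε / 2) B D) : EpsClose ε A D := by
  obtain ⟨t, ht, hag⟩ := h
  obtain ⟨s, hs, hag'⟩ := h'
  refine ⟨s + t, (norm_add_le _ _).trans_lt (by linarith), ?_⟩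
  have h1 : (1 : ℝ) ≤ ε⁻¹ := (one_le_inv₀ hε).2 hε1
  have h2 : (ε / 2)⁻¹ = 2 * ε⁻¹ := by
    field_simp
  rw [← shift_shift]
  refine AgreeTo.trans (hag.shift (R' := ε⁻¹) ?_) (hag'.mono ?_)
  · rw [h2]; linarith
  · rw [h2]; linarith

theorem isOpen_pattern_iff {U : Set (Set (Eucl d))} :
    IsOpen U ↔ ∀ A ∈ U, ∃ ε : ℝ, 0 < ε ∧ ∀ B, EpsClose ε A B → B ∈ U :=
  Iff.rfl

/-- The topology is given by its open sets only; the approximate triangle inequality is what makes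
the ε-close patterns a neighbourhood. -/
theorem mem_nhds_pattern_iff {A : Set (Eucl d)} {s : Set (Set (Eucl d))} :
    s ∈ 𝓝 A ↔ ∃ ε : ℝ, 0 < ε ∧ ∀ B, EpsClose ε A B → B ∈ s := by
  constructor
  · intro h
    obtain ⟨U, hU, hUo, hA⟩ := mem_nhds_iff.1 h
    obtain ⟨ε, hε, h'⟩ := isOpen_pattern_iff.1 hUo A hA
    exact ⟨ε, hε, fun B hB => hU (h' B hB)⟩
  · rintro ⟨ε, hε, h⟩
    refine mem_nhds_iff.2 ⟨{B | ∃ δ : ℝ, 0 < δ ∧ ∀ D, EpsClose δ B D → D ∈ s}, ?_, ?_, ⟨ε, hε, h⟩⟩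
    · rintro B ⟨δ, hδ, hB⟩
      exact hB B (EpsClose.refl hδ B)
    · refine isOpen_pattern_iff.2 ?_
      rintro B ⟨δ, hδ, hB⟩
      have hm : 0 < min δ 1 := lt_min hδ one_pos
      refine ⟨min δ 1 / 2, by positivity, fun D hD => ⟨min δ 1 / 2, by positivity, fun D' hD' => ?_⟩⟩
      exact hB D' ((EpsClose.trans hm (min_le_right _ _) hD hD').mono hm (min_le_left _ _))

theorem mem_closure_pattern_iff {A : Set (Eucl d)} {s : Set (Set (Eucl d))} :
    A ∈ closure s ↔ ∀ ε : ℝ, 0 < ε → ∃ B ∈ s, EpsClose ε A B := by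
  rw [mem_closure_iff_nhds]
  constructor
  · intro h ε hε
    obtain ⟨B, hB, hBs⟩ := h {B | EpsClose ε A B} (mem_nhds_pattern_iff.2 ⟨ε, hε, fun _ h => h⟩)
    exact ⟨B, hBs, hB⟩
  · intro h t ht
    obtain ⟨ε, hε, h'⟩ := mem_nhds_pattern_iff.1 ht
    obtain ⟨B, hBs, hB⟩ := h ε hε
    exact ⟨B, h' B hB, hBs⟩

/-- The subsets of a locally finite set form a compact set of patterns. -/
theorem isCompact_powerset {Δ : Set (Eucl d)}
    (hΔ : ∀ R : ℝ, (Δ ∩ Metric.closedBall 0 R).Finite) : IsCompact {A | A ⊆ Δ} := by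
  -- The powerset of Δ is the image of the Cantor space {0,1}^Δ. The map is continuous since a
  -- bounded patch involves finitely many coordinates.
  let φ : (Δ → Bool) → Set (Eucl d) := fun b => {x | ∃ h : x ∈ Δ, b ⟨x, h⟩ = true}
  have hφ : Continuous φ := by
    refine continuous_iff_continuousAt.2 fun b => ?_
    intro s hs
    obtain ⟨ε, hε, h⟩ := mem_nhds_pattern_iff.1 hs
    have hfin : {x : Δ | ‖(x : Eucl d)‖ ≤ ε⁻¹}.Finite := by
      refine Set.Finite.of_finite_image (f := Subtype.val) ((hΔ ε⁻¹).subset ?_)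
        Subtype.val_injective.injOn
      rintro _ ⟨x, hx, rfl⟩
      exact ⟨x.2, by simpa using hx⟩
    have hmem : {b' : Δ → Bool | ∀ x ∈ {x : Δ | ‖(x : Eucl d)‖ ≤ ε⁻¹}, b' x = b x} ∈ 𝓝 b := by
      have : {b' : Δ → Bool | ∀ x ∈ {x : Δ | ‖(x : Eucl d)‖ ≤ ε⁻¹}, b' x = b x} =
          ⋂ x ∈ {x : Δ | ‖(x : Eucl d)‖ ≤ ε⁻¹}, {b' | b' x = b x} := by
        ext b'; simp
      rw [this]
      refine (Filter.biInter_mem hfin).2 fun x _ => ?_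
      have hc : ContinuousAt (fun b' : Δ → Bool => b' x) b := (continuous_apply x).continuousAt
      exact hc.eventually (p := fun y => y = b x)
        ((isOpen_discrete ({b x} : Set Bool)).mem_nhds rfl)
    refine Filter.mem_map.2 (Filter.mem_of_superset hmem fun b' hb' => ?_)
    refine h _ (AgreeTo.epsClose hε (agreeTo_iff.2 fun x hx => ?_))
    constructor
    · rintro ⟨h1, h2⟩
      exact ⟨h1, by rw [hb' ⟨x, h1⟩ hx]; exact h2⟩
    · rintro ⟨h1, h2⟩
      exact ⟨h1, by rw [← hb' ⟨x, h1⟩ hx]; exact h2⟩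
  have hrange : {A | A ⊆ Δ} = Set.range φ := by
    classical
    ext A
    constructor
    · intro hA
      refine ⟨fun x => decide ((x : Eucl d) ∈ A), ?_⟩
      ext x
      simp only [φ, Set.mem_ofPred_eq, decide_eq_true_eq]
      exact ⟨fun ⟨_, h⟩ => h, fun h => ⟨hA h, h⟩⟩
    · rintro ⟨b, rfl⟩ x ⟨h, _⟩
      exact h
  rw [hrange]
  exact isCompact_range hφ

/-- A continuous function on a compact set of patterns is, up to `ε`, determined by a patch of
bounded size. -/
theorem exists_agreeTo_abs_sub_lt {K : Set (Set (Eucl d))} (hK : IsCompact K) {G : K → ℝ}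
    (hG : Continuous G) {ε : ℝ} (hε : 0 < ε) :
    ∃ R : ℝ, 0 < R ∧ ∀ A B : K, AgreeTo R (A : Set (Eucl d)) B → |G A - G B| < ε := by
  have h1 : ∀ A : K, ∃ η : ℝ, 0 < η ∧ ∀ B : K, EpsClose η (A : Set (Eucl d)) B →
      |G B - G A| < ε / 2 := by
    intro A
    have h2 : {B : K | |G B - G A| < ε / 2} ∈ 𝓝 A := by
      have := (Metric.continuous_iff'.1 hG A (ε / 2) (by positivity))
      simp only [Real.dist_eq] at this
      exact this
    rw [nhds_subtype] at h2
    obtain ⟨s, hs, hs'⟩ := Filter.mem_comap.1 h2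
    obtain ⟨η, hη, h⟩ := mem_nhds_pattern_iff.1 hs
    exact ⟨η, hη, fun B hB => hs' (h B hB)⟩
  choose η hη h using h1
  have hKc : IsCompact (Set.univ : Set K) := isCompact_iff_isCompact_univ.1 hK
  obtain ⟨t, -, ht⟩ := hKc.elim_nhds_subcover (fun A => {B : K | EpsClose (η A) (A : Set (Eucl d)) B})
    (fun A _ => by
      rw [nhds_subtype]
      exact Filter.mem_comap.2 ⟨{B | EpsClose (η A) (A : Set (Eucl d)) B},
        mem_nhds_pattern_iff.2 ⟨η A, hη A, fun _ h => h⟩, fun _ h => h⟩)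
  -- Any bound of the finitely many radii 1/η works. If A is close to a centre D of the cover and B
  -- agrees with A this far, then B is close to the same D.
  refine ⟨1 + ∑ A ∈ t, (η A)⁻¹, by
    have := Finset.sum_nonneg (s := t) (fun A _ => (inv_pos.2 (hη A)).le)
    positivity, fun A B hAB => ?_⟩
  obtain ⟨D, hD⟩ := Set.mem_iUnion.1 (ht (Set.mem_univ A))
  obtain ⟨hDt, hDA⟩ := Set.mem_iUnion.1 hD
  have hle : (η D)⁻¹ ≤ 1 + ∑ A ∈ t, (η A)⁻¹ := by
    have := Finset.single_le_sum (fun A _ => (inv_pos.2 (hη A)).le) hDt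
    linarith
  have hDB : EpsClose (η D) (D : Set (Eucl d)) B := hDA.trans_agreeTo (hAB.mono hle)
  have e1 := h D A hDA
  have e2 := h D B hDB
  rw [abs_lt] at *
  constructor <;> linarith [e1.1, e1.2, e2.1, e2.2]

end Patterns

/-! ### The closed relation between patterns and torus parameters -/

section Torus

set_option linter.unusedSectionVars false

/-- A function with values in a compact space tends to `y₀` if it is contained in a closed relation
which relates the base point to `y₀` only. -/
theorem tendsto_of_closed_rel {X Y : Type*} [TopologicalSpace X] [TopologicalSpace Y]
    [CompactSpace Y] {r : Set (X × Y)} (hr : IsClosed r) {S : Set X} {g : X → Y} {x₀ : X} {y₀ : Y}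
    (hg : ∀ x ∈ S, (x, g x) ∈ r) (h₀ : ∀ y, (x₀, y) ∈ r → y = y₀) :
    Filter.Tendsto g (𝓝[S] x₀) (𝓝 y₀) := by
  refine tendsto_nhds.2 fun O hO hy => ?_
  -- The projection along the compact factor is closed, so the base points related to some value
  -- outside O form a closed set, which misses x₀.
  have h := isClosedMap_fst_of_compactSpace (X := X) (Y := Y) _
    (hr.inter (hO.isClosed_compl.preimage continuous_snd))
  have hx : x₀ ∉ Prod.fst '' (r ∩ Prod.snd ⁻¹' Oᶜ) := by
    rintro ⟨⟨x, y⟩, ⟨h1, h2⟩, rfl⟩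
    have := h₀ y h1
    subst this
    exact h2 hy
  filter_upwards [mem_nhdsWithin_of_mem_nhds (h.isOpen_compl.mem_nhds hx), self_mem_nhdsWithin]
    with x hx hxS
  by_contra hcon
  exact hx ⟨(x, g x), ⟨hg x hxS, hcon⟩, rfl⟩

variable {d : ℕ} {H : Type} [AddCommGroup H] [TopologicalSpace H]
  {Γ : AddSubgroup (H × Eucl d)} {W : Set H}

/-- `M` lies between the projection sets of the interior of the window and of the window. -/
def Sandwiched (Γ : AddSubgroup (H × Eucl d)) (W : Set H) (ξ : H × Eucl d)
    (M : Set (Eucl d)) : Prop :=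
  projSet Γ (interior W) ξ ⊆ M ∧ M ⊆ projSet Γ W ξ

theorem mem_projSet {ξ : H × Eucl d} {x : Eucl d} :
    x ∈ projSet Γ W ξ ↔ ∃ γ ∈ Γ, (γ + ξ).1 ∈ W ∧ (γ + ξ).2 = x := Iff.rfl

theorem projSet_add {γ : H × Eucl d} (hγ : γ ∈ Γ) (V : Set H) (ξ : H × Eucl d) :
    projSet Γ V (γ + ξ) = projSet Γ V ξ := by
  ext x
  constructor
  · rintro ⟨β, hβ, h⟩
    exact ⟨β + γ, Γ.add_mem hβ hγ, by rwa [add_assoc]⟩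
  · rintro ⟨β, hβ, h⟩
    refine ⟨β - γ, Γ.sub_mem hβ hγ, ?_⟩
    have e : β - γ + (γ + ξ) = β + ξ := by abel
    rwa [e]

theorem Sandwiched.add {γ : H × Eucl d} (hγ : γ ∈ Γ) {ξ : H × Eucl d} {M : Set (Eucl d)}
    (h : Sandwiched Γ W ξ M) : Sandwiched Γ W (γ + ξ) M := by
  unfold Sandwiched
  rwa [projSet_add hγ, projSet_add hγ]

theorem shift_projSet (V : Set H) (ξ : H × Eucl d) (x : Eucl d) :
    shift (projSet Γ V ξ) x = projSet Γ V (ξ - (0, x)) := by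
  ext y
  simp only [mem_shift, mem_projSet]
  refine exists_congr fun γ => and_congr_right fun _ => ?_
  simp only [Prod.fst_add, Prod.fst_sub, sub_zero, Prod.snd_add, Prod.snd_sub]
  refine and_congr_right fun _ => ?_
  rw [← add_sub_assoc, sub_eq_iff_eq_add]

theorem Sandwiched.shift {ξ : H × Eucl d} {M : Set (Eucl d)} (h : Sandwiched Γ W ξ M)
    (x : Eucl d) : Sandwiched Γ W (ξ - (0, x)) (shift M x) := by
  unfold Sandwiched
  rw [← shift_projSet, ← shift_projSet]
  exact ⟨fun y hy => h.1 hy, fun y hy => h.2 hy⟩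

theorem sandwiched_projSet (ξ : H × Eucl d) : Sandwiched Γ W ξ (projSet Γ W ξ) :=
  ⟨fun _ ⟨γ, hγ, h1, h2⟩ => ⟨γ, hγ, interior_subset h1, h2⟩, subset_rfl⟩

/-- The graph of the torus parametrization. -/
def torusRel (Γ : AddSubgroup (H × Eucl d)) (W : Set H) :
    Set (Set (Eucl d) × ((H × Eucl d) ⧸ Γ)) :=
  {p | ∃ ξ : H × Eucl d, QuotientAddGroup.mk ξ = p.2 ∧ Sandwiched Γ W ξ p.1}

/-- Changing ξ by a lattice vector does not change the projection sets, so any representative may be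
used. -/
theorem mem_torusRel {M : Set (Eucl d)} {ξ : H × Eucl d} :
    (M, (QuotientAddGroup.mk ξ : (H × Eucl d) ⧸ Γ)) ∈ torusRel Γ W ↔ Sandwiched Γ W ξ M := by
  constructor
  · rintro ⟨ξ', h, h'⟩
    have hmem : -ξ' + ξ ∈ Γ := QuotientAddGroup.eq.1 h
    have e : ξ = (-ξ' + ξ) + ξ' := by abel
    rw [e]
    exact h'.add hmem
  · intro h
    exact ⟨ξ, rfl, h⟩

theorem snd_injOn (hΓ : IsCutProjectScheme Γ) {γ β : H × Eucl d} (hγ : γ ∈ Γ) (hβ : β ∈ Γ)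
    (h : γ.2 = β.2) : γ = β := hΓ.injOn hγ hβ h

variable [IsTopologicalAddGroup H] [T2Space H]

theorem isClosed_lattice (hΓ : IsCutProjectScheme Γ) : IsClosed (Γ : Set (H × Eucl d)) := by
  have := hΓ.discrete
  exact AddSubgroup.isClosed_of_discrete

theorem finite_lattice_inter (hΓ : IsCutProjectScheme Γ) {K : Set H} (hK : IsCompact K) (ρ : ℝ) :
    {γ : H × Eucl d | γ ∈ Γ ∧ γ.1 ∈ K ∧ ‖γ.2‖ ≤ ρ}.Finite := by
  have hc : IsCompact (K ×ˢ Metric.closedBall (0 : Eucl d) ρ) :=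
    hK.prod (isCompact_closedBall _ _)
  have h1 : IsCompact ((K ×ˢ Metric.closedBall (0 : Eucl d) ρ) ∩ (Γ : Set (H × Eucl d))) :=
    hc.inter_right (isClosed_lattice hΓ)
  have hd : IsDiscrete ((K ×ˢ Metric.closedBall (0 : Eucl d) ρ) ∩ (Γ : Set (H × Eucl d))) := by
    have h2 : IsDiscrete (Γ : Set (H × Eucl d)) := ⟨hΓ.discrete⟩
    exact h2.mono Set.inter_subset_right
  refine (h1.finite hd).subset ?_
  rintro γ ⟨h1, h2, h3⟩
  exact ⟨⟨h2, by simpa using h3⟩, h1⟩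

theorem finite_projSet_inter (hΓ : IsCutProjectScheme Γ) (hW : IsCompact W) (ξ : H × Eucl d)
    (R : ℝ) : (projSet Γ W ξ ∩ Metric.closedBall 0 R).Finite := by
  have hK : IsCompact ((fun w => w - ξ.1) '' W) := hW.image (by fun_prop)
  refine ((finite_lattice_inter hΓ hK (R + ‖ξ.2‖)).image (fun γ => (γ + ξ).2)).subset ?_
  rintro _ ⟨⟨γ, hγ, h1, rfl⟩, h2⟩
  refine ⟨γ, ⟨hγ, ⟨_, h1, by simp⟩, ?_⟩, rfl⟩
  rw [mem_closedBall_zero_iff] at h2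
  have : γ.2 = (γ + ξ).2 - ξ.2 := by simp
  rw [this]
  exact (norm_sub_le _ _).trans (by linarith)

theorem isCompact_sub_window (hW : IsCompact W) (V : Set H) (hV : IsCompact V) :
    IsCompact ((fun p : H × H => p.1 - p.2) '' (W ×ˢ V)) :=
  (hW.prod hV).image (by fun_prop)

/-- A bounded patch involves finitely many lattice points, and membership in the closed set W,
non-membership in it, and membership in its open interior behave well in the limit on the
appropriate side. -/
theorem isClosed_torusRel [LocallyCompactSpace H] (hΓ : IsCutProjectScheme Γ) (hW : IsCompact W) :
    IsClosed (torusRel Γ W) := by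
  refine isClosed_of_closure_subset ?_
  rintro ⟨M, τ⟩ hcl
  obtain ⟨ξ₀, rfl⟩ := QuotientAddGroup.mk_surjective τ
  rw [mem_torusRel]
  -- Near a limit point (M, ξ₀) there are sandwiched patterns B with a parameter ξ near ξ₀ and a
  -- translation t near 0 satisfying any prescribed condition that holds near (ξ₀, 0).
  have key : ∀ (ε : ℝ), 0 < ε → ∀ p : (H × Eucl d) × Eucl d → Prop,
      (∀ᶠ z in 𝓝 (ξ₀, (0 : Eucl d)), p z) → ∃ B ξ t, p (ξ, t) ∧ AgreeTo ε⁻¹ (shift M t) B ∧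
        Sandwiched Γ W ξ B := by
    intro ε hε p hp
    rw [nhds_prod_eq, Filter.eventually_prod_iff] at hp
    obtain ⟨pa, hpa, pb, hpb, hpab⟩ := hp
    obtain ⟨η, hη, hη'⟩ := Metric.eventually_nhds_iff.1 hpb
    have hm : 0 < min ε η := lt_min hε hη
    have h1 : {B | EpsClose (min ε η) M B} ×ˢ
        ((QuotientAddGroup.mk : H × Eucl d → (H × Eucl d) ⧸ Γ) '' {ξ | pa ξ}) ∈
        𝓝 (M, (QuotientAddGroup.mk ξ₀ : (H × Eucl d) ⧸ Γ)) :=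
      prod_mem_nhds (mem_nhds_pattern_iff.2 ⟨_, hm, fun _ h => h⟩)
        (QuotientAddGroup.isOpenMap_coe.image_mem_nhds hpa)
    obtain ⟨⟨B, τ⟩, ⟨hB, ⟨ξ, hξ, hξτ⟩⟩, hr⟩ := mem_closure_iff_nhds.1 hcl _ h1
    obtain ⟨t, ht, hag⟩ := hB
    simp only at hξτ
    rw [← hξτ, mem_torusRel] at hr
    refine ⟨B, ξ, t, hpab hξ (hη' ?_), hag.mono (inv_anti₀ hm (min_le_left _ _)), hr⟩
    rw [dist_zero_right]
    exact ht.trans_le (min_le_right _ _)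
  obtain ⟨V, hV, hVn⟩ := exists_compact_mem_nhds ξ₀.1
  have hev : ∀ᶠ z : (H × Eucl d) × Eucl d in 𝓝 (ξ₀, (0 : Eucl d)),
      z.1.1 ∈ V ∧ ‖z.1.2 - ξ₀.2‖ < 1 ∧ ‖z.2‖ < 1 := by
    have c1 : ContinuousAt (fun z : (H × Eucl d) × Eucl d => z.1.1) (ξ₀, 0) := by fun_prop
    have c2 : ContinuousAt (fun z : (H × Eucl d) × Eucl d => ‖z.1.2 - ξ₀.2‖) (ξ₀, 0) := by fun_prop
    have c3 : ContinuousAt (fun z : (H × Eucl d) × Eucl d => ‖z.2‖) (ξ₀, 0) := by fun_prop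
    refine (c1.eventually hVn).and ((c2.eventually_lt_const ?_).and (c3.eventually_lt_const ?_)) <;>
      simp
  -- Were y not in the projection set, each of the finitely many lattice points able to produce y
  -- would still fail to do so for nearby (ξ, t).
  have hsub : M ⊆ projSet Γ W ξ₀ := by
    intro y hy
    by_contra hcon
    have hF := finite_lattice_inter hΓ (isCompact_sub_window hW V hV) (‖y‖ + ‖ξ₀.2‖ + 2)
    have hev' : ∀ γ ∈ {γ : H × Eucl d | γ ∈ Γ ∧ γ.1 ∈ (fun p : H × H => p.1 - p.2) '' (W ×ˢ V) ∧
        ‖γ.2‖ ≤ ‖y‖ + ‖ξ₀.2‖ + 2}, ∀ᶠ z : (H × Eucl d) × Eucl d in 𝓝 (ξ₀, (0 : Eucl d)),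
        ¬ ((γ + z.1).1 ∈ W ∧ (γ + z.1).2 + z.2 = y) := by
      rintro γ ⟨hγ, -, -⟩
      have hcl : IsClosed {z : (H × Eucl d) × Eucl d | (γ + z.1).1 ∈ W ∧ (γ + z.1).2 + z.2 = y} :=
        (hW.isClosed.preimage (by fun_prop)).inter (isClosed_eq (by fun_prop) (by fun_prop))
      refine hcl.isOpen_compl.mem_nhds ?_
      rintro ⟨h1, h2⟩
      exact hcon ⟨γ, hγ, h1, by simpa using h2⟩
    obtain ⟨B, ξ, t, ⟨⟨h1, h2, h3⟩, h4⟩, hag, hS⟩ := key ((‖y‖ + 1)⁻¹) (by positivity) _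
      (hev.and ((Filter.eventually_all_finite hF).2 hev'))
    rw [inv_inv, agreeTo_iff] at hag
    have hyB : y - t ∈ B := (hag (y - t) ((norm_sub_le _ _).trans (by linarith))).1 (by simpa)
    obtain ⟨γ, hγ, hγ1, hγ2⟩ := hS.2 hyB
    refine h4 γ ⟨hγ, ⟨((γ + ξ).1, ξ.1), ⟨hγ1, h1⟩, by simp⟩, ?_⟩ ⟨hγ1, ?_⟩
    · have : γ.2 = y - t - (ξ.2 - ξ₀.2) - ξ₀.2 := by
        rw [← hγ2, Prod.snd_add]; abel
      rw [this]
      refine (norm_sub_le _ _).trans ?_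
      have := norm_sub_le (y - t) (ξ.2 - ξ₀.2)
      have := norm_sub_le y t
      linarith
    · simp only [hγ2, sub_add_cancel]
  refine ⟨?_, hsub⟩
  rintro y ⟨γ, hγ, h1, h2⟩
  -- The point over the interior of W survives in B and yields a point of M close to y. Both belong
  -- to the projection set at ξ₀, so they differ by a lattice vector over W - W of physical length
  -- at most 2; these are finitely many, and a small enough difference must vanish.
  have hF := finite_lattice_inter hΓ (isCompact_sub_window hW W hW) 2
  have hev' : ∀ δ ∈ {γ : H × Eucl d | γ ∈ Γ ∧ γ.1 ∈ (fun p : H × H => p.1 - p.2) '' (W ×ˢ W) ∧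
        ‖γ.2‖ ≤ 2}, ∀ᶠ z : (H × Eucl d) × Eucl d in 𝓝 (ξ₀, (0 : Eucl d)),
        δ.2 ≠ 0 → z.1.2 - ξ₀.2 + z.2 ≠ δ.2 := by
    rintro δ -
    by_cases hδ : δ.2 = 0
    · exact Filter.Eventually.of_forall fun _ h => absurd hδ h
    · have hc : ContinuousAt (fun z : (H × Eucl d) × Eucl d => z.1.2 - ξ₀.2 + z.2) (ξ₀, 0) := by
        fun_prop
      have := hc.eventually_ne (by simpa using Ne.symm hδ : _ ≠ δ.2)
      exact this.mono fun z hz _ => hz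
  have hevW : ∀ᶠ z : (H × Eucl d) × Eucl d in 𝓝 (ξ₀, (0 : Eucl d)),
      (γ + z.1).1 ∈ interior W := by
    have hc : ContinuousAt (fun z : (H × Eucl d) × Eucl d => (γ + z.1).1) (ξ₀, 0) := by fun_prop
    exact hc.eventually (isOpen_interior.mem_nhds h1)
  obtain ⟨B, ξ, t, ⟨⟨_, e2, e3⟩, e4, e5⟩, hag, hS⟩ := key ((‖y‖ + 1)⁻¹) (by positivity) _
      (hev.and (((Filter.eventually_all_finite hF).2 hev').and hevW))
  rw [inv_inv, agreeTo_iff] at hag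
  have hB : (γ + ξ).2 ∈ B := hS.1 ⟨γ, hγ, e5, rfl⟩
  have hexp : (γ + ξ).2 = y + (ξ.2 - ξ₀.2) := by
    rw [← h2]; simp only [Prod.snd_add]; abel
  have hM : (γ + ξ).2 + t ∈ M := (hag _ (by
    rw [hexp]; exact (norm_add_le _ _).trans (by linarith))).2 hB
  obtain ⟨γ', hγ', g1, g2⟩ := hsub hM
  have hd2 : (γ' - γ).2 = ξ.2 - ξ₀.2 + t := by
    have : γ'.2 + ξ₀.2 = γ.2 + ξ.2 + t := by simpa using g2
    rw [Prod.snd_sub, sub_eq_iff_eq_add, eq_comm, ← sub_eq_zero]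
    have h3 := sub_eq_zero.2 this
    rw [← neg_eq_zero, ← h3]
    abel
  have hz : (γ' - γ).2 = 0 := by
    by_contra hne
    refine e4 (γ' - γ) ⟨Γ.sub_mem hγ' hγ, ⟨((γ' + ξ₀).1, (γ + ξ₀).1), ⟨g1, interior_subset h1⟩,
      by simp⟩, ?_⟩ hne hd2.symm
    rw [hd2]
    exact (norm_add_le _ _).trans (by linarith)
  have : (γ + ξ).2 + t = y := by
    rw [hexp, add_assoc, ← hd2, hz, add_zero]
  rwa [this] at hM

end Torus

/-! ### Uniqueness of the parameter, and continuity of the star map -/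

section TorusParametrization

set_option linter.unusedSectionVars false

variable {d : ℕ} {H : Type} [AddCommGroup H] [TopologicalSpace H] [IsTopologicalAddGroup H]
  {Γ : AddSubgroup (H × Eucl d)} {W : Set H} {M : Set (Eucl d)} {ξ : H × Eucl d}

theorem exists_lattice_add_mem (hΓ : IsCutProjectScheme Γ) {O : Set H} (hO : IsOpen O)
    (hne : O.Nonempty) (h : H) : ∃ γ ∈ Γ, γ.1 + h ∈ O := by
  have hO' : IsOpen ((fun x => x + h) ⁻¹' O) := hO.preimage (by fun_prop)
  obtain ⟨w, hw⟩ := hne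
  obtain ⟨x, hx, γ, hγ, rfl⟩ := hΓ.dense.inter_open_nonempty _ hO' ⟨w - h, by simpa using hw⟩
  exact ⟨γ, hγ, hx⟩

theorem IsWindow.interior_nonempty (hW : IsWindow W) : (interior W).Nonempty := by
  rw [Set.nonempty_iff_ne_empty]
  intro h
  have h1 := hW.closure_interior
  rw [h, closure_empty] at h1
  exact hW.nonempty.ne_empty h1.symm

/-- The pattern remembers its window: the star image contains a dense part of the interior of W, and
W is the closure of that interior. -/
theorem Sandwiched.closure_star_image (hΓ : IsCutProjectScheme Γ) (hW : IsWindow W) [T2Space H]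
    (h : Sandwiched Γ W ξ M) :
    closure ((fun z => z + ξ.1) '' (Prod.fst '' {γ : H × Eucl d | γ ∈ Γ ∧ γ.2 + ξ.2 ∈ M})) = W := by
  refine subset_antisymm (closure_minimal ?_ hW.compact.isClosed) ?_
  · rintro _ ⟨_, ⟨γ, ⟨hγ, hγM⟩, rfl⟩, rfl⟩
    obtain ⟨β, hβ, h1, h2⟩ := h.2 hγM
    have : β = γ := snd_injOn hΓ hβ hγ (by simpa using h2)
    subst this
    exact h1
  · rw [← hW.closure_interior]
    refine closure_minimal (fun w hw => mem_closure_iff.2 fun O hO hwO => ?_) isClosed_closure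
    obtain ⟨γ, hγ, hγO⟩ := exists_lattice_add_mem hΓ (hO.inter isOpen_interior) ⟨w, hwO, hw⟩ ξ.1
    exact ⟨γ.1 + ξ.1, hγO.1, _, ⟨γ, ⟨hγ, h.1 ⟨γ, hγ, hγO.2, rfl⟩⟩, rfl⟩, rfl⟩

/-- After lattice translations both parameters have the same physical component, namely a common
point of M. The windows recovered from M then differ by a translation, which is trivial as W is
aperiodic. -/
theorem Sandwiched.unique (hΓ : IsCutProjectScheme Γ) (hW : IsWindow W) [T2Space H]
    {ξ' : H × Eucl d} (h : Sandwiched Γ W ξ M) (h' : Sandwiched Γ W ξ' M) : ξ' - ξ ∈ Γ := by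
  obtain ⟨γ, hγ, hγW⟩ := exists_lattice_add_mem hΓ isOpen_interior hW.interior_nonempty ξ.1
  have hx : (γ + ξ).2 ∈ M := h.1 ⟨γ, hγ, hγW, rfl⟩
  obtain ⟨β, hβ, hβW, hβx⟩ := h'.2 hx
  have hS := (h.add hγ).closure_star_image hΓ hW
  have hS' := (h'.add hβ).closure_star_image hΓ hW
  rw [hβx] at hS'
  set D := Prod.fst '' {α : H × Eucl d | α ∈ Γ ∧ α.2 + (γ + ξ).2 ∈ M} with hD
  have hcl : ∀ z : H, closure ((fun w => w + z) '' D) = (fun w => w + z) '' closure D := fun z =>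
    ((Homeomorph.addRight z).image_closure D).symm
  rw [hcl] at hS hS'
  have hz := hW.aperiodic ((β + ξ').1 - (γ + ξ).1) (by
    conv_lhs => rw [← hS]
    rw [Set.image_image]
    conv_rhs => rw [← hS']
    refine Set.image_congr fun w _ => ?_
    abel)
  have heq : β + ξ' = γ + ξ := Prod.ext (sub_eq_zero.1 hz) hβx
  have : ξ' - ξ = γ - β := by
    rw [sub_eq_sub_iff_add_eq_add, add_comm ξ', heq]
  rw [this]
  exact Γ.sub_mem hγ hβ

theorem shift_mem_hull {Λ : Set (Eucl d)} (h : M ∈ Hull Λ) (x : Eucl d) : shift M x ∈ Hull Λ := by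
  refine mem_closure_pattern_iff.2 fun ε hε => ?_
  have hε' : 0 < (ε⁻¹ + ‖x‖)⁻¹ := by positivity
  obtain ⟨B, ⟨y, rfl⟩, t, ht, hag⟩ := mem_closure_pattern_iff.1 h _ hε'
  refine ⟨shift Λ (x + y), ⟨_, rfl⟩, t, ht.trans_le ?_, ?_⟩
  · have : (ε⁻¹ + ‖x‖)⁻¹ ≤ (ε⁻¹)⁻¹ := inv_anti₀ (by positivity) (by linarith [norm_nonneg x])
    rwa [inv_inv] at this
  · rw [inv_inv] at hag
    have := hag.shift (R' := ε⁻¹) (x := x) le_rfl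
    rwa [shift_shift, shift_shift, add_comm x t, ← shift_shift] at this

theorem self_mem_hull (Λ : Set (Eucl d)) : Λ ∈ Hull Λ :=
  subset_closure ⟨0, (shift_zero Λ).symm⟩

theorem hull_subset_hull {Λ : Set (Eucl d)} (h : M ∈ Hull Λ) : Hull M ⊆ Hull Λ := by
  refine closure_minimal ?_ isClosed_closure
  rintro _ ⟨x, rfl⟩
  exact shift_mem_hull h x

theorem transversal_subset_hull (Λ : Set (Eucl d)) : Transversal Λ ⊆ Hull Λ := by
  refine closure_mono ?_
  rintro _ ⟨x, -, rfl⟩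
  exact ⟨x, rfl⟩

theorem IsModelSet.of_mem_hull {A : Set (Eucl d)} (hM : IsModelSet Γ W M) (hA : A ∈ Hull M) :
    IsModelSet Γ W A := by
  obtain ⟨ξ, hξ, h⟩ := hM
  exact ⟨ξ, hξ, hull_subset_hull h hA⟩

theorem NonSingular.sub_snd (h : NonSingular Γ W ξ) (x : Eucl d) :
    NonSingular Γ W (ξ - (0, x)) := by
  intro γ hγ
  simpa using h γ hγ

theorem IsModelSet.mem_closure (hM : IsModelSet Γ W M) : M ∈ closure (nonSingularSets Γ W) := by
  obtain ⟨ξ, hξ, h⟩ := hM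
  refine closure_mono ?_ h
  rintro _ ⟨x, rfl⟩
  exact ⟨ξ - (0, x), hξ.sub_snd x, shift_projSet W ξ x⟩

variable [T2Space H] [LocallyCompactSpace H]

/-- The first projection of the closed relation along the compact torus is closed and contains a
translation orbit, hence the hull. -/
theorem IsModelSet.exists_sandwiched (hΓ : IsCutProjectScheme Γ) (hW : IsCompact W)
    (hM : IsModelSet Γ W M) : ∃ ξ, Sandwiched Γ W ξ M := by
  have := hΓ.cocompact
  obtain ⟨ξ, hξ, h⟩ := hM
  have hcl := isClosedMap_fst_of_compactSpace _ (isClosed_torusRel (Γ := Γ) (W := W) hΓ hW)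
  have hsub : Hull (projSet Γ W ξ) ⊆ Prod.fst '' torusRel Γ W := by
    refine closure_minimal ?_ hcl
    rintro _ ⟨x, rfl⟩
    exact ⟨(_, QuotientAddGroup.mk (ξ - (0, x))), mem_torusRel.2 ((sandwiched_projSet ξ).shift x),
      rfl⟩
  obtain ⟨⟨_, τ⟩, hr, rfl⟩ := hsub h
  obtain ⟨ξ', rfl⟩ := QuotientAddGroup.mk_surjective τ
  exact ⟨ξ', mem_torusRel.1 hr⟩

theorem Sandwiched.eq_of_mem_torusRel (hΓ : IsCutProjectScheme Γ) (hW : IsWindow W)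
    (h : Sandwiched Γ W ξ M) {τ : (H × Eucl d) ⧸ Γ} (hτ : (M, τ) ∈ torusRel Γ W) :
    τ = QuotientAddGroup.mk ξ := by
  obtain ⟨ξ', rfl⟩ := QuotientAddGroup.mk_surjective τ
  refine (QuotientAddGroup.eq.2 ?_).symm
  have := h.unique hΓ hW (mem_torusRel.1 hτ)
  rwa [neg_add_eq_sub]

theorem torusParam_mem_torusRel {A : Set (Eucl d)} (hA : A ∈ nonSingularSets Γ W) :
    (A, torusParam Γ W A) ∈ torusRel Γ W := by
  unfold torusParam
  rw [dif_pos hA, mem_torusRel]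
  conv_rhs => rw [hA.choose_spec.2]
  exact sandwiched_projSet _

theorem t2Space_torus (hΓ : IsCutProjectScheme Γ) : T2Space ((H × Eucl d) ⧸ Γ) := by
  have : IsClosed (Γ : Set (H × Eucl d)) := isClosed_lattice hΓ
  infer_instance

/-- A closed graph with compact target gives convergence of the parameters, so the extension by
continuity picks the only related parameter. -/
theorem torusParametrization_eq (hΓ : IsCutProjectScheme Γ) (hW : IsWindow W)
    (hM : IsModelSet Γ W M) (h : Sandwiched Γ W ξ M) :
    torusParametrization Γ W M = QuotientAddGroup.mk ξ := by
  have := hΓ.cocompact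
  have := t2Space_torus hΓ
  exact extendFrom_eq hM.mem_closure (tendsto_of_closed_rel (isClosed_torusRel hΓ hW.compact)
    (fun A hA => torusParam_mem_torusRel hA) fun y hy => h.eq_of_mem_torusRel hΓ hW hy)

theorem starMap_eq (hΓ : IsCutProjectScheme Γ) (hW : IsWindow W)
    (hM : IsModelSet Γ W M) (h : Sandwiched Γ W ξ M) {u : H} {x : Eucl d}
    (hu : (u, x) - ξ ∈ Γ) : starMap Γ W M x = u := by
  have hex : ∃ v : H, (QuotientAddGroup.mk (v, x) : (H × Eucl d) ⧸ Γ) =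
      torusParametrization Γ W M := by
    refine ⟨u, ?_⟩
    rw [torusParametrization_eq hΓ hW hM h, eq_comm, QuotientAddGroup.eq, neg_add_eq_sub]
    exact hu
  unfold starMap
  rw [dif_pos hex]
  have hs := hex.choose_spec.trans (torusParametrization_eq hΓ hW hM h)
  rw [eq_comm, QuotientAddGroup.eq, neg_add_eq_sub] at hs
  have := snd_injOn hΓ hs hu (by simp)
  simpa using congrArg Prod.fst this

theorem starMap_mem (hΓ : IsCutProjectScheme Γ) (hW : IsWindow W) (hM : IsModelSet Γ W M)
    (h : Sandwiched Γ W ξ M) {x : Eucl d} (hx : x ∈ M) :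
    starMap Γ W M x ∈ W ∧ (starMap Γ W M x, x) - ξ ∈ Γ := by
  obtain ⟨γ, hγ, h1, rfl⟩ := h.2 hx
  have hmem : ((γ + ξ).1, (γ + ξ).2) - ξ ∈ Γ := by
    change γ + ξ - ξ ∈ Γ
    rwa [add_sub_cancel_right]
  rw [starMap_eq hΓ hW hM h hmem]
  exact ⟨h1, hmem⟩

theorem exists_lattice_of_mem (hΓ : IsCutProjectScheme Γ) (hW : IsWindow W)
    (hM : IsModelSet Γ W M) {x y : Eucl d} (hx : x ∈ M) (hy : y ∈ M) :
    ∃ γ ∈ Γ, γ.2 = y - x ∧ γ.1 = starMap Γ W M y - starMap Γ W M x := by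
  obtain ⟨ξ, h⟩ := hM.exists_sandwiched hΓ hW.compact
  refine ⟨_, Γ.sub_mem (starMap_mem hΓ hW hM h hy).2 (starMap_mem hΓ hW hM h hx).2, ?_, ?_⟩ <;> simp

theorem starMap_shift (hΓ : IsCutProjectScheme Γ) (hW : IsWindow W) (hM : IsModelSet Γ W M)
    {x y : Eucl d} (hx : y + x ∈ M) :
    starMap Γ W (shift M x) y = starMap Γ W M (y + x) := by
  obtain ⟨ξ, h⟩ := hM.exists_sandwiched hΓ hW.compact
  refine starMap_eq hΓ hW (hM.of_mem_hull (shift_mem_hull (self_mem_hull M) x)) (h.shift x) ?_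
  have := (starMap_mem hΓ hW hM h hx).2
  convert this using 1
  ext1
  · simp
  · simp only [Prod.snd_sub]; abel

/-- If 0 were missing, the locally finite A would stay away from 0 by some ε. But the approximating
patterns contain 0, so A contains a translation vector shorter than ε. -/
theorem zero_mem_of_mem_transversal (hΓ : IsCutProjectScheme Γ) (hW : IsCompact W)
    (hM : IsModelSet Γ W M) {A : Set (Eucl d)} (hA : A ∈ Transversal M) : (0 : Eucl d) ∈ A := by
  obtain ⟨ξ, h⟩ := (hM.of_mem_hull (transversal_subset_hull M hA)).exists_sandwiched hΓ hW
  by_contra h0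
  have hfin := (finite_projSet_inter hΓ hW ξ 1).subset (Set.inter_subset_inter_left _ h.2)
  obtain ⟨ε, hε, hεA⟩ : ∃ ε : ℝ, 0 < ε ∧ ∀ t ∈ A ∩ Metric.closedBall 0 1, ε ≤ ‖t‖ := by
    have hev : ∀ᶠ ε : ℝ in 𝓝[>] 0, ∀ t ∈ A ∩ Metric.closedBall 0 1, ε ≤ ‖t‖ := by
      refine (Filter.eventually_all_finite hfin).2 fun t ht => ?_
      have hpos : 0 < ‖t‖ := norm_pos_iff.2 fun h => h0 (h ▸ ht.1)
      exact (eventually_le_nhds hpos).filter_mono nhdsWithin_le_nhds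
    obtain ⟨ε, h1, h2⟩ := (hev.and self_mem_nhdsWithin).exists
    exact ⟨ε, h2, h1⟩
  have hm : 0 < min ε 1 := lt_min hε one_pos
  obtain ⟨B, ⟨x, hx, rfl⟩, t, ht, hag⟩ := mem_closure_pattern_iff.1 hA _ hm
  have htA : t ∈ A := by
    have := (agreeTo_iff.1 hag 0 (by simpa using hm.le)).2 (by simpa using hx)
    simpa using this
  have := hεA t ⟨htA, by simpa using (ht.trans_le (min_le_right _ _)).le⟩
  exact absurd ht (not_lt.2 ((min_le_left _ _).trans this))

/-- All members contain 0, so all lie in one locally finite set: the physical components of the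
lattice points over W - W. -/
theorem isCompact_transversal (hΓ : IsCutProjectScheme Γ) (hW : IsCompact W)
    (hM : IsModelSet Γ W M) : IsCompact (Transversal M) := by
  have hΔ : ∀ R : ℝ, ((Prod.snd '' {γ : H × Eucl d | γ ∈ Γ ∧ γ.1 ∈ (fun p : H × H => p.1 - p.2) ''
      (W ×ˢ W)}) ∩ Metric.closedBall 0 R).Finite := by
    intro R
    refine ((finite_lattice_inter hΓ (isCompact_sub_window hW W hW) R).image Prod.snd).subset ?_
    rintro _ ⟨⟨γ, ⟨h1, h2⟩, rfl⟩, h3⟩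
    exact ⟨γ, ⟨h1, h2, by simpa using h3⟩, rfl⟩
  refine (isCompact_powerset hΔ).of_isClosed_subset isClosed_closure fun A hA y hy => ?_
  have h0 := zero_mem_of_mem_transversal hΓ hW hM hA
  obtain ⟨ξ, h⟩ := (hM.of_mem_hull (transversal_subset_hull M hA)).exists_sandwiched hΓ hW
  obtain ⟨γ, hγ, g1, g2⟩ := h.2 hy
  obtain ⟨β, hβ, b1, b2⟩ := h.2 h0
  refine ⟨γ - β, ⟨Γ.sub_mem hγ hβ, ⟨((γ + ξ).1, (β + ξ).1), ⟨g1, b1⟩, by simp⟩⟩, ?_⟩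
  rw [← g2, ← sub_zero (γ + ξ).2, ← b2]
  simp

/-- The star value at 0 lies in the compact W and is the only u related to A through the parameter
(u, 0); the closed graph argument applies. -/
theorem continuous_starMap_zero (hΓ : IsCutProjectScheme Γ) (hW : IsWindow W)
    (hM : IsModelSet Γ W M) :
    Continuous fun A : Transversal M => starMap Γ W (A : Set (Eucl d)) 0 := by
  have : CompactSpace W := isCompact_iff_compactSpace.1 hW.compact
  have hmod : ∀ A : Transversal M, IsModelSet Γ W (A : Set (Eucl d)) := fun A =>
    hM.of_mem_hull (transversal_subset_hull M A.2)
  have h0 : ∀ A : Transversal M, (0 : Eucl d) ∈ (A : Set (Eucl d)) := fun A =>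
    zero_mem_of_mem_transversal hΓ hW.compact hM A.2
  have hs : ∀ A : Transversal M, starMap Γ W (A : Set (Eucl d)) 0 ∈ W := fun A => by
    obtain ⟨ξ, h⟩ := (hmod A).exists_sandwiched hΓ hW.compact
    exact (starMap_mem hΓ hW (hmod A) h (h0 A)).1
  let g : Transversal M → W := fun A => ⟨starMap Γ W (A : Set (Eucl d)) 0, hs A⟩
  have hcont : Continuous fun p : Transversal M × W =>
      (((p.1 : Set (Eucl d)), (QuotientAddGroup.mk ((p.2 : H), (0 : Eucl d)) : (H × Eucl d) ⧸ Γ)) :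
        Set (Eucl d) × ((H × Eucl d) ⧸ Γ)) := by
    refine Continuous.prodMk (by fun_prop) ?_
    exact QuotientAddGroup.continuous_mk.comp (by fun_prop)
  have hcl := (isClosed_torusRel (Γ := Γ) (W := W) hΓ hW.compact).preimage hcont
  have hg : Continuous g := by
    rw [← continuousOn_univ]
    intro A _
    refine tendsto_of_closed_rel hcl (fun B _ => ?_) fun w hw => ?_
    · obtain ⟨ξ, h⟩ := (hmod B).exists_sandwiched hΓ hW.compact
      have := (starMap_mem hΓ hW (hmod B) h (h0 B)).2
      refine mem_torusRel.2 ?_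
      have h2 := h.add this
      simpa using h2
    · have h1 : Sandwiched Γ W ((w : H), (0 : Eucl d)) A := mem_torusRel.1 hw
      exact Subtype.ext (starMap_eq hΓ hW (hmod A) h1 (by simp)).symm
  exact continuous_subtype_val.comp hg

end TorusParametrization

/-! ### Non-singular patterns, and the torus as an equicontinuous factor -/

section Nonslip

set_option linter.unusedSectionVars false

variable {d : ℕ} {H : Type} [AddCommGroup H] [TopologicalSpace H] [IsTopologicalAddGroup H]
  [T2Space H] [LocallyCompactSpace H]
  {Γ : AddSubgroup (H × Eucl d)} {W : Set H} {M : Set (Eucl d)}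

theorem mem_interior_of_notMem_frontier {X : Type*} [TopologicalSpace X] {S : Set X}
    {x : X} (hx : x ∈ S) (hx' : x ∉ frontier S) : x ∈ interior S := by
  by_contra h
  exact hx' ⟨subset_closure hx, h⟩

/-- Near a non-singular parameter, patches of bounded size do not change. -/
theorem eventually_mem_window_iff (hΓ : IsCutProjectScheme Γ) (hW : IsCompact W) {h : H}
    (hh : NonSingular Γ W (h, 0)) (R : ℝ) :
    ∀ᶠ h' in 𝓝 h, ∀ β ∈ Γ, ‖β.2‖ ≤ R →
      (β.1 + h ∈ W → β.1 + h' ∈ interior W) ∧ (β.1 + h' ∈ W → β.1 + h ∈ W) := by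
  obtain ⟨V, hV, hVn⟩ := exists_compact_mem_nhds h
  have hF := finite_lattice_inter hΓ (isCompact_sub_window hW V hV) R
  have hev : ∀ β ∈ {γ : H × Eucl d | γ ∈ Γ ∧ γ.1 ∈ (fun p : H × H => p.1 - p.2) '' (W ×ˢ V) ∧
        ‖γ.2‖ ≤ R}, ∀ᶠ h' in 𝓝 h,
        (β.1 + h ∈ W → β.1 + h' ∈ interior W) ∧ (β.1 + h' ∈ W → β.1 + h ∈ W) := by
    rintro β ⟨hβ, -, -⟩
    have hc : ContinuousAt (fun h' => β.1 + h') h := by fun_prop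
    have hfr : β.1 + h ∉ frontier W := by simpa using hh β hβ
    by_cases hm : β.1 + h ∈ W
    · have := hc.eventually (isOpen_interior.mem_nhds (mem_interior_of_notMem_frontier hm hfr))
      exact this.mono fun h' h1 => ⟨fun _ => h1, fun _ => hm⟩
    · have := hc.eventually (hW.isClosed.isOpen_compl.mem_nhds hm)
      exact this.mono fun h' h1 => ⟨fun h2 => absurd h2 hm, fun h2 => absurd h2 h1⟩
  filter_upwards [(Filter.eventually_all_finite hF).2 hev, hVn] with h' h1 h2 β hβ hβR
  constructor
  · intro h3
    exact (h1 β ⟨hβ, ⟨(β.1 + h, h), ⟨h3, mem_of_mem_nhds hVn⟩, by simp⟩, hβR⟩).1 h3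
  · intro h3
    exact (h1 β ⟨hβ, ⟨(β.1 + h', h'), ⟨h3, h2⟩, by simp⟩, hβR⟩).2 h3

theorem mem_projSet_zero {h : H} {V : Set H} {x : Eucl d} :
    x ∈ projSet Γ V (h, 0) ↔ ∃ γ ∈ Γ, γ.1 + h ∈ V ∧ γ.2 = x := by
  simp [mem_projSet]

/-- Density of Γ in H provides a point of M whose star value is so close to the non-singular h that
the two patches of radius R coincide. -/
theorem exists_agreeTo_projSet (hΓ : IsCutProjectScheme Γ) (hW : IsCompact W)
    (hM : IsModelSet Γ W M) {h : H} (hh : NonSingular Γ W (h, 0)) (hhW : h ∈ W) (R : ℝ) :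
    ∃ x ∈ M, AgreeTo R (projSet Γ W (h, 0)) (shift M x) := by
  obtain ⟨ξ, hξ⟩ := hM.exists_sandwiched hΓ hW
  have hint : h ∈ interior W := mem_interior_of_notMem_frontier hhW
    (by simpa using hh 0 Γ.zero_mem)
  obtain ⟨O, hO, hOo, hhO⟩ := mem_nhds_iff.1 (Filter.inter_mem
    (eventually_mem_window_iff hΓ hW hh R) (isOpen_interior.mem_nhds hint))
  obtain ⟨γ, hγ, hγO⟩ := exists_lattice_add_mem hΓ hOo ⟨h, hhO⟩ ξ.1
  obtain ⟨h1, h2⟩ := hO hγO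
  refine ⟨(γ + ξ).2, hξ.1 ⟨γ, hγ, h2, rfl⟩, agreeTo_iff.2 ?_⟩
  intro y hy
  rw [mem_shift, mem_projSet_zero]
  constructor
  · rintro ⟨β, hβ, hβW, rfl⟩
    refine hξ.1 ⟨β + γ, Γ.add_mem hβ hγ, ?_, by simp [add_assoc]⟩
    have := (h1 β hβ hy).1 hβW
    simpa [add_assoc] using this
  · intro hyM
    obtain ⟨δ, hδ, hδW, hδy⟩ := hξ.2 hyM
    have hy2 : (δ - γ).2 = y := by
      have : δ.2 + ξ.2 = y + (γ.2 + ξ.2) := hδy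
      rw [Prod.snd_sub, sub_eq_iff_eq_add]
      rw [← add_assoc] at this
      exact add_right_cancel this
    refine ⟨δ - γ, Γ.sub_mem hδ hγ, ?_, hy2⟩
    refine (h1 _ (Γ.sub_mem hδ hγ) (by rwa [hy2])).2 ?_
    have e : (δ - γ).1 + (γ.1 + ξ.1) = (δ + ξ).1 := by
      simp only [Prod.fst_sub, Prod.fst_add]; abel
    rwa [e]

theorem projSet_mem_transversal (hΓ : IsCutProjectScheme Γ) (hW : IsCompact W)
    (hM : IsModelSet Γ W M) {h : H} (hh : NonSingular Γ W (h, 0)) (hhW : h ∈ W) :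
    projSet Γ W (h, 0) ∈ Transversal M := by
  refine mem_closure_pattern_iff.2 fun ε hε => ?_
  obtain ⟨x, hx, hag⟩ := exists_agreeTo_projSet hΓ hW hM hh hhW ε⁻¹
  exact ⟨_, ⟨x, hx, rfl⟩, hag.epsClose hε⟩

/-- This allows statements on the transversal to be checked at parameters in a prescribed dense set.
-/
theorem transversal_subset_closure (hΓ : IsCutProjectScheme Γ) (hW : IsCompact W)
    (hM : IsModelSet Γ W M) {D : Set H} (hD : Dense D) :
    Transversal M ⊆ closure {A | ∃ h ∈ D, h ∈ W ∧ A = projSet Γ W (h, 0)} := by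
  refine closure_minimal ?_ isClosed_closure
  rintro _ ⟨x, hx, rfl⟩
  obtain ⟨ξ, hξ, hM⟩ := hM
  refine mem_closure_pattern_iff.2 fun ε hε => ?_
  -- The radius must cover the patch around x; the extra 1 pays for the translation t, which forces
  -- re-centring at x - t.
  have hε' : 0 < (ε⁻¹ + ‖x‖ + 1)⁻¹ := by positivity
  obtain ⟨_, ⟨y, rfl⟩, t, ht, hag⟩ := mem_closure_pattern_iff.1 hM _ hε'
  rw [inv_inv] at hag
  have ht1 : ‖t‖ < 1 := ht.trans_le (inv_le_one_of_one_le₀ (by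
    have := inv_pos.2 hε
    linarith [norm_nonneg x]))
  have hn : ‖x - t‖ ≤ ‖x‖ + 1 := (norm_sub_le _ _).trans (by linarith)
  obtain ⟨γ, hγ, hγW, hγx⟩ : x - t ∈ shift (projSet Γ W ξ) y :=
    (agreeTo_iff.1 hag _ (hn.trans (by linarith [inv_pos.2 hε]))).1 (by simpa using hx)
  have hag' : AgreeTo ε⁻¹ (shift M x) (projSet Γ W ((γ + ξ).1, 0)) := by
    have h1 := hag.shift (R' := ε⁻¹) (x := x - t) (by linarith)
    rw [shift_shift, shift_shift, sub_add_cancel, shift_projSet, ← hγx, ← projSet_add hγ,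
      ← add_sub_assoc] at h1
    convert h1 using 2
    ext1 <;> simp
  have hns : NonSingular Γ W ((γ + ξ).1, 0) := by
    intro β hβ
    have := hξ (β + γ) (Γ.add_mem hβ hγ)
    simpa [add_assoc] using this
  have hint : (γ + ξ).1 ∈ interior W := mem_interior_of_notMem_frontier hγW
    (by simpa using hns 0 Γ.zero_mem)
  obtain ⟨O, hO, hOo, hhO⟩ := mem_nhds_iff.1 (Filter.inter_mem
    (eventually_mem_window_iff hΓ hW hns ε⁻¹) (isOpen_interior.mem_nhds hint))
  obtain ⟨h', hh'O, hh'D⟩ := hD.inter_open_nonempty O hOo ⟨_, hhO⟩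
  obtain ⟨h1, h2⟩ := hO hh'O
  refine ⟨_, ⟨h', hh'D, interior_subset h2, rfl⟩,
    AgreeTo.epsClose hε (hag'.trans (agreeTo_iff.2 fun z hz => ?_))⟩
  rw [mem_projSet_zero, mem_projSet_zero]
  constructor
  · rintro ⟨β, hβ, hβW, rfl⟩
    exact ⟨β, hβ, interior_subset ((h1 β hβ hz).1 hβW), rfl⟩
  · rintro ⟨β, hβ, hβW, rfl⟩
    exact ⟨β, hβ, (h1 β hβ hz).2 hβW, rfl⟩

/-- The star values of points of M are dense in W, and the range of a continuous function on the
compact transversal is closed. -/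
theorem exists_transversal_starMap_eq (hΓ : IsCutProjectScheme Γ) (hW : IsWindow W)
    (hM : IsModelSet Γ W M) {w : H} (hw : w ∈ W) :
    ∃ A ∈ Transversal M, starMap Γ W A 0 = w := by
  have : CompactSpace (Transversal M) :=
    isCompact_iff_compactSpace.1 (isCompact_transversal hΓ hW.compact hM)
  obtain ⟨ξ, hξ⟩ := hM.exists_sandwiched hΓ hW.compact
  have hcl := (isCompact_range (continuous_starMap_zero hΓ hW hM)).isClosed
  have hsub : W ⊆ Set.range fun A : Transversal M => starMap Γ W (A : Set (Eucl d)) 0 := by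
    refine (hξ.closure_star_image hΓ hW).symm.subset.trans (closure_minimal ?_ hcl)
    rintro _ ⟨_, ⟨γ, ⟨hγ, hγM⟩, rfl⟩, rfl⟩
    refine ⟨⟨_, shift_mem_transversal hγM⟩, ?_⟩
    have h0 : (0 : Eucl d) + (γ.2 + ξ.2) ∈ M := by rwa [zero_add]
    simp only
    rw [starMap_shift hΓ hW hM h0, zero_add]
    refine starMap_eq hΓ hW hM hξ ?_
    change γ + ξ - ξ ∈ Γ
    rwa [add_sub_cancel_right]
  obtain ⟨A, hA⟩ := hsub hw
  exact ⟨A, A.2, hA⟩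

/-- The action of `ℝᵈ` on the torus through which the torus parametrization is equivariant. -/
@[reducible] def torusAction (Γ : AddSubgroup (H × Eucl d)) : AddAction (Eucl d) ((H × Eucl d) ⧸ Γ) where
  vadd x τ := τ - QuotientAddGroup.mk (0, x)
  zero_vadd τ := by
    change τ - QuotientAddGroup.mk 0 = τ
    rw [QuotientAddGroup.mk_zero, sub_zero]
  add_vadd x y τ := by
    change τ - QuotientAddGroup.mk (0, x + y) =
      τ - QuotientAddGroup.mk (0, y) - QuotientAddGroup.mk (0, x)
    rw [sub_sub, ← QuotientAddGroup.mk_add]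
    congr 2
    simp [add_comm]

/-- The torus itself is one of the factors tested by the relation: translations of a compact group
are equicontinuous, since they preserve differences. -/
theorem torusParametrization_eq_of_maxEquicontinuousRel (hΓ : IsCutProjectScheme Γ)
    (hW : IsWindow W) (hM : IsModelSet Γ W M) {A B : Set (Eucl d)}
    (hAB : MaxEquicontinuousRel M A B) :
    torusParametrization Γ W A = torusParametrization Γ W B := by
  obtain ⟨hA, hB, h⟩ := hAB
  have := hΓ.cocompact
  have := t2Space_torus hΓ
  let _ : UniformSpace ((H × Eucl d) ⧸ Γ) := IsTopologicalAddGroup.rightUniformSpace _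
  let _ := torusAction Γ
  have hvadd : ∀ (x : Eucl d) (τ : (H × Eucl d) ⧸ Γ),
      x +ᵥ τ = τ - QuotientAddGroup.mk (0, x) := fun _ _ => rfl
  have hcont : ContinuousVAdd (Eucl d) ((H × Eucl d) ⧸ Γ) := by
    refine ⟨?_⟩
    have : Continuous fun p : Eucl d × ((H × Eucl d) ⧸ Γ) =>
        p.2 - (QuotientAddGroup.mk ((0 : H), p.1) : (H × Eucl d) ⧸ Γ) :=
      continuous_snd.sub (QuotientAddGroup.continuous_mk.comp (by fun_prop))
    exact this
  have hmod : ∀ P : Hull M, IsModelSet Γ W (P : Set (Eucl d)) := fun P => hM.of_mem_hull P.2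
  refine h ((H × Eucl d) ⧸ Γ) (fun P : Hull M => torusParametrization Γ W (P : Set (Eucl d)))
    ?_ ?_ ?_ ?_
  · have : IsUniformAddGroup ((H × Eucl d) ⧸ Γ) := isUniformAddGroup_of_addCommGroup
    intro V hV
    rw [uniformity_eq_comap_nhds_zero] at hV
    obtain ⟨U, hU, hUV⟩ := Filter.mem_comap.1 hV
    change ∀ᶠ p : ((H × Eucl d) ⧸ Γ) × ((H × Eucl d) ⧸ Γ) in uniformity _, _
    rw [uniformity_eq_comap_nhds_zero]
    filter_upwards [Filter.preimage_mem_comap hU] with p hp x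
    refine hUV ?_
    change p.2 - _ - (p.1 - _) ∈ U
    rw [sub_sub_sub_cancel_right]
    exact hp
  · rw [← continuousOn_univ]
    intro P _
    have hcl := (isClosed_torusRel (Γ := Γ) (W := W) hΓ hW.compact).preimage
      (f := fun p : Hull M × ((H × Eucl d) ⧸ Γ) => ((p.1 : Set (Eucl d)), p.2)) (by fun_prop)
    obtain ⟨ξ, hξ⟩ := (hmod P).exists_sandwiched hΓ hW.compact
    refine tendsto_of_closed_rel hcl (fun Q _ => ?_) fun τ hτ => ?_
    · obtain ⟨ξ, hξ⟩ := (hmod Q).exists_sandwiched hΓ hW.compact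
      change (_, torusParametrization Γ W (Q : Set (Eucl d))) ∈ torusRel Γ W
      rw [torusParametrization_eq hΓ hW (hmod Q) hξ]
      exact mem_torusRel.2 hξ
    · change τ = torusParametrization Γ W (P : Set (Eucl d))
      rw [torusParametrization_eq hΓ hW (hmod P) hξ]
      exact hξ.eq_of_mem_torusRel hΓ hW hτ
  · intro τ
    obtain ⟨ξ, rfl⟩ := QuotientAddGroup.mk_surjective τ
    -- For surjectivity, move the internal component into W by a lattice vector, take a member of
    -- the transversal with that star value, and translate it to the required physical component.
    obtain ⟨γ, hγ, hγW⟩ := exists_lattice_add_mem hΓ isOpen_interior hW.interior_nonempty ξ.1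
    obtain ⟨A, hA, hAs⟩ := exists_transversal_starMap_eq hΓ hW hM (interior_subset hγW)
    have hAH := transversal_subset_hull M hA
    have hAm := hM.of_mem_hull hAH
    obtain ⟨ξ', hξ'⟩ := hAm.exists_sandwiched hΓ hW.compact
    have h1 := (starMap_mem hΓ hW hAm hξ' (zero_mem_of_mem_transversal hΓ hW.compact hM hA)).2
    have h2 := (hξ'.add h1).shift (-(γ + ξ).2)
    rw [sub_add_cancel, hAs] at h2
    have h3 := shift_mem_hull hAH (-(γ + ξ).2)
    refine ⟨⟨_, h3⟩, ?_⟩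
    simp only
    rw [torusParametrization_eq hΓ hW (hM.of_mem_hull h3) h2, eq_comm, QuotientAddGroup.eq]
    convert hγ using 1
    ext1 <;> simp
  · intro P Q x hQ
    obtain ⟨ξ, hξ⟩ := (hmod P).exists_sandwiched hΓ hW.compact
    have h1 := hξ.shift x
    rw [← hQ] at h1
    rw [torusParametrization_eq hΓ hW (hmod P) hξ, torusParametrization_eq hΓ hW (hmod Q) h1, hvadd]
    rfl

/-- Reprojections are nonslip. -/
theorem reprojection_le_nonslip (hΓ : IsCutProjectScheme Γ) (hW : IsWindow W)
    (hM : IsModelSet Γ W M) : Reprojection Γ W M ≤ Nonslip M := by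
  rintro F ⟨L, hL, hF⟩
  refine ⟨fun A => L (starMap Γ W (A : Set (Eucl d)) 0),
    ⟨hL.comp (continuous_starMap_zero hΓ hW hM), fun x => ?_⟩, 1, one_pos, fun A B hAB _ => ?_⟩
  · have h0 : (0 : Eucl d) + x ∈ M := by simp
    simp only
    rw [hF, starMap_shift hΓ hW hM h0, zero_add]
  · have h1 := torusParametrization_eq_of_maxEquicontinuousRel hΓ hW hM hAB
    have h2 : ∀ P Q : Set (Eucl d), torusParametrization Γ W P = torusParametrization Γ W Q →
        starMap Γ W P 0 = starMap Γ W Q 0 := by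
      intro P Q h
      unfold starMap
      rw [h]
    simp only [h2 _ _ h1]

theorem nonslip_le_wpe (Λ : Set (Eucl d)) : Nonslip Λ ≤ WPE Λ := by
  rintro F ⟨Ft, h, -⟩
  exact ⟨Ft, h⟩

theorem classesOf_mono (Λ : Set (Eucl d)) {S T : Submodule ℝ (Λ → ℝ)} (h : S ≤ T) :
    classesOf Λ S ≤ classesOf Λ T :=
  Submodule.map_mono (Submodule.comap_mono (Submodule.map_mono h))

end Nonslip

/-! ### Covering the boundary of a polyhedral window by hyperplanes -/

section Hyperplanes

variable {n : ℕ}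

/-- Countably many hyperplanes have a dense complement. -/
theorem dense_compl_hyperplanes {ι : Type*} [Countable ι] {ν : ι → Eucl n →L[ℝ] ℝ}
    (hν : ∀ i, ν i ≠ 0) (β : ι → ℝ) : Dense {x | ∀ i, ν i x ≠ β i} := by
  have h : {x | ∀ i, ν i x ≠ β i} = ⋂ i, {x | ν i x ≠ β i} := by ext; simp
  rw [h]
  -- Baire: each complement is open, and dense because a point of the hyperplane can be pushed off
  -- it along v.
  refine dense_iInter_of_isOpen (fun i => isOpen_ne_fun (by fun_prop) continuous_const) fun i => ?_
  obtain ⟨v, hv⟩ : ∃ v, ν i v ≠ 0 := by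
    by_contra! hcon
    exact hν i (ContinuousLinearMap.ext hcon)
  intro x
  by_cases hx : ν i x = β i
  · refine mem_closure_of_tendsto (f := fun t : ℝ => x + t • v) (b := 𝓝[≠] (0 : ℝ)) ?_ ?_
    · have : Continuous fun t : ℝ => x + t • v := by fun_prop
      simpa using (this.tendsto 0).mono_left nhdsWithin_le_nhds
    · filter_upwards [self_mem_nhdsWithin] with t ht
      have ht' : t ≠ 0 := ht
      simp [hx, hv, ht']
  · exact subset_closure hx

theorem exists_functional_eq_of_affineSpan_ne_top {t : Set (Eucl n)} (ht : t.Nonempty)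
    (h : affineSpan ℝ t ≠ ⊤) : ∃ l : Eucl n →L[ℝ] ℝ, l ≠ 0 ∧ ∃ a, ∀ x ∈ t, l x = a := by
  have hdir : (affineSpan ℝ t).direction < ⊤ := by
    refine lt_top_iff_ne_top.2 fun h' => h ?_
    exact (AffineSubspace.direction_eq_top_iff_of_nonempty (ht.affineSpan ℝ)).1 h'
  obtain ⟨f, hf, hle⟩ := Submodule.exists_le_ker_of_lt_top _ hdir
  obtain ⟨x₀, hx₀⟩ := ht
  refine ⟨LinearMap.toContinuousLinearMap f, ?_, f x₀, fun x hx => ?_⟩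
  · simpa using hf
  · have : x -ᵥ x₀ ∈ (affineSpan ℝ t).direction :=
      AffineSubspace.vsub_mem_direction (subset_affineSpan ℝ t hx) (subset_affineSpan ℝ t hx₀)
    have h0 : f (x - x₀) = 0 := hle this
    rw [map_sub, sub_eq_zero] at h0
    exact h0

/-- The boundary of a polytope is covered by finitely many hyperplanes. -/
theorem exists_hyperplanes_convexHull (s : Finset (Eucl n)) :
    ∃ S : Set ((Eucl n →L[ℝ] ℝ) × ℝ), S.Finite ∧ (∀ p ∈ S, p.1 ≠ 0) ∧
      frontier (convexHull ℝ (s : Set (Eucl n))) ⊆ {x | ∃ p ∈ S, p.1 x = p.2} := by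
  have hch : ∀ t : Set (Eucl n), ∃ p : (Eucl n →L[ℝ] ℝ) × ℝ, t.Nonempty → affineSpan ℝ t ≠ ⊤ →
      p.1 ≠ 0 ∧ ∀ x ∈ t, p.1 x = p.2 := by
    intro t
    by_cases h : t.Nonempty ∧ affineSpan ℝ t ≠ ⊤
    · obtain ⟨l, hl, a, ha⟩ := exists_functional_eq_of_affineSpan_ne_top h.1 h.2
      exact ⟨(l, a), fun _ _ => ⟨hl, ha⟩⟩
    · exact ⟨0, fun h1 h2 => absurd ⟨h1, h2⟩ h⟩
  choose p hp using hch
  -- One hyperplane for every subset of the vertices that fails to span affinely.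
  refine ⟨p '' {t | t ⊆ (s : Set (Eucl n)) ∧ t.Nonempty ∧ affineSpan ℝ t ≠ ⊤},
    ((s.finite_toSet.finite_subsets).subset fun t ht => ht.1).image p, ?_, ?_⟩
  · rintro _ ⟨t, ⟨-, h1, h2⟩, rfl⟩
    exact (hp t h1 h2).1
  · intro x hx
    have hcl : IsClosed (convexHull ℝ (s : Set (Eucl n))) := s.finite_toSet.isClosed_convexHull ℝ
    rw [hcl.frontier_eq] at hx
    -- Carathéodory with positive weights: if the affinely independent vertices span, x is interior
    -- to their simplex; otherwise x lies on the hyperplane chosen for them.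
    obtain ⟨ι, _, z, w, hz, hind, hw, hw1, hx'⟩ := eq_pos_convex_span_of_mem_convexHull hx.1
    have hne : (Set.range z).Nonempty := by
      by_contra hcon
      have : IsEmpty ι := Set.range_eq_empty_iff.1 (Set.not_nonempty_iff_eq_empty.1 hcon)
      simp at hw1
    by_cases htop : affineSpan ℝ (Set.range z) = ⊤
    · exfalso
      refine hx.2 (interior_mono (convexHull_mono hz) ?_)
      let b : AffineBasis ι ℝ (Eucl n) := ⟨z, hind, htop⟩
      have hb : Set.range z = Set.range b := rfl
      rw [hb, AffineBasis.interior_convexHull]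
      intro i
      have hcomb : Finset.univ.affineCombination ℝ z w = x := by
        rw [Finset.affineCombination_eq_linear_combination _ _ _ hw1, hx']
      have := b.coord_apply_combination_of_mem (Finset.mem_univ i) hw1
      change b.coord i (Finset.univ.affineCombination ℝ z w) = w i at this
      rw [← hcomb, this]
      exact hw i
    · refine ⟨_, ⟨_, ⟨hz, hne, htop⟩, rfl⟩, ?_⟩
      have h1 := (hp _ hne htop).2
      rw [← hx', map_sum]
      simp only [map_smul, smul_eq_mul, h1 _ (Set.mem_range_self _)]
      rw [← Finset.sum_mul, hw1, one_mul]

theorem frontier_biUnion_subset_of_finite {X ι : Type*} [TopologicalSpace X] {I : Set ι}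
    (hI : I.Finite) (s : ι → Set X) : frontier (⋃ i ∈ I, s i) ⊆ ⋃ i ∈ I, frontier (s i) := by
  intro x hx
  rw [frontier, hI.closure_biUnion] at hx
  obtain ⟨h1, h2⟩ := hx
  simp only [Set.mem_iUnion] at h1 ⊢
  obtain ⟨i, hi, hxi⟩ := h1
  exact ⟨i, hi, hxi, fun h => h2 (interior_mono (Set.subset_biUnion_of_mem hi) h)⟩

theorem IsPolyhedron.exists_hyperplanes {P : Set (Eucl n)} (hP : IsPolyhedron P) :
    ∃ S : Set ((Eucl n →L[ℝ] ℝ) × ℝ), S.Finite ∧ (∀ p ∈ S, p.1 ≠ 0) ∧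
      frontier P ⊆ {x | ∃ p ∈ S, p.1 x = p.2} := by
  obtain ⟨I, hI, rfl⟩ := hP
  choose S hS hS0 hSf using exists_hyperplanes_convexHull (n := n)
  refine ⟨⋃ s ∈ I, S s, hI.biUnion fun s _ => hS s, ?_, ?_⟩
  · intro p hp
    simp only [Set.mem_iUnion] at hp
    obtain ⟨s, -, hp⟩ := hp
    exact hS0 s p hp
  · refine (frontier_biUnion_subset_of_finite hI _).trans (Set.iUnion₂_subset fun s hs x hx => ?_)
    obtain ⟨p, hp, h⟩ := hSf s hx
    exact ⟨p, Set.mem_biUnion hs hp, h⟩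

/-- The boundary of a polyhedral window is covered by finitely many hyperplanes, whose normals are
normalized by a common vector. -/
theorem IsPolyhedral.exists_hyperplanes {C : Type} [TopologicalSpace C] [DiscreteTopology C]
    {W : Set (Eucl n × C)} (hW : IsPolyhedral W) :
    ∃ (Φ : Finset (Eucl n →L[ℝ] ℝ)) (A : Finset ℝ) (e₀ : Eucl n), (∀ l ∈ Φ, l e₀ = 1) ∧
      ∀ h ∈ frontier W, ∃ l ∈ Φ, ∃ a ∈ A, l h.1 = a := by
  classical
  obtain ⟨k, P, c, hP, -, rfl⟩ := hW
  choose S hS hS0 hSf using fun i => (hP i).exists_hyperplanes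
  have hT : (⋃ i, S i).Finite := Set.finite_iUnion hS
  obtain ⟨T, hT'⟩ := hT.exists_finset_coe
  have hT0 : ∀ p ∈ T, p.1 ≠ 0 := by
    intro p hp
    have : p ∈ ⋃ i, S i := by rw [← hT']; exact hp
    obtain ⟨i, hi⟩ := Set.mem_iUnion.1 this
    exact hS0 i p hi
  -- Dividing each normal by its nonzero value at e₀ makes proportional normals equal, so distinct
  -- normals in Φ are not proportional.
  obtain ⟨e₀, he₀⟩ := (dense_compl_hyperplanes (ι := T) (ν := fun p => p.1.1)
    (fun p => hT0 p.1 p.2) (fun _ => 0)).nonempty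
  refine ⟨T.image fun p => (p.1 e₀)⁻¹ • p.1, T.image fun p => (p.1 e₀)⁻¹ * p.2, e₀, ?_, ?_⟩
  · intro l hl
    obtain ⟨p, hp, rfl⟩ := Finset.mem_image.1 hl
    have : p.1 e₀ ≠ 0 := he₀ ⟨p, hp⟩
    simp [this]
  · intro h hh
    have h1 : frontier (⋃ i, P i ×ˢ {c i}) ⊆ ⋃ i, frontier (P i ×ˢ {c i}) := by
      simpa using frontier_biUnion_subset_of_finite Set.finite_univ fun i => P i ×ˢ {c i}
    obtain ⟨i, hi⟩ := Set.mem_iUnion.1 (h1 hh)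
    have hfr : frontier ({c i} : Set C) = ∅ := (isClopen_discrete _).frontier_eq
    rw [frontier_prod_eq, hfr, Set.prod_empty, Set.empty_union] at hi
    obtain ⟨p, hp, hpa⟩ := hSf i hi.1
    have hpT : p ∈ T := by
      have : p ∈ (T : Set _) := by rw [hT']; exact Set.mem_iUnion.2 ⟨i, hp⟩
      exact this
    refine ⟨_, Finset.mem_image_of_mem _ hpT, _, Finset.mem_image_of_mem _ hpT, ?_⟩
    simp [hpa]

end Hyperplanes

/-! ### The lattice as a Euclidean lattice, and transverse functionals -/

section Lattice

set_option linter.unusedSectionVars false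

variable {d n : ℕ} {C : Type} [AddCommGroup C] [Finite C] [TopologicalSpace C] [DiscreteTopology C]
  {Γ : AddSubgroup ((Eucl n × C) × Eucl d)}

theorem finite_lattice_bounded (hΓ : IsCutProjectScheme Γ) (a b : ℝ) :
    {γ : (Eucl n × C) × Eucl d | γ ∈ Γ ∧ ‖γ.1.1‖ ≤ a ∧ ‖γ.2‖ ≤ b}.Finite := by
  have hK : IsCompact (Metric.closedBall (0 : Eucl n) a ×ˢ (Set.univ : Set C)) :=
    (isCompact_closedBall _ _).prod Set.finite_univ.isCompact
  refine (finite_lattice_inter hΓ hK b).subset ?_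
  rintro γ ⟨h1, h2, h3⟩
  exact ⟨h1, ⟨by simpa using h2, trivial⟩, h3⟩

theorem countable_lattice (hΓ : IsCutProjectScheme Γ) :
    (Γ : Set ((Eucl n × C) × Eucl d)).Countable := by
  have h : (Γ : Set ((Eucl n × C) × Eucl d)) ⊆
      ⋃ k : ℕ, {γ : (Eucl n × C) × Eucl d | γ ∈ Γ ∧ ‖γ.1.1‖ ≤ k ∧ ‖γ.2‖ ≤ k} := by
    intro γ hγ
    obtain ⟨k, hk⟩ := exists_nat_ge (max ‖γ.1.1‖ ‖γ.2‖)
    exact Set.mem_iUnion.2 ⟨k, hγ, (le_max_left _ _).trans hk, (le_max_right _ _).trans hk⟩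
  exact (Set.countable_iUnion fun k : ℕ =>
    (finite_lattice_bounded hΓ (k : ℝ) (k : ℝ)).countable).mono h

/-- The compact quotient is covered by the image of one bounded open box. -/
theorem exists_lattice_near (hΓ : IsCutProjectScheme Γ) :
    ∃ ρ : ℝ, ∀ z : (Eucl n × C) × Eucl d, ∃ γ ∈ Γ, ‖z.1.1 - γ.1.1‖ ≤ ρ ∧ ‖z.2 - γ.2‖ ≤ ρ := by
  have := hΓ.cocompact
  let V : ℕ → Set ((Eucl n × C) × Eucl d) := fun k => {z | ‖z.1.1‖ < k ∧ ‖z.2‖ < k}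
  have hV : ∀ k, IsOpen (V k) := by
    intro k
    have h1 : IsOpen {z : (Eucl n × C) × Eucl d | ‖z.1.1‖ < k} :=
      isOpen_lt (by fun_prop) continuous_const
    have h2 : IsOpen {z : (Eucl n × C) × Eucl d | ‖z.2‖ < k} :=
      isOpen_lt (by fun_prop) continuous_const
    exact h1.inter h2
  have hmono : Monotone V := by
    intro k l hkl z hz
    have : (k : ℝ) ≤ l := by exact_mod_cast hkl
    exact ⟨hz.1.trans_le this, hz.2.trans_le this⟩
  obtain ⟨k, hk⟩ := (isCompact_univ (X := ((Eucl n × C) × Eucl d) ⧸ Γ)).elim_directed_cover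
    (fun k => QuotientAddGroup.mk '' V k) (fun k => QuotientAddGroup.isOpenMap_coe _ (hV k))
    (by
      rintro τ -
      obtain ⟨z, rfl⟩ := QuotientAddGroup.mk_surjective τ
      obtain ⟨k, hk⟩ := exists_nat_gt (max ‖z.1.1‖ ‖z.2‖)
      exact Set.mem_iUnion.2 ⟨k, z, ⟨(le_max_left _ _).trans_lt hk, (le_max_right _ _).trans_lt hk⟩,
        rfl⟩)
    (Monotone.directed_le fun k l hkl => Set.image_mono (hmono hkl))
  refine ⟨k, fun z => ?_⟩
  obtain ⟨v, hv, hvz⟩ := hk (Set.mem_univ (QuotientAddGroup.mk z))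
  have hmem : -v + z ∈ Γ := QuotientAddGroup.eq.1 hvz
  refine ⟨-v + z, hmem, ?_, ?_⟩
  · have : z.1.1 - (-v + z).1.1 = v.1.1 := by
      simp only [Prod.fst_add, Prod.fst_neg]; abel
    rw [this]; exact hv.1.le
  · have : z.2 - (-v + z).2 = v.2 := by
      simp only [Prod.snd_add, Prod.snd_neg]; abel
    rw [this]; exact hv.2.le

/-- The points of the lattice over an open subset of the internal group are relatively dense. -/
theorem exists_lattice_add_mem_near (hΓ : IsCutProjectScheme Γ) {O : Set (Eucl n × C)}
    (hO : IsOpen O) (hne : O.Nonempty) : ∃ r₀ : ℝ, 0 ≤ r₀ ∧ ∀ (h : Eucl n × C) (x : Eucl d),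
      ∃ γ ∈ Γ, h + γ.1 ∈ O ∧ ‖γ.2 - x‖ ≤ r₀ := by
  obtain ⟨ρ, hρ⟩ := exists_lattice_near hΓ
  have hρ0 : 0 ≤ ρ := by
    obtain ⟨γ, -, h, -⟩ := hρ 0
    exact (norm_nonneg _).trans h
  have hK : IsCompact (Metric.closedBall (0 : Eucl n) ρ ×ˢ (Set.univ : Set C)) :=
    (isCompact_closedBall _ _).prod Set.finite_univ.isCompact
  obtain ⟨t, ht⟩ := hK.elim_finite_subcover (fun β : Γ => (fun k => β.1.1 + k) ⁻¹' O)
    (fun β => hO.preimage (by fun_prop)) (by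
      intro k _
      obtain ⟨γ, hγ, h⟩ := exists_lattice_add_mem hΓ hO hne k
      exact Set.mem_iUnion.2 ⟨⟨γ, hγ⟩, h⟩)
  have hs := Finset.sum_nonneg (s := t) (fun β _ => norm_nonneg β.1.2)
  refine ⟨ρ + ∑ β ∈ t, ‖β.1.2‖, by positivity, fun h x => ?_⟩
  -- Subtracting a lattice vector near (h, -x) makes the internal part bounded and the physical part
  -- near x; one of finitely many β then moves the internal part into O.
  obtain ⟨γ', hγ', h1, h2⟩ := hρ (h, -x)
  have hk : h - γ'.1 ∈ Metric.closedBall (0 : Eucl n) ρ ×ˢ (Set.univ : Set C) :=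
    ⟨by simpa using h1, trivial⟩
  obtain ⟨β, hβ⟩ := Set.mem_iUnion.1 (ht hk)
  obtain ⟨hβt, hβO⟩ := Set.mem_iUnion.1 hβ
  refine ⟨β - γ', Γ.sub_mem β.2 hγ', ?_, ?_⟩
  · have : h + (β.1 - γ').1 = β.1.1 + (h - γ'.1) := by
      simp only [Prod.fst_sub]; abel
    rw [this]; exact hβO
  · have e : (β.1 - γ').2 - x = β.1.2 + (-x - γ'.2) := by
      simp only [Prod.snd_sub]; abel
    rw [e]
    have h3 := Finset.single_le_sum (fun β _ => norm_nonneg β.1.2) hβt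
    exact (norm_add_le _ _).trans (by linarith)

/-- Forgetting the finite component embeds the lattice into a Euclidean space. -/
def realEmbedding (Γ : AddSubgroup ((Eucl n × C) × Eucl d)) : Γ →ₗ[ℤ] Eucl n × Eucl d where
  toFun γ := (γ.1.1.1, γ.1.2)
  map_add' _ _ := rfl
  map_smul' _ _ := rfl

theorem realEmbedding_injective (hΓ : IsCutProjectScheme Γ) :
    Function.Injective (realEmbedding Γ) := fun γ β h =>
  Subtype.ext (snd_injOn hΓ γ.2 β.2 (congrArg (fun v : Eucl n × Eucl d => v.2) h))

theorem discreteTopology_range_realEmbedding (hΓ : IsCutProjectScheme Γ) :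
    DiscreteTopology (LinearMap.range (realEmbedding Γ)) := by
  have hfin : ((fun γ : (Eucl n × C) × Eucl d => ((γ.1.1, γ.2) : Eucl n × Eucl d)) ''
      {γ | γ ∈ Γ ∧ ‖γ.1.1‖ ≤ 1 ∧ ‖γ.2‖ ≤ 1}).Finite := (finite_lattice_bounded hΓ 1 1).image _
  obtain ⟨ε, hε, hεA⟩ : ∃ ε : ℝ, 0 < ε ∧ ∀ v ∈ ((fun γ : (Eucl n × C) × Eucl d =>
      ((γ.1.1, γ.2) : Eucl n × Eucl d)) '' {γ | γ ∈ Γ ∧ ‖γ.1.1‖ ≤ 1 ∧ ‖γ.2‖ ≤ 1}),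
      v ≠ 0 → ε ≤ ‖v‖ := by
    have hev : ∀ᶠ ε : ℝ in 𝓝[>] 0, ∀ v ∈ ((fun γ : (Eucl n × C) × Eucl d =>
      ((γ.1.1, γ.2) : Eucl n × Eucl d)) '' {γ | γ ∈ Γ ∧ ‖γ.1.1‖ ≤ 1 ∧ ‖γ.2‖ ≤ 1}),
      v ≠ 0 → ε ≤ ‖v‖ := by
      refine (Filter.eventually_all_finite hfin).2 fun v _ => ?_
      by_cases hv : v = 0
      · exact Filter.Eventually.of_forall fun _ h => absurd hv h
      · exact ((eventually_le_nhds (norm_pos_iff.2 hv)).filter_mono nhdsWithin_le_nhds).mono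
          fun _ h _ => h
    obtain ⟨ε, h1, h2⟩ := (hev.and self_mem_nhdsWithin).exists
    exact ⟨ε, h2, h1⟩
  refine DiscreteTopology.of_forall_le_dist (lt_min hε one_pos) ?_
  rintro x y hxy
  have hne : (x : Eucl n × Eucl d) - y ≠ 0 := fun h => hxy (Subtype.ext (sub_eq_zero.1 h))
  rw [Subtype.dist_eq, dist_eq_norm]
  by_contra! hcon
  have h1 : ‖(x : Eucl n × Eucl d) - y‖ ≤ 1 := (hcon.trans_le (min_le_right _ _)).le
  obtain ⟨γ, hγ⟩ := (x - y).2
  have hγ' : realEmbedding Γ γ = (x : Eucl n × Eucl d) - y := hγ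
  rw [← hγ'] at hcon hne h1
  have h2 := hεA _ ⟨γ.1, ⟨γ.2, (norm_fst_le (realEmbedding Γ γ)).trans h1,
    (norm_snd_le (realEmbedding Γ γ)).trans h1⟩, rfl⟩ hne
  exact absurd hcon (not_lt.2 ((min_le_left _ _).trans h2))

/-- A functional that vanishes on the lattice is bounded, since every vector is within bounded
distance of the lattice; so it is zero. -/
theorem span_range_realEmbedding (hΓ : IsCutProjectScheme Γ) :
    Submodule.span ℝ (LinearMap.range (realEmbedding Γ) : Set (Eucl n × Eucl d)) = ⊤ := by
  by_contra hcon
  obtain ⟨f, hf, hle⟩ := Submodule.exists_le_ker_of_lt_top _ (lt_top_iff_ne_top.2 hcon)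
  obtain ⟨v, hv⟩ : ∃ v, f v ≠ 0 := by
    by_contra! h
    exact hf (LinearMap.ext h)
  obtain ⟨ρ, hρ⟩ := exists_lattice_near hΓ
  let g := LinearMap.toContinuousLinearMap f
  have hb : ∀ w, |f w| ≤ ‖g‖ * ρ := by
    intro w
    obtain ⟨γ, hγ, h1, h2⟩ := hρ ((w.1, 0), w.2)
    have h0 : f (realEmbedding Γ ⟨γ, hγ⟩) = 0 :=
      hle (Submodule.subset_span (LinearMap.mem_range_self _ _))
    have h3 : f w = g (w - realEmbedding Γ ⟨γ, hγ⟩) := by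
      change f w = f (w - realEmbedding Γ ⟨γ, hγ⟩)
      rw [map_sub, h0, sub_zero]
    rw [h3, ← Real.norm_eq_abs]
    refine (g.le_opNorm _).trans (mul_le_mul_of_nonneg_left ?_ (norm_nonneg _))
    exact max_le h1 h2
  have h1 := hb (((‖g‖ * ρ + 1) / f v) • v)
  rw [map_smul, smul_eq_mul, div_mul_cancel₀ _ hv] at h1
  have := (le_abs_self _).trans h1
  linarith

/-- Every homomorphism of the lattice to `ℝ` is the restriction of a linear functional. -/
theorem exists_linearMap_extension (hΓ : IsCutProjectScheme Γ) (θ : Γ →ₗ[ℤ] ℝ) :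
    ∃ μ : Eucl n × Eucl d →ₗ[ℝ] ℝ, ∀ γ : Γ, μ (realEmbedding Γ γ) = θ γ := by
  have := discreteTopology_range_realEmbedding hΓ
  have : IsZLattice ℝ (LinearMap.range (realEmbedding Γ)) := ⟨span_range_realEmbedding hΓ⟩
  have : Module.Free ℤ (LinearMap.range (realEmbedding Γ)) := ZLattice.module_free ℝ _
  let b := Module.Free.chooseBasis ℤ (LinearMap.range (realEmbedding Γ))
  let φ := LinearEquiv.ofInjective (realEmbedding Γ) (realEmbedding_injective hΓ)
  -- A ℤ-basis of the lattice is an ℝ-basis of the whole space.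
  let μ : Eucl n × Eucl d →ₗ[ℝ] ℝ := (b.ofZLatticeBasis ℝ _).constr ℝ fun i => θ (φ.symm (b i))
  refine ⟨μ, fun γ => ?_⟩
  have h : (μ.restrictScalars ℤ) ∘ₗ (LinearMap.range (realEmbedding Γ)).subtype =
      θ ∘ₗ φ.symm.toLinearMap := by
    refine b.ext fun i => ?_
    change μ (b i : Eucl n × Eucl d) = θ (φ.symm (b i))
    rw [← b.ofZLatticeBasis_apply ℝ]
    exact (b.ofZLatticeBasis ℝ _).constr_basis ℝ _ i
  have := LinearMap.congr_fun h (φ γ)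
  simpa [φ] using this

theorem finite_lattice_module (hΓ : IsCutProjectScheme Γ) : Module.Finite ℤ Γ := by
  have := discreteTopology_range_realEmbedding hΓ
  have : IsZLattice ℝ (LinearMap.range (realEmbedding Γ)) := ⟨span_range_realEmbedding hΓ⟩
  have : Module.Finite ℤ (LinearMap.range (realEmbedding Γ)) := ZLattice.module_finite ℝ _
  exact Module.Finite.equiv
    (LinearEquiv.ofInjective (realEmbedding Γ) (realEmbedding_injective hΓ)).symm

/-- For a functional `l` on the internal space there are finitely many linear functionals on the
total space which on the lattice depend on `l` only, jointly determine `l` up to finitely many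
values when bounded, and do not vanish on the physical space. -/
theorem exists_transverse_functionals (hΓ : IsCutProjectScheme Γ) {l : Eucl n →L[ℝ] ℝ}
    (hl : l ≠ 0) : ∃ (ι : Type) (_ : Fintype ι) (μ : ι → (Eucl n × Eucl d →ₗ[ℝ] ℝ))
      (u : ι → Eucl d), (∀ i, μ i (0, u i) = 1) ∧
      (∀ i, ∀ γ ∈ Γ, l γ.1.1 = 0 → μ i (γ.1.1, γ.2) = 0) ∧
      ∀ B : ℝ, ((fun γ : (Eucl n × C) × Eucl d => l γ.1.1) ''
        {γ | γ ∈ Γ ∧ ∀ i, |μ i (γ.1.1, γ.2)| ≤ B}).Finite := by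
  classical
  have := finite_lattice_module hΓ
  -- The values of l on Γ form a finitely generated free group, possibly dense in ℝ. Its integer
  -- coordinates are homomorphisms of Γ that factor through l, and they extend to linear functionals
  -- ν.
  let f : Γ →ₗ[ℤ] ℝ := (l.toLinearMap.restrictScalars ℤ) ∘ₗ LinearMap.fst ℤ _ _ ∘ₗ realEmbedding Γ
  have hf : ∀ γ : Γ, f γ = l γ.1.1.1 := fun _ => rfl
  have : Module.Free ℤ (LinearMap.range f) := inferInstance
  let b := Module.Free.chooseBasis ℤ (LinearMap.range f)
  let θ : Module.Free.ChooseBasisIndex ℤ (LinearMap.range f) → Γ →ₗ[ℤ] ℝ := fun i =>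
    (Int.castAddHom ℝ).toIntLinearMap ∘ₗ b.coord i ∘ₗ f.rangeRestrict
  have hθ : ∀ i γ, θ i γ = ((b.repr (f.rangeRestrict γ) i : ℤ) : ℝ) := fun _ _ => rfl
  choose ν hν using fun i => exists_linearMap_extension hΓ (θ i)
  have hνθ : ∀ i γ (hγ : γ ∈ Γ), ν i (γ.1.1, γ.2) =
      ((b.repr (f.rangeRestrict ⟨γ, hγ⟩) i : ℤ) : ℝ) := fun i γ hγ => hν i ⟨γ, hγ⟩
  have hcoord : ∀ γ (hγ : γ ∈ Γ), (∀ i, b.repr (f.rangeRestrict ⟨γ, hγ⟩) i = 0) →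
      l γ.1.1 = 0 := by
    intro γ hγ h
    have h1 : b.repr (f.rangeRestrict ⟨γ, hγ⟩) = 0 := Finsupp.ext h
    have h2 : f.rangeRestrict ⟨γ, hγ⟩ = 0 := by simpa using h1
    exact congrArg Subtype.val h2
  -- If all ν vanished on ℝᵈ, they would be small at lattice points with small internal part; being
  -- integers, they would be 0 there, so l would vanish at all these points, against density of Γ in
  -- H.
  obtain ⟨i₀, v₀, hv₀⟩ : ∃ i₀ v₀, ν i₀ (0, v₀) ≠ 0 := by
    by_contra! hcon
    have hev : ∀ᶠ e : Eucl n in 𝓝 0, ∀ i, |ν i (e, 0)| < 1 := by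
      refine Filter.eventually_all.2 fun i => ?_
      have hc : Continuous fun e : Eucl n => |ν i (e, 0)| := by
        have : Continuous (ν i) := (ν i).continuous_of_finiteDimensional
        fun_prop
      exact (hc.tendsto 0).eventually_lt_const (by
        have : ((0 : Eucl n), (0 : Eucl d)) = 0 := rfl
        simp [this])
    obtain ⟨N, hN, hNo, h0N⟩ := mem_nhds_iff.1 hev
    have hd : Dense {x | ∀ _ : Unit, l x ≠ 0} := dense_compl_hyperplanes (fun _ => hl) fun _ => 0
    obtain ⟨e, heN, hel⟩ := hd.inter_open_nonempty N hNo ⟨0, h0N⟩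
    have hO : IsOpen ((N ∩ {x | l x ≠ 0}) ×ˢ ({0} : Set C)) :=
      (hNo.inter (isOpen_ne_fun l.continuous continuous_const)).prod (isOpen_discrete _)
    obtain ⟨γ, hγ, ⟨hγN, hγl⟩, -⟩ := exists_lattice_add_mem hΓ hO ⟨(e, 0), ⟨heN, hel ()⟩, rfl⟩ 0
    rw [add_zero] at hγN hγl
    refine hγl (hcoord γ hγ fun i => ?_)
    have h1 := hN hγN i
    have h2 : ν i (γ.1.1, γ.2) = ν i (γ.1.1, 0) := by
      have : ((γ.1.1, γ.2) : Eucl n × Eucl d) = (γ.1.1, 0) + (0, γ.2) := by simp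
      rw [this, map_add, hcon, add_zero]
    rw [← h2, hνθ i γ hγ] at h1
    have h3 : |b.repr (f.rangeRestrict ⟨γ, hγ⟩) i| < 1 := by exact_mod_cast h1
    exact Int.abs_lt_one_iff.1 h3
  -- Adding ν i₀ repairs the functionals that vanish on ℝᵈ; the values of κ still control those of
  -- all ν.
  let κ : Module.Free.ChooseBasisIndex ℤ (LinearMap.range f) → (Eucl n × Eucl d →ₗ[ℝ] ℝ) := fun i =>
    if ∃ v, ν i (0, v) ≠ 0 then ν i else ν i + ν i₀
  have hκ : ∀ i, ∃ v, κ i (0, v) ≠ 0 := by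
    intro i
    by_cases h : ∃ v, ν i (0, v) ≠ 0
    · simp only [κ, if_pos h]
      exact h
    · simp only [κ, if_neg h]
      push Not at h
      exact ⟨v₀, by simpa [h] using hv₀⟩
  choose v hv using hκ
  refine ⟨_, inferInstance, κ, fun i => (κ i (0, v i))⁻¹ • v i, fun i => ?_, ?_, fun B => ?_⟩
  · have : ((0 : Eucl n), (κ i (0, v i))⁻¹ • v i) = (κ i (0, v i))⁻¹ • ((0 : Eucl n), v i) := by
      simp
    rw [this, map_smul, smul_eq_mul, inv_mul_cancel₀ (hv i)]
  · intro i γ hγ h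
    have h1 : f.rangeRestrict ⟨γ, hγ⟩ = 0 := Subtype.ext h
    have h2 : ∀ j, ν j (γ.1.1, γ.2) = 0 := fun j => by rw [hνθ j γ hγ, h1]; simp
    simp only [κ]
    split_ifs
    · exact h2 i
    · rw [LinearMap.add_apply, h2, h2, add_zero]
  -- Undoing the addition of ν i₀ costs a factor 2. Bounded integer coordinates leave finitely many
  -- values of l.
  · obtain ⟨N, hN⟩ := exists_nat_ge (2 * B)
    have hfin : (Set.Icc (fun _ => -(N : ℤ)) (fun _ => (N : ℤ)) :
        Set (Module.Free.ChooseBasisIndex ℤ (LinearMap.range f) → ℤ)).Finite := Set.finite_Icc _ _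
    refine (hfin.image fun c => ((b.equivFun.symm c : LinearMap.range f) : ℝ)).subset ?_
    rintro _ ⟨γ, ⟨hγ, hB⟩, rfl⟩
    have hB0 : |ν i₀ (γ.1.1, γ.2)| ≤ B := by
      have := hB i₀
      simpa only [κ, if_pos (⟨v₀, hv₀⟩ : ∃ v, ν i₀ (0, v) ≠ 0)] using this
    have hB1 : ∀ i, |ν i (γ.1.1, γ.2)| ≤ N := by
      intro i
      have h1 := hB i
      simp only [κ] at h1
      have hBn := (abs_nonneg _).trans hB0
      split_ifs at h1
      · linarith
      · rw [LinearMap.add_apply] at h1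
        rw [abs_le] at *
        constructor <;> linarith
    refine ⟨b.equivFun (f.rangeRestrict ⟨γ, hγ⟩), ?_, ?_⟩
    · have h3 : ∀ i, |b.repr (f.rangeRestrict ⟨γ, hγ⟩) i| ≤ (N : ℤ) := fun i => by
        have := hB1 i
        rw [hνθ i γ hγ] at this
        exact_mod_cast this
      exact ⟨fun i => (abs_le.1 (h3 i)).1, fun i => (abs_le.1 (h3 i)).2⟩
    · simp only [LinearEquiv.symm_apply_apply]
      rfl

end Lattice

/-! ### Pattern functions and the sides of hyperplanes -/

section Core

set_option linter.unusedSectionVars false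

variable {d n : ℕ} {C : Type} [AddCommGroup C] [Finite C] [TopologicalSpace C] [DiscreteTopology C]

/-- A window of a cut and project scheme whose boundary is covered by the hyperplanes `l = a` with
`l ∈ Φ` and `a ∈ A`; the normals `l` are pairwise non-proportional. -/
structure CoveredWindow (Γ : AddSubgroup ((Eucl n × C) × Eucl d)) (W : Set (Eucl n × C))
    (Φ : Finset (Eucl n →L[ℝ] ℝ)) (A : Finset ℝ) (e₀ : Eucl n) : Prop where
  scheme : IsCutProjectScheme Γ
  window : IsWindow W
  normalized : ∀ l ∈ Φ, l e₀ = 1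
  frontier_subset : ∀ h ∈ frontier W, ∃ l ∈ Φ, ∃ a ∈ A, l h.1 = a

/-- The hyperplanes obtained from the hyperplanes `l = a` by translation with lattice vectors. -/
def latticeHyperplanes (Γ : AddSubgroup ((Eucl n × C) × Eucl d)) (Φ : Finset (Eucl n →L[ℝ] ℝ))
    (A : Finset ℝ) : Set ((Eucl n →L[ℝ] ℝ) × ℝ) :=
  {p | p.1 ∈ Φ ∧ ∃ a ∈ A, ∃ γ ∈ Γ, p.2 = a - p.1 γ.1.1}

/-- The points on none of the lattice translates of the hyperplanes. -/
def offHyperplanes (Γ : AddSubgroup ((Eucl n × C) × Eucl d)) (Φ : Finset (Eucl n →L[ℝ] ℝ))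
    (A : Finset ℝ) : Set (Eucl n) :=
  {e | ∀ p ∈ latticeHyperplanes Γ Φ A, p.1 e ≠ p.2}

/-- Two points lie strictly on the same side of a hyperplane. -/
def SameSide (p : (Eucl n →L[ℝ] ℝ) × ℝ) (e e' : Eucl n) : Prop :=
  0 < (p.1 e - p.2) * (p.1 e' - p.2)

/-- The patches of size `ρ` at the points with parameters `h` and `h'` coincide. -/
def SamePatch (Γ : AddSubgroup ((Eucl n × C) × Eucl d)) (W : Set (Eucl n × C)) (ρ : ℝ)
    (h h' : Eucl n × C) : Prop :=
  ∀ β ∈ Γ, ‖β.2‖ ≤ ρ → (h + β.1 ∈ W ↔ h' + β.1 ∈ W)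

/-- A function of the internal parameter which is approximated by functions of patches, and whose
increments along lattice vectors are functions of patches. -/
structure IsPatternFunction (Γ : AddSubgroup ((Eucl n × C) × Eucl d)) (W : Set (Eucl n × C))
    (Φ : Finset (Eucl n →L[ℝ] ℝ)) (A : Finset ℝ) (f : Eucl n × C → ℝ) : Prop where
  approx : ∀ ε : ℝ, 0 < ε → ∃ ρ : ℝ, ∀ h h' : Eucl n × C, h.1 ∈ offHyperplanes Γ Φ A →
    h'.1 ∈ offHyperplanes Γ Φ A → h ∈ W → h' ∈ W → SamePatch Γ W ρ h h' → |f h - f h'| ≤ ε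
  increment : ∀ r : ℝ, ∃ R : ℝ, ∀ h h' : Eucl n × C, h.1 ∈ offHyperplanes Γ Φ A →
    h'.1 ∈ offHyperplanes Γ Φ A → h ∈ W → h' ∈ W → ∀ γ ∈ Γ, ‖γ.2‖ ≤ r → h + γ.1 ∈ W →
    h' + γ.1 ∈ W → SamePatch Γ W R h h' → f (h + γ.1) - f h = f (h' + γ.1) - f h'

variable {Γ : AddSubgroup ((Eucl n × C) × Eucl d)} {W : Set (Eucl n × C)}
  {Φ : Finset (Eucl n →L[ℝ] ℝ)} {A : Finset ℝ} {e₀ : Eucl n} {f : Eucl n × C → ℝ}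

theorem mem_offHyperplanes_add {e : Eucl n} (he : e ∈ offHyperplanes Γ Φ A)
    {γ : (Eucl n × C) × Eucl d} (hγ : γ ∈ Γ) : e + γ.1.1 ∈ offHyperplanes Γ Φ A := by
  rintro ⟨l, b⟩ ⟨hl, a, ha, β, hβ, hb⟩ heq
  simp only at hb heq hl
  refine he (l, b - l γ.1.1) ⟨hl, a, ha, β + γ, Γ.add_mem hβ hγ, ?_⟩ ?_
  · simp [hb]; ring
  · simp only
    rw [← heq, map_add]; ring

theorem SameSide.ne_zero_of_mem_segment {p : (Eucl n →L[ℝ] ℝ) × ℝ} {e e' x : Eucl n}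
    (h : SameSide p e e') (hx : x ∈ segment ℝ e e') : p.1 x ≠ p.2 := by
  obtain ⟨a, b, ha, hb, hab, rfl⟩ := hx
  unfold SameSide at h
  intro heq
  have h1 : a * (p.1 e - p.2) + b * (p.1 e' - p.2) = 0 := by
    simp only [map_add, map_smul, smul_eq_mul] at heq
    linear_combination heq - p.2 * hab
  have hsq : 0 < (p.1 e - p.2) ^ 2 := by
    have : p.1 e - p.2 ≠ 0 := by
      intro h0; rw [h0] at h; simp at h
    positivity
  have hsq' : 0 < (p.1 e' - p.2) ^ 2 := by
    have : p.1 e' - p.2 ≠ 0 := by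
      intro h0; rw [h0] at h; simp at h
    positivity
  rcases ha.eq_or_lt with rfl | ha'
  · have hb1 : b = 1 := by linarith
    subst hb1
    have h2 : p.1 e' - p.2 = 0 := by linarith
    rw [h2] at hsq'
    simp at hsq'
  · have h2 : a * (p.1 e - p.2) ^ 2 + b * ((p.1 e - p.2) * (p.1 e' - p.2)) = 0 := by
      linear_combination (p.1 e - p.2) * h1
    have h3 := mul_pos ha' hsq
    have h4 := mul_nonneg hb h.le
    linarith

/-- The segment between the two points stays in one slice and meets no hyperplane of the cover,
hence never the boundary of W. -/
theorem CoveredWindow.mem_iff_of_sameSide (D : CoveredWindow Γ W Φ A e₀) {e e' : Eucl n} {c : C}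
    (h : ∀ l ∈ Φ, ∀ a ∈ A, SameSide (l, a) e e') : (e, c) ∈ W ↔ (e', c) ∈ W := by
  by_contra hcon
  have hpre : IsPreconnected (segment ℝ e e' ×ˢ ({c} : Set C)) :=
    (convex_segment e e').isPreconnected.prod isPreconnected_singleton
  have h1 : (e, c) ∈ segment ℝ e e' ×ˢ ({c} : Set C) := ⟨left_mem_segment _ _ _, rfl⟩
  have h2 : (e', c) ∈ segment ℝ e e' ×ˢ ({c} : Set C) := ⟨right_mem_segment _ _ _, rfl⟩
  have hne : ((segment ℝ e e' ×ˢ ({c} : Set C)) ∩ W).Nonempty ∧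
      ((segment ℝ e e' ×ˢ ({c} : Set C)) ∩ Wᶜ).Nonempty := by
    by_cases hW : (e, c) ∈ W
    · exact ⟨⟨_, h1, hW⟩, ⟨_, h2, fun h' => hcon ⟨fun _ => h', fun _ => hW⟩⟩⟩
    · exact ⟨⟨_, h2, by tauto⟩, ⟨_, h1, hW⟩⟩
  have hfr : ∀ x ∈ segment ℝ e e' ×ˢ ({c} : Set C), x ∈ W → x ∈ interior W := by
    refine fun x hx hxW => mem_interior_of_notMem_frontier hxW fun hxf => ?_
    obtain ⟨l, hl, a, ha, heq⟩ := D.frontier_subset x hxf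
    exact (h l hl a ha).ne_zero_of_mem_segment hx.1 heq
  obtain ⟨x, hx, hxW⟩ := hne.1
  obtain ⟨y, -, hy1, hy2⟩ := hpre _ _ isOpen_interior D.window.compact.isClosed.isOpen_compl
    (fun z hz => (em (z ∈ W)).imp_left (hfr z hz)) ⟨x, hx, hfr x hx hxW⟩ hne.2
  exact hy2 (interior_subset hy1)

theorem CoveredWindow.add_mem_iff_of_sameSide (D : CoveredWindow Γ W Φ A e₀) {e e' : Eucl n} {c : C}
    {β : Eucl n × C} (h : ∀ l ∈ Φ, ∀ a ∈ A, SameSide (l, a - l β.1) e e') :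
    (e, c) + β ∈ W ↔ (e', c) + β ∈ W := by
  refine D.mem_iff_of_sameSide (e := e + β.1) (e' := e' + β.1) (c := c + β.2) fun l hl a ha => ?_
  have := h l hl a ha
  unfold SameSide at *
  simp only [map_add] at *
  convert this using 2 <;> ring

theorem CoveredWindow.exists_bound (D : CoveredWindow Γ W Φ A e₀) :
    ∃ w : ℝ, 0 ≤ w ∧ ∀ h ∈ W, ‖h.1‖ ≤ w := by
  obtain ⟨w, hw⟩ := (D.window.compact.image continuous_fst).isBounded.exists_norm_le
  refine ⟨max w 0, le_max_right _ _, fun h hh => (hw _ ⟨h, hh, rfl⟩).trans (le_max_left _ _)⟩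

theorem CoveredWindow.exists_ball (D : CoveredWindow Γ W Φ A e₀) :
    ∃ (e₁ : Eucl n) (c₁ : C) (s : ℝ), 0 < s ∧ ∀ e, ‖e - e₁‖ < 2 * s → (e, c₁) ∈ W := by
  obtain ⟨⟨e₁, c₁⟩, h⟩ := D.window.interior_nonempty
  have hc : ContinuousAt (fun e : Eucl n => (e, c₁)) e₁ := by fun_prop
  obtain ⟨s, hs, hs'⟩ := Metric.eventually_nhds_iff.1
    (hc.eventually (isOpen_interior.mem_nhds h))
  refine ⟨e₁, c₁, s / 2, by positivity, fun e he => interior_subset (hs' ?_)⟩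
  rw [dist_eq_norm]
  linarith

theorem exists_linear_bound {ι : Type} [Fintype ι] (μ : ι → (Eucl n × Eucl d →ₗ[ℝ] ℝ)) :
    ∃ K : ℝ, 0 ≤ K ∧ ∀ i x y, |μ i (x, y)| ≤ K * (‖x‖ + ‖y‖) := by
  refine ⟨∑ i, ‖LinearMap.toContinuousLinearMap (μ i)‖,
    Finset.sum_nonneg fun i _ => norm_nonneg _, fun i x y => ?_⟩
  have h1 := (LinearMap.toContinuousLinearMap (μ i)).le_opNorm (x, y)
  have h2 : ‖((x, y) : Eucl n × Eucl d)‖ ≤ ‖x‖ + ‖y‖ :=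
    max_le (by linarith [norm_nonneg y]) (by linarith [norm_nonneg x])
  have h3 := Finset.single_le_sum
    (fun i (_ : i ∈ Finset.univ) => norm_nonneg (LinearMap.toContinuousLinearMap (μ i)))
    (Finset.mem_univ i)
  calc |μ i (x, y)| ≤ _ := h1
    _ ≤ _ := mul_le_mul h3 h2 (norm_nonneg _) (Finset.sum_nonneg fun i _ => norm_nonneg _)

/-- Only lattice vectors with internal part of norm at most 2w can connect two points of W; the
others are absent from both patches. -/
theorem CoveredWindow.samePatch_add (D : CoveredWindow Γ W Φ A e₀) {w : ℝ}
    (hw : ∀ h ∈ W, ‖h.1‖ ≤ w) {e e' : Eucl n} {c : C} {g : (Eucl n × C) × Eucl d}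
    (hg : (e, c) + g.1 ∈ W) (hg' : (e', c) + g.1 ∈ W) {ϱ : ℝ}
    (h : ∀ β ∈ Γ, ‖β.2‖ ≤ ϱ → ‖β.1.1‖ ≤ 2 * w → ∀ l ∈ Φ, ∀ a ∈ A,
      SameSide (l, a - l (g + β).1.1) e e') :
    SamePatch Γ W ϱ ((e, c) + g.1) ((e', c) + g.1) := by
  intro β hβ hβϱ
  by_cases hβw : ‖β.1.1‖ ≤ 2 * w
  · rw [add_assoc, add_assoc]
    exact D.add_mem_iff_of_sameSide (h β hβ hβϱ hβw)
  · have key : ∀ z : Eucl n × C, z ∈ W → z + β.1 ∉ W := by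
      intro z hz hzβ
      have h1 := hw _ hz
      have h2 := hw _ hzβ
      refine hβw ?_
      have : β.1.1 = (z + β.1).1 - z.1 := by simp
      rw [this]
      exact (norm_sub_le _ _).trans (by linarith)
    exact iff_of_false (key _ hg) (key _ hg')

end Core

/-! ### Finiteness of the jumps: walking away from the slab -/

section Core

set_option linter.unusedSectionVars false

variable {d n : ℕ} {C : Type} [AddCommGroup C] [Finite C] [TopologicalSpace C] [DiscreteTopology C]
  {Γ : AddSubgroup ((Eucl n × C) × Eucl d)} {W : Set (Eucl n × C)}
  {Φ : Finset (Eucl n →L[ℝ] ℝ)} {A : Finset ℝ} {e₀ : Eucl n} {f : Eucl n × C → ℝ}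

/-- If the patches at two parameters coincide all along a walk through the lattice, then the values
of a pattern function differ as much at its start as at its end. -/
theorem sub_eq_of_walk {r R : ℝ}
    (hR : ∀ h h' : Eucl n × C, h.1 ∈ offHyperplanes Γ Φ A →
      h'.1 ∈ offHyperplanes Γ Φ A → h ∈ W → h' ∈ W → ∀ γ ∈ Γ, ‖γ.2‖ ≤ r → h + γ.1 ∈ W →
      h' + γ.1 ∈ W → SamePatch Γ W R h h' → f (h + γ.1) - f h = f (h' + γ.1) - f h')
    {h h' : Eucl n × C} (hh : h.1 ∈ offHyperplanes Γ Φ A) (hh' : h'.1 ∈ offHyperplanes Γ Φ A)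
    {g : ℕ → (Eucl n × C) × Eucl d} (hg0 : g 0 = 0) (hg : ∀ j, g j ∈ Γ)
    (hgW : ∀ j, h + (g j).1 ∈ W) (hgW' : ∀ j, h' + (g j).1 ∈ W)
    (hstep : ∀ j, ‖(g (j + 1)).2 - (g j).2‖ ≤ r) {k : ℕ}
    (hpatch : ∀ j < k, SamePatch Γ W R (h + (g j).1) (h' + (g j).1)) :
    f (h + (g k).1) - f (h' + (g k).1) = f h - f h' := by
  induction k with
  | zero => simp [hg0]
  | succ k ih =>
    rw [← ih fun j hj => hpatch j (hj.trans (Nat.lt_succ_self k))]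
    have h1 := hR (h + (g k).1) (h' + (g k).1) (mem_offHyperplanes_add hh (hg k))
      (mem_offHyperplanes_add hh' (hg k)) (hgW k) (hgW' k) (g (k + 1) - g k)
      (Γ.sub_mem (hg _) (hg _)) (hstep k)
    have e : ∀ z : Eucl n × C, z + (g k).1 + (g (k + 1) - g k).1 = z + (g (k + 1)).1 := by
      intro z; simp only [Prod.fst_sub]; abel
    rw [e, e] at h1
    have h2 := h1 (hgW _) (hgW' _) (hpatch k (Nat.lt_succ_self k))
    linarith

/-- For every normal `l` there are finitely many exceptional hyperplanes `l = b` such that a pattern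
function does not jump across the other ones. -/
theorem IsPatternFunction.exists_exceptional (D : CoveredWindow Γ W Φ A e₀)
    (hf : IsPatternFunction Γ W Φ A f) {l : Eucl n →L[ℝ] ℝ} (hl : l ∈ Φ) :
    ∃ S : Set ℝ, S.Finite ∧ ∀ ε : ℝ, 0 < ε → ∃ P : Set ((Eucl n →L[ℝ] ℝ) × ℝ), P.Finite ∧
      P ⊆ latticeHyperplanes Γ Φ A ∧ ∃ δ : ℝ, 0 < δ ∧ ∀ e e' c, e ∈ offHyperplanes Γ Φ A →
        e' ∈ offHyperplanes Γ Φ A → (e, c) ∈ W → (e', c) ∈ W → ‖e' - e‖ < δ → ∀ b ∉ S,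
        (∀ p ∈ P, ¬ SameSide p e e' → p = (l, b)) → |f (e, c) - f (e', c)| ≤ ε := by
  classical
  have hl0 : l ≠ 0 := by
    rintro rfl
    simpa using D.normalized _ hl
  obtain ⟨w, hw0, hw⟩ := D.exists_bound
  obtain ⟨e₁, c₁, s, hs, hball⟩ := D.exists_ball
  -- The walk of e is kept in a ball of half the available radius, so that the parallel walk of e',
  -- at distance less than s, remains in W.
  have hO : IsOpen (Metric.ball e₁ s ×ˢ ({c₁} : Set C)) :=
    Metric.isOpen_ball.prod (isOpen_discrete _)
  obtain ⟨r₀, hr₀, hdense⟩ := exists_lattice_add_mem_near D.scheme hO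
    ⟨(e₁, c₁), Metric.mem_ball_self hs, rfl⟩
  obtain ⟨ι, _, μ, u, hμu, hμl, hμfin⟩ := exists_transverse_functionals D.scheme hl0
  obtain ⟨K, hK0, hK⟩ := exists_linear_bound μ
  obtain ⟨U, hU0, hU⟩ : ∃ U : ℝ, 0 ≤ U ∧ ∀ i, ‖u i‖ ≤ U :=
    ⟨∑ i, ‖u i‖, Finset.sum_nonneg fun i _ => norm_nonneg _,
      fun i => Finset.single_le_sum (fun i _ => norm_nonneg (u i)) (Finset.mem_univ i)⟩
  -- On lattice vectors μ i depends on l only, so prescribing l among the finitely many a - a'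
  -- bounds μ i. This is the width of the slab.
  obtain ⟨m₀, hm₀⟩ : ∃ m₀ : ℝ, ∀ i, ∀ a ∈ A, ∀ a' ∈ A, ∀ γ ∈ Γ, l γ.1.1 = a - a' →
      |μ i (γ.1.1, γ.2)| ≤ m₀ := by
    have h1 : ∀ (i : ι) (t : ℝ), ∃ m : ℝ, ∀ γ ∈ Γ, l γ.1.1 = t → |μ i (γ.1.1, γ.2)| ≤ m := by
      intro i t
      by_cases h : ∃ γ ∈ Γ, l γ.1.1 = t
      · obtain ⟨γ, hγ, hγt⟩ := h
        refine ⟨|μ i (γ.1.1, γ.2)|, fun β hβ hβt => le_of_eq ?_⟩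
        have := hμl i (β - γ) (Γ.sub_mem hβ hγ) (by simp [hβt, hγt])
        have e : ((β - γ).1.1, (β - γ).2) = (β.1.1, β.2) - (γ.1.1, γ.2) := rfl
        rw [e, map_sub, sub_eq_zero] at this
        rw [this]
      · push Not at h
        exact ⟨0, fun γ hγ hγt => absurd hγt (h γ hγ)⟩
    choose m hm using h1
    refine ⟨∑ i, ∑ a ∈ A, ∑ a' ∈ A, |m i (a - a')|, fun i a ha a' ha' γ hγ hγl => ?_⟩
    calc |μ i (γ.1.1, γ.2)| ≤ m i (a - a') := hm _ _ γ hγ hγl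
      _ ≤ |m i (a - a')| := le_abs_self _
      _ ≤ ∑ a' ∈ A, |m i (a - a')| :=
        Finset.single_le_sum (f := fun a' => |m i (a - a')|) (fun _ _ => abs_nonneg _) ha'
      _ ≤ ∑ a ∈ A, ∑ a' ∈ A, |m i (a - a')| :=
        Finset.single_le_sum (f := fun a => ∑ a' ∈ A, |m i (a - a')|)
          (fun _ _ => Finset.sum_nonneg fun _ _ => abs_nonneg _) ha
      _ ≤ _ := Finset.single_le_sum (f := fun i => ∑ a ∈ A, ∑ a' ∈ A, |m i (a - a')|)
          (fun _ _ => Finset.sum_nonneg fun _ _ => Finset.sum_nonneg fun _ _ => abs_nonneg _)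
          (Finset.mem_univ i)
  obtain ⟨R, hR⟩ := hf.increment (2 * r₀ + U)
  -- Width of the slab, plus the deviation of the walk from its straight line, plus the extent of a
  -- patch of radius R, all measured by μ.
  set m₃ : ℝ := m₀ + K * (2 * w + r₀) + K * (2 * w + |R|) with hm₃
  -- The exceptional b come from lattice vectors at which every μ i is at most m₃, that is, from
  -- slabs all of which are near the origin. This choice does not involve ε.
  refine ⟨Set.image2 (fun a t => a - t) (A : Set ℝ) ((fun γ : (Eucl n × C) × Eucl d => l γ.1.1) ''
        {γ | γ ∈ Γ ∧ ∀ i, |μ i (γ.1.1, γ.2)| ≤ m₃}), A.finite_toSet.image2 _ (hμfin m₃),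
        fun ε hε => ?_⟩
  obtain ⟨ρ, hρ⟩ := hf.approx ε hε
  -- After k steps μ has drifted by k, enough for patches of radius ρ to miss the slab.
  obtain ⟨k, hk⟩ := exists_nat_ge (K * (2 * w + |ρ|))
  -- All lattice vectors that can occur in a patch met on the walk.
  set T : Set ((Eucl n × C) × Eucl d) :=
    {γ | γ ∈ Γ ∧ ‖γ.1.1‖ ≤ 4 * w ∧ ‖γ.2‖ ≤ k * U + r₀ + |R| + |ρ|} with hT
  have hTfin : T.Finite := finite_lattice_bounded D.scheme _ _
  refine ⟨⋃ l' ∈ Φ, ⋃ a ∈ A, (fun γ : (Eucl n × C) × Eucl d => (l', a - l' γ.1.1)) '' T,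
    Φ.finite_toSet.biUnion fun l' _ => A.finite_toSet.biUnion fun a _ => hTfin.image _, ?_,
    s, hs, ?_⟩
  · intro p hp
    simp only [Set.mem_iUnion] at hp
    obtain ⟨l', hl', a, ha, γ, hγ, rfl⟩ := hp
    exact ⟨hl', a, ha, γ, hγ.1, rfl⟩
  intro e e' c he he' heW heW' hee' b hb hcross
  have hside : ∀ γ ∈ T, (∀ a ∈ A, l γ.1.1 ≠ a - b) → ∀ l' ∈ Φ, ∀ a ∈ A,
      SameSide (l', a - l' γ.1.1) e e' := by
    intro γ hγ hγb l' hl' a ha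
    by_contra hcon
    have hp : (l', a - l' γ.1.1) ∈ ⋃ l' ∈ Φ, ⋃ a ∈ A,
        (fun γ : (Eucl n × C) × Eucl d => (l', a - l' γ.1.1)) '' T := by
      simp only [Set.mem_iUnion]
      exact ⟨l', hl', a, ha, γ, hγ, rfl⟩
    have h1 := hcross _ hp hcon
    obtain ⟨rfl, h2⟩ := Prod.mk.inj h1
    exact hγb a ha (by linarith)
  -- The direction v of the walk: the hyperplane l = b is seen neither by the patches of radius |R|
  -- on the way nor by the patch of radius |ρ| at the end.
  obtain ⟨v, hvU, hv⟩ : ∃ v : Eucl d, ‖v‖ ≤ U ∧ ∀ j : ℕ, ∀ g ∈ Γ, ∀ β ∈ Γ, ‖g.1.1‖ ≤ 2 * w →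
      ‖g.2 - (j : ℝ) • v‖ ≤ r₀ → ‖β.1.1‖ ≤ 2 * w → (‖β.2‖ ≤ |R| ∨ (j = k ∧ ‖β.2‖ ≤ |ρ|)) →
      ∀ a ∈ A, l (g + β).1.1 ≠ a - b := by
    by_cases hex : ∃ a₀ ∈ A, ∃ γ₀ ∈ Γ, b = a₀ - l γ₀.1.1
    · obtain ⟨a₀, ha₀, γ₀, hγ₀, rfl⟩ := hex
      obtain ⟨i, hi⟩ : ∃ i, m₃ < |μ i (γ₀.1.1, γ₀.2)| := by
        by_contra! hcon
        exact hb ⟨a₀, ha₀, _, ⟨γ₀, ⟨hγ₀, hcon⟩, rfl⟩, rfl⟩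
      -- The sign is chosen so that walking along σ • u i increases σ * μ i by 1 per step, away from
      -- the value at γ₀.
      obtain ⟨σ, hσ, hσi⟩ : ∃ σ : ℝ, |σ| = 1 ∧ σ * μ i (γ₀.1.1, γ₀.2) < -m₃ := by
        rcases lt_abs.1 hi with h | h
        · exact ⟨-1, by simp, by linarith⟩
        · exact ⟨1, by simp, by linarith⟩
      have hσσ : σ * σ = 1 := by rw [← abs_mul_abs_self, hσ, one_mul]
      refine ⟨σ • u i, ?_, ?_⟩
      · rw [norm_smul, Real.norm_eq_abs, hσ, one_mul]; exact hU i
      · intro j g hg β hβ hgw hgr hβw hβR a ha heq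
        have hσle : ∀ x : ℝ, |σ * x| = |x| := fun x => by rw [abs_mul, hσ, one_mul]
        have e1 : μ i (g.1.1, g.2) = μ i (g.1.1, g.2 - (j : ℝ) • σ • u i) + j * σ := by
          have : ((g.1.1, g.2) : Eucl n × Eucl d) =
              (g.1.1, g.2 - (j : ℝ) • σ • u i) + ((j : ℝ) * σ) • (0, u i) := by
            simp [mul_smul]
          rw [this, map_add, map_smul, hμu, smul_eq_mul, mul_one]
        have e2 : μ i ((g + β - γ₀).1.1, (g + β - γ₀).2) =
            μ i (g.1.1, g.2) + μ i (β.1.1, β.2) - μ i (γ₀.1.1, γ₀.2) := by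
          have : (((g + β - γ₀).1.1, (g + β - γ₀).2) : Eucl n × Eucl d) =
              (g.1.1, g.2) + (β.1.1, β.2) - (γ₀.1.1, γ₀.2) := rfl
          rw [this, map_sub, map_add]
        have b0 := hm₀ i a ha a₀ ha₀ (g + β - γ₀) (Γ.sub_mem (Γ.add_mem hg hβ) hγ₀) (by
          have : (g + β - γ₀).1.1 = (g + β).1.1 - γ₀.1.1 := rfl
          rw [this, map_sub, heq]; ring)
        have b1 : |μ i (g.1.1, g.2 - (j : ℝ) • σ • u i)| ≤ K * (2 * w + r₀) :=
          (hK _ _ _).trans (mul_le_mul_of_nonneg_left (add_le_add hgw hgr) hK0)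
        have b2 : |μ i (β.1.1, β.2)| ≤ K * (2 * w + ‖β.2‖) :=
          (hK _ _ _).trans (mul_le_mul_of_nonneg_left (add_le_add hβw le_rfl) hK0)
        rw [← hσle] at b0 b1 b2
        rw [e2, e1] at b0
        have c0 := (abs_le.1 b0).2
        have c0' := (abs_le.1 b0).1
        have c1 := (abs_le.1 b1).1
        have c2 := (abs_le.1 b2).1
        have hj0 : (0 : ℝ) ≤ j := Nat.cast_nonneg j
        have hexp : σ * (μ i (g.1.1, g.2 - (j : ℝ) • σ • u i) + j * σ + μ i (β.1.1, β.2) -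
            μ i (γ₀.1.1, γ₀.2)) = σ * μ i (g.1.1, g.2 - (j : ℝ) • σ • u i) + j +
            σ * μ i (β.1.1, β.2) - σ * μ i (γ₀.1.1, γ₀.2) := by
          linear_combination (j : ℝ) * hσσ
        rw [hexp] at c0
        have hKR : 0 ≤ K * (2 * w + |R|) := by positivity
        -- Both cases contradict the slab bound m₀: for radius |R| the choice of m₃ suffices at
        -- every j, for radius |ρ| the drift j = k compensates the larger patch.
        rcases hβR with h | ⟨rfl, h⟩
        · have : K * (2 * w + ‖β.2‖) ≤ K * (2 * w + |R|) :=
            mul_le_mul_of_nonneg_left (by linarith) hK0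
          linarith
        · have : K * (2 * w + ‖β.2‖) ≤ K * (2 * w + |ρ|) :=
            mul_le_mul_of_nonneg_left (by linarith) hK0
          linarith
    -- If b is no translate with normal l, nothing has to be avoided and the walk may stay in place.
    · refine ⟨0, by simpa using hU0, fun j g hg β hβ _ _ _ _ a ha heq => hex ?_⟩
      exact ⟨a, ha, g + β, Γ.add_mem hg hβ, by linarith⟩
  choose g' hg'Γ hg'O hg'v using fun j : ℕ => hdense (e, c) ((j : ℝ) • v)
  -- The walk must start exactly at the given parameters, so its first vector is 0 instead of one
  -- chosen to land in the ball.
  let g : ℕ → (Eucl n × C) × Eucl d := fun j => if j = 0 then 0 else g' j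
  have hg : ∀ j, g j ∈ Γ ∧ (e, c) + (g j).1 ∈ W ∧ (e', c) + (g j).1 ∈ W ∧
      ‖(g j).2 - (j : ℝ) • v‖ ≤ r₀ := by
    intro j
    by_cases hj : j = 0
    · have : g j = 0 := if_pos hj
      rw [this]
      subst hj
      exact ⟨Γ.zero_mem, by simpa using heW, by simpa using heW', by simpa using hr₀⟩
    · have : g j = g' j := if_neg hj
      rw [this]
      have h1 : ‖e + (g' j).1.1 - e₁‖ < s := by simpa [dist_eq_norm] using (hg'O j).1
      have h2 : c + (g' j).1.2 = c₁ := (hg'O j).2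
      have e1 : ∀ x : Eucl n, (x, c) + (g' j).1 = (x + (g' j).1.1, c₁) := fun x =>
        Prod.ext rfl h2
      refine ⟨hg'Γ j, ?_, ?_, hg'v j⟩
      · rw [e1]; exact hball _ (by linarith)
      · rw [e1]
        refine hball _ ?_
        have : e' + (g' j).1.1 - e₁ = (e' - e) + (e + (g' j).1.1 - e₁) := by abel
        rw [this]
        exact (norm_add_le _ _).trans_lt (by linarith)
  have hgw : ∀ j, ‖(g j).1.1‖ ≤ 2 * w := by
    intro j
    have : (g j).1.1 = ((e, c) + (g j).1).1 - e := by simp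
    rw [this]
    have h1 := hw _ (hg j).2.1
    have h2 := hw _ heW
    exact (norm_sub_le _ _).trans (by linarith)
  have hpatch : ∀ j ≤ k, ∀ ϱ : ℝ, (ϱ = |R| ∨ (j = k ∧ ϱ = |ρ|)) →
      SamePatch Γ W ϱ ((e, c) + (g j).1) ((e', c) + (g j).1) := by
    intro j hjk ϱ hϱ
    refine D.samePatch_add hw (hg j).2.1 (hg j).2.2.1 fun β hβ hβϱ hβw => ?_
    refine hside (g j + β) ⟨Γ.add_mem (hg j).1 hβ, ?_, ?_⟩ (hv j (g j) (hg j).1 β hβ (hgw j)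
      (hg j).2.2.2 hβw ?_)
    · exact (norm_add_le (g j).1.1 β.1.1).trans (by linarith [hgw j])
    · have h1 : ‖(g j).2‖ ≤ r₀ + j * U := by
        have e1 : (g j).2 = ((g j).2 - (j : ℝ) • v) + (j : ℝ) • v := by abel
        rw [e1]
        refine (norm_add_le _ _).trans (add_le_add (hg j).2.2.2 ?_)
        rw [norm_smul, Real.norm_eq_abs, abs_of_nonneg (Nat.cast_nonneg j)]
        exact mul_le_mul_of_nonneg_left hvU (Nat.cast_nonneg j)
      have h2 : (j : ℝ) * U ≤ k * U := mul_le_mul_of_nonneg_right (by exact_mod_cast hjk) hU0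
      have h3 : ‖β.2‖ ≤ |R| + |ρ| := by
        rcases hϱ with rfl | ⟨-, rfl⟩
        · linarith [abs_nonneg ρ]
        · linarith [abs_nonneg R]
      exact (norm_add_le (g j).2 β.2).trans (by linarith)
    · rcases hϱ with rfl | ⟨h, rfl⟩
      · exact Or.inl hβϱ
      · exact Or.inr ⟨h, hβϱ⟩
  have hwalk := sub_eq_of_walk hR (h := (e, c)) (h' := (e', c)) he he' (g := g) (if_pos rfl)
    (fun j => (hg j).1) (fun j => (hg j).2.1) (fun j => (hg j).2.2.1) (fun j => by
      have e1 : (g (j + 1)).2 - (g j).2 = ((g (j + 1)).2 - ((j + 1 : ℕ) : ℝ) • v) -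
          ((g j).2 - (j : ℝ) • v) + v := by
        push_cast
        rw [add_smul, one_smul]; abel
      rw [e1]
      refine (norm_add_le _ _).trans ?_
      have := norm_sub_le ((g (j + 1)).2 - ((j + 1 : ℕ) : ℝ) • v) ((g j).2 - (j : ℝ) • v)
      linarith [(hg j).2.2.2, (hg (j + 1)).2.2.2]) (k := k) (fun j hj β hβ hβR =>
        hpatch j hj.le _ (Or.inl rfl) β hβ (hβR.trans (le_abs_self R)))
  rw [← hwalk]
  exact hρ _ _ (mem_offHyperplanes_add he (hg k).1) (mem_offHyperplanes_add he' (hg k).1)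
    (hg k).2.1 (hg k).2.2.1 fun β hβ hβρ =>
      hpatch k le_rfl _ (Or.inr ⟨rfl, rfl⟩) β hβ (hβρ.trans (le_abs_self ρ))

end Core

/-! ### Counting crossings along a segment -/

section Core

set_option linter.unusedSectionVars false

theorem exists_root_of_mul_neg {x y s t : ℝ} (hst : s ≤ t)
    (h : (x + s * y) * (x + t * y) < 0) : ∃ τ, s < τ ∧ τ < t ∧ x + τ * y = 0 := by
  have hy : y ≠ 0 := by
    rintro rfl
    nlinarith [mul_self_nonneg x]
  have h1 : (s + x / y) * (t + x / y) < 0 := by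
    have e : (x + s * y) * (x + t * y) = (s + x / y) * (t + x / y) * y ^ 2 := by
      field_simp; ring
    rw [e] at h
    exact (neg_iff_pos_of_mul_neg h).2 (by positivity)
  refine ⟨-x / y, ?_, ?_, by field_simp; ring⟩
  · by_contra! h2
    rw [neg_div] at h2
    nlinarith
  · by_contra! h2
    rw [neg_div] at h2
    nlinarith

/-- A function on the unit interval which varies little between good points separated by at most one
root of finitely many affine functions with distinct roots. -/
theorem abs_sub_le_card_roots {ι : Type*} (P : Finset ι) (x y : ι → ℝ) (φ : ℝ → ℝ) {G : Set ℝ}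
    (hG : Dense G) (h0 : ∀ t ∈ G, ∀ p ∈ P, x p + t * y p ≠ 0)
    (hdist : ∀ p ∈ P, ∀ q ∈ P, p ≠ q → ∀ t, x p + t * y p = 0 → x q + t * y q ≠ 0) {ε : ℝ}
    (hstep : ∀ s ∈ G, ∀ t ∈ G, 0 ≤ s → s ≤ t → t ≤ 1 →
      (P.filter fun p => (x p + s * y p) * (x p + t * y p) < 0).card ≤ 1 → |φ s - φ t| ≤ ε) :
    ∀ k : ℕ, ∀ s ∈ G, ∀ t ∈ G, 0 ≤ s → s ≤ t → t ≤ 1 →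
      (P.filter fun p => (x p + s * y p) * (x p + t * y p) < 0).card = k →
      |φ s - φ t| ≤ max (k : ℝ) 1 * ε := by
  intro k
  induction k using Nat.strong_induction_on with
  | _ k ih =>
  intro s hs t ht h0s hst ht1 hcard
  by_cases hk : k ≤ 1
  · have h1 := hstep s hs t ht h0s hst ht1 (hcard.trans_le hk)
    have h2 : max (k : ℝ) 1 = 1 := max_eq_right (by exact_mod_cast hk)
    rwa [h2, one_mul]
  push Not at hk
  have hroot : ∀ p, (x p + s * y p) * (x p + t * y p) < 0 → ∃ τ, s < τ ∧ τ < t ∧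
      x p + τ * y p = 0 := fun p hp => exists_root_of_mul_neg hst hp
  obtain ⟨p, hp, q, hq, hpq⟩ := Finset.one_lt_card.1 (hcard.symm ▸ hk)
  obtain ⟨hpP, hp⟩ := Finset.mem_filter.1 hp
  obtain ⟨hqP, hq⟩ := Finset.mem_filter.1 hq
  obtain ⟨τ, hτs, hτt, hτ⟩ := hroot p hp
  obtain ⟨τ', hτs', hτt', hτ'⟩ := hroot q hq
  have hne : τ ≠ τ' := by
    rintro rfl
    exact hdist p hpP q hqP hpq τ hτ hτ'
  have hcross : ∀ p σ r, σ < r → x p + s * y p ≠ 0 → x p + t * y p ≠ 0 → s < σ → σ < t →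
      s < r → r < t → x p + σ * y p = 0 → (x p + s * y p) * (x p + r * y p) < 0 := by
    intro p σ r hσr h1 h2 h3 h4 h5 h6 h7
    have hy : y p ≠ 0 := by
      intro h; rw [h] at h7 h1; simp at h7 h1; exact h1 h7
    have e : (x p + s * y p) * (x p + r * y p) = (s - σ) * (r - σ) * y p ^ 2 := by
      have : x p = -(σ * y p) := by linarith
      rw [this]; ring
    rw [e]
    have : 0 < y p ^ 2 := by positivity
    exact mul_neg_of_neg_of_pos (mul_neg_of_neg_of_pos (by linarith) (by linarith)) this
  have hcross' : ∀ p σ r, r < σ → x p + s * y p ≠ 0 → x p + t * y p ≠ 0 → s < σ → σ < t →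
      s < r → r < t → x p + σ * y p = 0 → (x p + r * y p) * (x p + t * y p) < 0 := by
    intro p σ r hσr h1 h2 h3 h4 h5 h6 h7
    have hy : y p ≠ 0 := by
      intro h; rw [h] at h7 h1; simp at h7 h1; exact h1 h7
    have e : (x p + r * y p) * (x p + t * y p) = (r - σ) * (t - σ) * y p ^ 2 := by
      have : x p = -(σ * y p) := by linarith
      rw [this]; ring
    rw [e]
    have : 0 < y p ^ 2 := by positivity
    exact mul_neg_of_neg_of_pos (mul_neg_of_neg_of_pos (by linarith) (by linarith)) this
  -- A good point strictly between two distinct roots leaves a sign change on each side, so strong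
  -- induction applies to both halves.
  obtain ⟨r, hr, hsr, hrt, h1, h2⟩ : ∃ r ∈ G, s < r ∧ r < t ∧
      (P.filter fun p => (x p + s * y p) * (x p + r * y p) < 0).Nonempty ∧
      (P.filter fun p => (x p + r * y p) * (x p + t * y p) < 0).Nonempty := by
    rcases lt_or_gt_of_ne hne with h | h
    · obtain ⟨r, ⟨hr1, hr2⟩, hr⟩ := hG.inter_open_nonempty _ isOpen_Ioo (Set.nonempty_Ioo.2 h)
      refine ⟨r, hr, by linarith, by linarith, ⟨p, ?_⟩, ⟨q, ?_⟩⟩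
      · exact Finset.mem_filter.2 ⟨hpP, hcross p τ r hr1 (h0 s hs p hpP) (h0 t ht p hpP)
          hτs hτt (by linarith) (by linarith) hτ⟩
      · exact Finset.mem_filter.2 ⟨hqP, hcross' q τ' r hr2 (h0 s hs q hqP) (h0 t ht q hqP)
          hτs' hτt' (by linarith) (by linarith) hτ'⟩
    · obtain ⟨r, ⟨hr1, hr2⟩, hr⟩ := hG.inter_open_nonempty _ isOpen_Ioo (Set.nonempty_Ioo.2 h)
      refine ⟨r, hr, by linarith, by linarith, ⟨q, ?_⟩, ⟨p, ?_⟩⟩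
      · exact Finset.mem_filter.2 ⟨hqP, hcross q τ' r hr1 (h0 s hs q hqP) (h0 t ht q hqP)
          hτs' hτt' (by linarith) (by linarith) hτ'⟩
      · exact Finset.mem_filter.2 ⟨hpP, hcross' p τ r hr2 (h0 s hs p hpP) (h0 t ht p hpP)
          hτs hτt (by linarith) (by linarith) hτ⟩
  have hmid : ∀ p, (x p + s * y p) * (x p + r * y p) < 0 → 0 < (x p + r * y p) * (x p + t * y p) := by
    intro p hp
    have e : x p + t * y p = (x p + r * y p) + (t - r) * y p := by ring
    rcases mul_neg_iff.1 hp with ⟨a, b⟩ | ⟨a, b⟩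
    · have hy : y p < 0 := by
        by_contra! hcon
        nlinarith [mul_nonneg hcon (sub_pos.2 hsr).le]
      exact mul_pos_of_neg_of_neg b (by rw [e]; nlinarith [mul_neg_of_pos_of_neg (sub_pos.2 hrt) hy])
    · have hy : 0 < y p := by
        by_contra! hcon
        nlinarith [mul_nonneg (neg_nonneg.2 hcon) (sub_pos.2 hsr).le]
      exact mul_pos b (by rw [e]; nlinarith [mul_pos (sub_pos.2 hrt) hy])
  have hmid' : ∀ p, (x p + r * y p) * (x p + t * y p) < 0 → 0 < (x p + s * y p) * (x p + r * y p) := by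
    intro p hp
    have e : x p + s * y p = (x p + r * y p) - (r - s) * y p := by ring
    rcases mul_neg_iff.1 hp with ⟨a, b⟩ | ⟨a, b⟩
    · have hy : y p < 0 := by
        by_contra! hcon
        nlinarith [mul_nonneg hcon (sub_pos.2 hrt).le]
      exact mul_pos (by rw [e]; nlinarith [mul_neg_of_pos_of_neg (sub_pos.2 hsr) hy]) a
    · have hy : 0 < y p := by
        by_contra! hcon
        nlinarith [mul_nonneg (neg_nonneg.2 hcon) (sub_pos.2 hrt).le]
      exact mul_pos_of_neg_of_neg (by rw [e]; nlinarith [mul_pos (sub_pos.2 hsr) hy]) a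
  classical
  -- An affine function changes sign at most once, so the crossings of the two halves are disjoint
  -- and are crossings of the whole.
  have hle : (P.filter fun p => (x p + s * y p) * (x p + r * y p) < 0).card +
      (P.filter fun p => (x p + r * y p) * (x p + t * y p) < 0).card ≤ k := by
    rw [← hcard, ← Finset.card_union_of_disjoint]
    · refine Finset.card_le_card fun p hp => ?_
      rw [Finset.mem_union, Finset.mem_filter, Finset.mem_filter] at hp
      refine Finset.mem_filter.2 ⟨by tauto, ?_⟩
      have hsq : ∀ a b c : ℝ, a * b < 0 → 0 < b * c → a * c < 0 := by
        intro a b c h1 h2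
        by_contra! h3
        have hb : b ≠ 0 := by rintro rfl; simp at h1
        have : 0 < b ^ 2 := by positivity
        nlinarith [mul_neg_of_neg_of_pos h1 h2, mul_nonneg h3 this.le]
      rcases hp with ⟨_, hp⟩ | ⟨_, hp⟩
      · exact hsq _ _ _ hp (hmid p hp)
      · have := hsq (x p + t * y p) (x p + r * y p) (x p + s * y p) (by rwa [mul_comm])
          (by rw [mul_comm]; exact hmid' p hp)
        rwa [mul_comm]
    · rw [Finset.disjoint_filter]
      intro p _ h1 h2
      exact absurd (hmid p h1) (not_lt.2 h2.le)
  have c1 := Finset.card_pos.2 h1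
  have c2 := Finset.card_pos.2 h2
  have i1 := ih _ (by omega) s hs r hr h0s hsr.le (hrt.le.trans ht1) rfl
  have i2 := ih _ (by omega) r hr t ht (h0s.trans hsr.le) hrt.le ht1 rfl
  have hε : 0 ≤ ε := by
    have h3 := hstep s hs s hs h0s le_rfl (hst.trans ht1) (by
      rw [Finset.filter_false_of_mem (fun p _ => not_lt.2 (mul_self_nonneg _))]
      simp)
    exact (abs_nonneg _).trans h3
  have m1 : max (((P.filter fun p => (x p + s * y p) * (x p + r * y p) < 0).card : ℕ) : ℝ) 1 =
      ((P.filter fun p => (x p + s * y p) * (x p + r * y p) < 0).card : ℕ) :=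
    max_eq_left (by exact_mod_cast c1)
  have m2 : max (((P.filter fun p => (x p + r * y p) * (x p + t * y p) < 0).card : ℕ) : ℝ) 1 =
      ((P.filter fun p => (x p + r * y p) * (x p + t * y p) < 0).card : ℕ) :=
    max_eq_left (by exact_mod_cast c2)
  rw [m1] at i1
  rw [m2] at i2
  have hle' : (((P.filter fun p => (x p + s * y p) * (x p + r * y p) < 0).card : ℕ) : ℝ) +
      ((P.filter fun p => (x p + r * y p) * (x p + t * y p) < 0).card : ℕ) ≤ k := by
    exact_mod_cast hle
  calc |φ s - φ t| ≤ |φ s - φ r| + |φ r - φ t| := abs_sub_le _ _ _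
    _ ≤ _ := add_le_add i1 i2
    _ ≤ k * ε := by
      rw [← add_mul]
      exact mul_le_mul_of_nonneg_right hle' hε
    _ ≤ max (k : ℝ) 1 * ε := mul_le_mul_of_nonneg_right (le_max_left _ _) hε

end Core

/-! ### Segments in general position -/

section Core

set_option linter.unusedSectionVars false

variable {d n : ℕ} {C : Type} [AddCommGroup C] [Finite C] [TopologicalSpace C] [DiscreteTopology C]
  {Γ : AddSubgroup ((Eucl n × C) × Eucl d)} {W : Set (Eucl n × C)}
  {Φ : Finset (Eucl n →L[ℝ] ℝ)} {A : Finset ℝ} {e₀ : Eucl n} {f : Eucl n × C → ℝ}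

theorem dense_compl_countable_hyperplanes {S : Set ((Eucl n →L[ℝ] ℝ) × ℝ)} (hS : S.Countable)
    (h0 : ∀ p ∈ S, p.1 ≠ 0) : Dense {x | ∀ p ∈ S, p.1 x ≠ p.2} := by
  have := hS.to_subtype
  have h := dense_compl_hyperplanes (ι := S) (ν := fun p => p.1.1) (fun p => h0 p.1 p.2)
    (fun p => p.1.2)
  convert h using 2
  ext x
  simp

theorem countable_latticeHyperplanes (hΓ : IsCutProjectScheme Γ) :
    (latticeHyperplanes Γ Φ A).Countable := by
  have h : latticeHyperplanes Γ Φ A ⊆ ⋃ l ∈ (Φ : Set (Eucl n →L[ℝ] ℝ)), ⋃ a ∈ (A : Set ℝ),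
      (fun γ : (Eucl n × C) × Eucl d => (l, a - l γ.1.1)) '' (Γ : Set _) := by
    rintro ⟨l, b⟩ ⟨hl, a, ha, γ, hγ, hb⟩
    simp only [Set.mem_iUnion]
    simp only at hb hl
    exact ⟨l, hl, a, ha, γ, hγ, by rw [hb]⟩
  exact (Φ.finite_toSet.countable.biUnion fun l _ => A.finite_toSet.countable.biUnion fun a _ =>
    (countable_lattice hΓ).image _).mono h

theorem CoveredWindow.ne_zero (D : CoveredWindow Γ W Φ A e₀) {l : Eucl n →L[ℝ] ℝ} (hl : l ∈ Φ) :
    l ≠ 0 := by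
  rintro rfl
  simpa using D.normalized _ hl

theorem CoveredWindow.dense_offHyperplanes (D : CoveredWindow Γ W Φ A e₀) :
    Dense (offHyperplanes Γ Φ A) :=
  dense_compl_countable_hyperplanes (countable_latticeHyperplanes D.scheme)
    fun _ hp => D.ne_zero hp.1

theorem SameSide.add_smul {p : (Eucl n →L[ℝ] ℝ) × ℝ} {x v : Eucl n} (h : SameSide p x (x + v))
    {s : ℝ} (h0 : 0 ≤ s) (h1 : s ≤ 1) : SameSide p x (x + s • v) := by
  unfold SameSide at *
  simp only [map_add, map_smul, smul_eq_mul] at *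
  have hx : p.1 x - p.2 ≠ 0 := by
    intro h0; rw [h0] at h; simp at h
  have hsq : 0 < (p.1 x - p.2) ^ 2 := by positivity
  have e : (p.1 x - p.2) * (p.1 x + s * p.1 v - p.2) = (1 - s) * (p.1 x - p.2) ^ 2 +
    s * ((p.1 x - p.2) * (p.1 x + p.1 v - p.2)) := by ring
  rw [e]
  rcases h0.eq_or_lt with rfl | hs
  · simpa using hsq
  · have := mul_pos hs h
    have := mul_nonneg (sub_nonneg.2 h1) hsq.le
    linarith

theorem SameSide.symm {p : (Eucl n →L[ℝ] ℝ) × ℝ} {x y : Eucl n} (h : SameSide p x y) :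
    SameSide p y x := by
  unfold SameSide at *
  rwa [mul_comm]

theorem SameSide.trans {p : (Eucl n →L[ℝ] ℝ) × ℝ} {x y z : Eucl n} (h : SameSide p x y)
    (h' : SameSide p y z) : SameSide p x z := by
  unfold SameSide at *
  have hy : p.1 y - p.2 ≠ 0 := by
    intro h0; rw [h0] at h; simp at h
  have hsq : 0 < (p.1 y - p.2) ^ 2 := by positivity
  by_contra! hcon
  nlinarith [mul_pos h h', mul_nonneg_of_nonpos_of_nonpos hcon (neg_nonpos.2 hsq.le)]

theorem eventually_sameSide {p : (Eucl n →L[ℝ] ℝ) × ℝ} {e : Eucl n} (h : p.1 e ≠ p.2) :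
    ∀ᶠ z in 𝓝 (0 : Eucl n), SameSide p e (e + z) := by
  have hc : Continuous fun z : Eucl n => (p.1 e - p.2) * (p.1 (e + z) - p.2) := by fun_prop
  refine (hc.tendsto 0).eventually_const_lt ?_
  rw [add_zero]
  exact mul_self_pos.2 (sub_ne_zero.2 h)

theorem exists_finite_gap {P : Set ((Eucl n →L[ℝ] ℝ) × ℝ)} (hP : P.Finite) :
    ∃ δ : ℝ, 0 < δ ∧ ∀ p ∈ P, ∀ q ∈ P, p.2 ≠ q.2 → δ ≤ |p.2 - q.2| := by
  have hev : ∀ᶠ δ : ℝ in 𝓝[>] 0, ∀ p ∈ P, ∀ q ∈ P, p.2 ≠ q.2 → δ ≤ |p.2 - q.2| := by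
    refine (Filter.eventually_all_finite hP).2 fun p _ => (Filter.eventually_all_finite hP).2
      fun q _ => ?_
    by_cases h : p.2 = q.2
    · exact Filter.Eventually.of_forall fun _ h' => absurd h h'
    · exact ((eventually_le_nhds (abs_pos.2 (sub_ne_zero.2 h))).filter_mono
        nhdsWithin_le_nhds).mono fun _ h _ => h
  obtain ⟨δ, h1, h2⟩ := (hev.and self_mem_nhdsWithin).exists
  exact ⟨δ, h2, h1⟩

/-- A line through a point off all hyperplanes meets each of them at most once, so only countably
many parameters are lost. -/
theorem dense_line_offHyperplanes (hΓ : IsCutProjectScheme Γ) {x : Eucl n} (v : Eucl n)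
    (hx : x ∈ offHyperplanes Γ Φ A) : Dense {t : ℝ | x + t • v ∈ offHyperplanes Γ Φ A} := by
  have hc : (⋃ p ∈ latticeHyperplanes Γ Φ A, {t : ℝ | p.1 (x + t • v) = p.2}).Countable := by
    refine (countable_latticeHyperplanes hΓ).biUnion fun p hp => Set.Subsingleton.countable ?_
    intro s hs t ht
    have hs' : p.1 (x + s • v) = p.2 := hs
    have ht' : p.1 (x + t • v) = p.2 := ht
    simp only [map_add, map_smul, smul_eq_mul] at hs' ht'
    have hv : p.1 v ≠ 0 := by
      intro h
      rw [h] at hs'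
      exact hx p hp (by linarith)
    have : (s - t) * p.1 v = 0 := by linarith
    exact sub_eq_zero.1 ((mul_eq_zero.1 this).resolve_right hv)
  have hd := hc.dense_compl ℝ
  refine hd.mono ?_
  intro t ht p hp heq
  exact ht (Set.mem_biUnion hp heq)

/-- A small displacement after which a segment meets no two of finitely many hyperplanes at once. -/
theorem CoveredWindow.exists_displacement (D : CoveredWindow Γ W Φ A e₀)
    {P : Set ((Eucl n →L[ℝ] ℝ) × ℝ)} (hP : P.Finite) (hPΓ : P ⊆ latticeHyperplanes Γ Φ A)
    {e v : Eucl n} (he : e ∈ offHyperplanes Γ Φ A) (hev : e + v ∈ offHyperplanes Γ Φ A) :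
    ∃ z : Eucl n, (∀ p ∈ P, SameSide p e (e + z)) ∧ (∀ p ∈ P, SameSide p (e + v) (e + v + z)) ∧
      e + z ∈ offHyperplanes Γ Φ A ∧ e + v + z ∈ offHyperplanes Γ Φ A ∧
      ∀ p ∈ P, ∀ q ∈ P, p ≠ q → ∀ t : ℝ, p.1 (e + z + t • v) = p.2 →
        q.1 (e + z + t • v) ≠ q.2 := by
  have hc := countable_latticeHyperplanes (Φ := Φ) (A := A) D.scheme
  -- Eliminating t from the two equations p = p.2 and q = q.2 along the displaced line leaves one
  -- linear condition on z with normal ν (p, q).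
  let ν : ((Eucl n →L[ℝ] ℝ) × ℝ) × ((Eucl n →L[ℝ] ℝ) × ℝ) → (Eucl n →L[ℝ] ℝ) := fun r =>
    r.2.1 v • r.1.1 - r.1.1 v • r.2.1
  let S : Set ((Eucl n →L[ℝ] ℝ) × ℝ) :=
    (fun p => (p.1, p.2 - p.1 e)) '' latticeHyperplanes Γ Φ A ∪
    (fun p => (p.1, p.2 - p.1 (e + v))) '' latticeHyperplanes Γ Φ A ∪
    (fun r => (ν r, r.2.1 v * r.1.2 - r.1.1 v * r.2.2 - ν r e)) '' {r | r ∈ P ×ˢ P ∧ ν r ≠ 0}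
  have hS : S.Countable := ((hc.image _).union (hc.image _)).union
    (((hP.prod hP).subset fun r hr => hr.1).countable.image _)
  have hd : Dense {x | ∀ p ∈ S, p.1 x ≠ p.2} := by
    refine dense_compl_countable_hyperplanes hS ?_
    rintro _ ((⟨p, hp, rfl⟩ | ⟨p, hp, rfl⟩) | ⟨r, hr, rfl⟩)
    · exact D.ne_zero hp.1
    · exact D.ne_zero hp.1
    · exact hr.2
  have hN : ∀ᶠ z in 𝓝 (0 : Eucl n), ∀ p ∈ P, SameSide p e (e + z) ∧
      SameSide p (e + v) (e + v + z) := (Filter.eventually_all_finite hP).2 fun p hp =>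
    (eventually_sameSide (he p (hPΓ hp))).and (eventually_sameSide (hev p (hPΓ hp)))
  obtain ⟨N, hN, hNo, h0⟩ := mem_nhds_iff.1 hN
  obtain ⟨z, hzN, hz⟩ := hd.inter_open_nonempty N hNo ⟨0, h0⟩
  have hez : e + z ∈ offHyperplanes Γ Φ A := by
    intro p hp heq
    refine hz _ (Or.inl (Or.inl ⟨p, hp, rfl⟩)) ?_
    simp only
    rw [← heq, map_add]; ring
  have hevz : e + v + z ∈ offHyperplanes Γ Φ A := by
    intro p hp heq
    refine hz _ (Or.inl (Or.inr ⟨p, hp, rfl⟩)) ?_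
    simp only
    rw [← heq, map_add p.1 (e + v)]; ring
  refine ⟨z, fun p hp => (hN hzN p hp).1, fun p hp => (hN hzN p hp).2, hez, hevz, ?_⟩
  intro p hp q hq hpq t h1 h2
  simp only [map_add, map_smul, smul_eq_mul] at h1 h2
  have hpv : p.1 v ≠ 0 := by
    intro h
    refine hez p (hPΓ hp) ?_
    rw [map_add]
    rw [h] at h1
    linarith
  -- If ν vanishes, the normals are proportional, hence equal as both are 1 at e₀; a common point
  -- would then force p = q.
  by_cases hν : ν (p, q) = 0
  · have h3 : q.1 v * p.1 e₀ - p.1 v * q.1 e₀ = 0 := by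
      simpa [ν] using congrArg (fun m : Eucl n →L[ℝ] ℝ => m e₀) hν
    rw [D.normalized _ (hPΓ hp).1, D.normalized _ (hPΓ hq).1] at h3
    have h4 : q.1 v = p.1 v := by linarith
    have h5 : p.1 = q.1 := by
      have : p.1 v • (p.1 - q.1) = 0 := by
        rw [smul_sub]
        simpa [ν, h4] using hν
      exact sub_eq_zero.1 ((smul_eq_zero.1 this).resolve_left hpv)
    refine hpq (Prod.ext h5 ?_)
    rw [← h1, ← h2, h5]
  · refine hz _ (Or.inr ⟨(p, q), ⟨⟨hp, hq⟩, hν⟩, rfl⟩) ?_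
    simp only [ν, sub_apply, smul_apply, smul_eq_mul]
    linear_combination q.1 v * h1 - p.1 v * h2

end Core

/-! ### Uniform continuity off finitely many hyperplanes -/

section Core

set_option linter.unusedSectionVars false

variable {d n : ℕ} {C : Type} [AddCommGroup C] [Finite C] [TopologicalSpace C] [DiscreteTopology C]
  {Γ : AddSubgroup ((Eucl n × C) × Eucl d)} {W : Set (Eucl n × C)}
  {Φ : Finset (Eucl n →L[ℝ] ℝ)} {A : Finset ℝ} {e₀ : Eucl n} {f : Eucl n × C → ℝ}

/-- A patch of radius ρ depends on finitely many lattice vectors, hence only on the sides of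
finitely many hyperplanes. -/
theorem IsPatternFunction.exists_finite_approx (D : CoveredWindow Γ W Φ A e₀)
    (hf : IsPatternFunction Γ W Φ A f) {ε : ℝ} (hε : 0 < ε) :
    ∃ P : Set ((Eucl n →L[ℝ] ℝ) × ℝ), P.Finite ∧ P ⊆ latticeHyperplanes Γ Φ A ∧
      ∀ e e' c, e ∈ offHyperplanes Γ Φ A → e' ∈ offHyperplanes Γ Φ A → (e, c) ∈ W → (e', c) ∈ W →
        (∀ p ∈ P, SameSide p e e') → |f (e, c) - f (e', c)| ≤ ε := by
  obtain ⟨ρ, hρ⟩ := hf.approx ε hε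
  obtain ⟨w, -, hw⟩ := D.exists_bound
  have hT := finite_lattice_bounded D.scheme (2 * w) ρ
  refine ⟨⋃ l ∈ (Φ : Set (Eucl n →L[ℝ] ℝ)), ⋃ a ∈ (A : Set ℝ),
    (fun γ : (Eucl n × C) × Eucl d => (l, a - l γ.1.1)) ''
      {γ | γ ∈ Γ ∧ ‖γ.1.1‖ ≤ 2 * w ∧ ‖γ.2‖ ≤ ρ},
    Φ.finite_toSet.biUnion fun l' _ => A.finite_toSet.biUnion fun a _ => hT.image _, ?_, ?_⟩
  · intro p hp
    simp only [Set.mem_iUnion] at hp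
    obtain ⟨l, hl, a, ha, γ, hγ, rfl⟩ := hp
    exact ⟨hl, a, ha, γ, hγ.1, rfl⟩
  · intro e e' c he he' heW heW' h
    refine hρ (e, c) (e', c) he he' heW heW' ?_
    have := D.samePatch_add hw (g := 0) (e := e) (e' := e') (c := c) (by simpa using heW)
      (by simpa using heW') (ϱ := ρ) fun β hβ hβρ hβw l hl a ha => h _ (by
        simp only [Set.mem_iUnion]
        exact ⟨l, hl, a, ha, β, ⟨hβ, hβw, hβρ⟩, by simp⟩)
    simpa using this

/-- Off finitely many hyperplanes, pattern functions are locally uniformly continuous. -/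
theorem IsPatternFunction.exists_modulus (D : CoveredWindow Γ W Φ A e₀)
    (hf : IsPatternFunction Γ W Φ A f) :
    ∃ B : Set ((Eucl n →L[ℝ] ℝ) × ℝ), B.Finite ∧ B ⊆ latticeHyperplanes Γ Φ A ∧
      (∀ l ∈ Φ, ∀ a ∈ A, (l, a) ∈ B) ∧ ∀ ε : ℝ, 0 < ε → ∃ δ : ℝ, 0 < δ ∧ ∀ e e' c,
        e ∈ offHyperplanes Γ Φ A → e' ∈ offHyperplanes Γ Φ A → (e, c) ∈ W → (e', c) ∈ W →
        ‖e' - e‖ < δ → (∀ p ∈ B, SameSide p e e') → |f (e, c) - f (e', c)| ≤ ε := by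
  classical
  have hS : ∀ l : Eucl n →L[ℝ] ℝ, ∃ S : Set ℝ, S.Finite ∧ (l ∈ Φ → ∀ ε : ℝ, 0 < ε →
      ∃ P : Set ((Eucl n →L[ℝ] ℝ) × ℝ), P.Finite ∧
      P ⊆ latticeHyperplanes Γ Φ A ∧ ∃ δ : ℝ, 0 < δ ∧ ∀ e e' c, e ∈ offHyperplanes Γ Φ A →
        e' ∈ offHyperplanes Γ Φ A → (e, c) ∈ W → (e', c) ∈ W → ‖e' - e‖ < δ → ∀ b ∉ S,
        (∀ p ∈ P, ¬ SameSide p e e' → p = (l, b)) → |f (e, c) - f (e', c)| ≤ ε) := by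
    intro l
    by_cases hl : l ∈ Φ
    · obtain ⟨S, hS, h⟩ := hf.exists_exceptional D hl
      exact ⟨S, hS, fun _ => h⟩
    · exact ⟨∅, Set.finite_empty, fun h => absurd h hl⟩
  choose S hSfin hS using hS
  have hBfin : (⋃ l ∈ (Φ : Set (Eucl n →L[ℝ] ℝ)), (fun b => (l, b)) '' (S l ∪ A)).Finite :=
    Φ.finite_toSet.biUnion fun l _ => ((hSfin l).union A.finite_toSet).image _
  -- B consists of the exceptional hyperplanes and those carrying ∂W; the latter ensure that
  -- segments not crossing B do not leave W.
  refine ⟨(⋃ l ∈ (Φ : Set (Eucl n →L[ℝ] ℝ)), (fun b => (l, b)) '' (S l ∪ A)) ∩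
    latticeHyperplanes Γ Φ A, hBfin.subset Set.inter_subset_left, Set.inter_subset_right, ?_, ?_⟩
  · intro l hl a ha
    refine ⟨?_, hl, a, ha, 0, Γ.zero_mem, by simp⟩
    simp only [Set.mem_iUnion]
    exact ⟨l, hl, a, Or.inr ha, rfl⟩
  set B := (⋃ l ∈ (Φ : Set (Eucl n →L[ℝ] ℝ)), (fun b => (l, b)) '' (S l ∪ A)) ∩
    latticeHyperplanes Γ Φ A with hB
  have hBS : ∀ p ∈ latticeHyperplanes Γ Φ A, p ∉ B → p.2 ∉ S p.1 := by
    intro p hp hpB hpS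
    refine hpB ⟨?_, hp⟩
    simp only [Set.mem_iUnion]
    exact ⟨p.1, hp.1, p.2, Or.inl hpS, rfl⟩
  have hBA : ∀ l ∈ Φ, ∀ a ∈ A, (l, a) ∈ B := by
    intro l hl a ha
    refine ⟨?_, hl, a, ha, 0, Γ.zero_mem, by simp⟩
    simp only [Set.mem_iUnion]
    exact ⟨l, hl, a, Or.inr ha, rfl⟩
  intro ε hε
  -- At most Φ.card + 1 for the segment, where the 1 covers the case of no crossing, and 2 for
  -- displacing its endpoints.
  set ε₁ : ℝ := ε / (Φ.card + 3) with hε₁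
  have hε₁0 : 0 < ε₁ := by positivity
  obtain ⟨P₀, hP₀, hP₀Γ, happ⟩ := hf.exists_finite_approx D hε₁0
  have hex : ∀ l : Eucl n →L[ℝ] ℝ, ∃ (P : Set ((Eucl n →L[ℝ] ℝ) × ℝ)) (δ : ℝ), P.Finite ∧
      P ⊆ latticeHyperplanes Γ Φ A ∧ 0 < δ ∧ (l ∈ Φ → ∀ e e' c, e ∈ offHyperplanes Γ Φ A →
        e' ∈ offHyperplanes Γ Φ A → (e, c) ∈ W → (e', c) ∈ W → ‖e' - e‖ < δ → ∀ b ∉ S l,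
        (∀ p ∈ P, ¬ SameSide p e e' → p = (l, b)) → |f (e, c) - f (e', c)| ≤ ε₁) := by
    intro l
    by_cases hl : l ∈ Φ
    · obtain ⟨P, h1, h2, δ, h3, h4⟩ := hS l hl ε₁ hε₁0
      exact ⟨P, δ, h1, h2, h3, fun _ => h4⟩
    · exact ⟨∅, 1, Set.finite_empty, Set.empty_subset _, one_pos, fun h => absurd h hl⟩
  choose Pl δl hPl hPlΓ hδl hstep using hex
  have hPfin : ((⋃ l ∈ (Φ : Set (Eucl n →L[ℝ] ℝ)), Pl l) ∪ P₀ ∪ B).Finite :=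
    ((Φ.finite_toSet.biUnion fun l _ => hPl l).union hP₀).union (hBfin.subset Set.inter_subset_left)
  have hPΓ : ((⋃ l ∈ (Φ : Set (Eucl n →L[ℝ] ℝ)), Pl l) ∪ P₀ ∪ B) ⊆ latticeHyperplanes Γ Φ A :=
    Set.union_subset (Set.union_subset (Set.iUnion₂_subset fun l _ => hPlΓ l) hP₀Γ)
      Set.inter_subset_right
  set P := (⋃ l ∈ (Φ : Set (Eucl n →L[ℝ] ℝ)), Pl l) ∪ P₀ ∪ B with hP
  have hPlP : ∀ l ∈ Φ, Pl l ⊆ P := fun l hl p hp =>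
    Or.inl (Or.inl (Set.mem_biUnion (x := l) hl hp))
  have hP₀P : P₀ ⊆ P := fun p hp => Or.inl (Or.inr hp)
  have hBP : B ⊆ P := fun p hp => Or.inr hp
  -- With ‖l‖ * δ below the gap, a segment shorter than δ crosses at most one hyperplane of P for
  -- each normal l.
  obtain ⟨δ₀, hδ₀, hgap⟩ := exists_finite_gap hPfin
  have hev : ∀ᶠ δ : ℝ in 𝓝[>] 0, ∀ l ∈ (Φ : Set (Eucl n →L[ℝ] ℝ)), δ ≤ δl l ∧ ‖l‖ * δ < δ₀ := by
    refine (Filter.eventually_all_finite Φ.finite_toSet).2 fun l _ => ?_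
    have hc : Continuous fun δ : ℝ => ‖l‖ * δ := by fun_prop
    exact ((eventually_le_nhds (hδl l)).and
      ((hc.tendsto 0).eventually_lt_const (by simpa using hδ₀))).filter_mono nhdsWithin_le_nhds
  obtain ⟨δ, hδ, hδ0⟩ := (hev.and self_mem_nhdsWithin).exists
  refine ⟨δ, hδ0, fun e e' c he he' heW heW' hee' hside => ?_⟩
  obtain ⟨v, rfl⟩ : ∃ v, e' = e + v := ⟨e' - e, by abel⟩
  rw [add_sub_cancel_left] at hee'
  obtain ⟨z, hz1, hz2, hxG, hxG', hdist⟩ := D.exists_displacement hPfin hPΓ he he'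
  have hxv : e + v + z = e + z + v := by abel
  rw [hxv] at hxG'
  have hxside : ∀ p ∈ B, SameSide p (e + z) (e + z + v) := fun p hp => by
    rw [← hxv]
    exact ((hz1 p (hBP hp)).symm.trans (hside p hp)).trans (hz2 p (hBP hp))
  have hxW : (e + z, c) ∈ W := (D.mem_iff_of_sameSide fun l hl a ha =>
    hz1 _ (hBP (hBA l hl a ha))).1 heW
  have hxW' : (e + z + v, c) ∈ W := (D.mem_iff_of_sameSide fun l hl a ha => by
    rw [← hxv]; exact hz2 _ (hBP (hBA l hl a ha))).1 heW'
  have hfirst : |f (e, c) - f (e + z, c)| ≤ ε₁ :=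
    happ _ _ _ he hxG heW hxW fun p hp => hz1 p (hP₀P hp)
  have hlast : |f (e + z + v, c) - f (e + v, c)| ≤ ε₁ :=
    happ _ _ _ hxG' he' hxW' heW' fun p hp => by
      rw [← hxv]; exact (hz2 p (hP₀P hp)).symm
  set x := e + z with hx
  have hval : ∀ p : (Eucl n →L[ℝ] ℝ) × ℝ, ∀ t : ℝ,
      p.1 (x + t • v) - p.2 = p.1 x - p.2 + t * p.1 v := by
    intro p t
    simp only [map_add, map_smul, smul_eq_mul]; ring
  have hmid := abs_sub_le_card_roots hPfin.toFinset (fun p => p.1 x - p.2) (fun p => p.1 v)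
    (fun t => f (x + t • v, c)) (dense_line_offHyperplanes D.scheme v hxG)
    (fun t ht p hp h0 => ht p (hPΓ (hPfin.mem_toFinset.1 hp)) (by
      rw [← hval] at h0; linarith))
    (fun p hp q hq hpq t h1 h2 => hdist p (hPfin.mem_toFinset.1 hp) q (hPfin.mem_toFinset.1 hq)
      hpq t (by rw [← hval] at h1; linarith) (by rw [← hval] at h2; linarith)) (ε := ε₁) (by
    intro s hs t ht h0s hst ht1 hcard
    have hsB : ∀ p ∈ B, SameSide p x (x + s • v) := fun p hp =>
      (hxside p hp).add_smul h0s (hst.trans ht1)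
    have htB : ∀ p ∈ B, SameSide p x (x + t • v) := fun p hp =>
      (hxside p hp).add_smul (h0s.trans hst) ht1
    have hsW : (x + s • v, c) ∈ W := (D.mem_iff_of_sameSide fun l hl a ha =>
      hsB _ (hBA l hl a ha)).1 hxW
    have htW : (x + t • v, c) ∈ W := (D.mem_iff_of_sameSide fun l hl a ha =>
      htB _ (hBA l hl a ha)).1 hxW
    have hcross : ∀ p ∈ P, ¬ SameSide p (x + s • v) (x + t • v) → p ∈ hPfin.toFinset.filter fun p =>
        (p.1 x - p.2 + s * p.1 v) * (p.1 x - p.2 + t * p.1 v) < 0 := by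
      intro p hp hns
      refine Finset.mem_filter.2 ⟨hPfin.mem_toFinset.2 hp, ?_⟩
      rw [← hval, ← hval]
      refine lt_of_le_of_ne (not_lt.1 hns) (mul_ne_zero ?_ ?_)
      · exact sub_ne_zero.2 (hs p (hPΓ hp))
      · exact sub_ne_zero.2 (ht p (hPΓ hp))
    have hlen : ‖x + t • v - (x + s • v)‖ < δ := by
      have : x + t • v - (x + s • v) = (t - s) • v := by rw [sub_smul]; abel
      rw [this, norm_smul, Real.norm_eq_abs, abs_of_nonneg (sub_nonneg.2 hst)]
      have : (t - s) * ‖v‖ ≤ 1 * ‖v‖ := mul_le_mul_of_nonneg_right (by linarith) (norm_nonneg _)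
      linarith
    by_cases hno : ∀ p ∈ P, SameSide p (x + s • v) (x + t • v)
    · exact happ _ _ _ hs ht hsW htW fun p hp => hno p (hP₀P hp)
    · push Not at hno
      obtain ⟨p, hp, hns⟩ := hno
      have hpB : p ∉ B := fun hpB => hns ((hsB p hpB).symm.trans (htB p hpB))
      have hpΦ := (hPΓ hp).1
      -- A piece with a single crossing p: as p is not in B, it is not exceptional, so f changes by
      -- at most ε₁.
      refine hstep p.1 hpΦ _ _ _ hs ht hsW htW (hlen.trans_le (hδ p.1 hpΦ).1) p.2
        (hBS p (hPΓ hp) hpB) fun q hq hqns => ?_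
      exact Finset.card_le_one.1 hcard q (hcross q (hPlP _ hpΦ hq) hqns) p (hcross p hp hns))
    _ 0 (by simpa using hxG) 1 (by simpa using hxG') le_rfl zero_le_one le_rfl rfl
  have hcardle : (hPfin.toFinset.filter fun p =>
      (p.1 x - p.2 + 0 * p.1 v) * (p.1 x - p.2 + 1 * p.1 v) < 0).card ≤ Φ.card := by
    refine Finset.card_le_card_of_injOn Prod.fst (fun p hp => ?_) ?_
    · exact (hPΓ (hPfin.mem_toFinset.1 (Finset.mem_filter.1 hp).1)).1
    · intro p hp q hq hpq
      obtain ⟨hpP, hp⟩ := Finset.mem_filter.1 hp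
      obtain ⟨hqP, hq⟩ := Finset.mem_filter.1 hq
      rw [hPfin.mem_toFinset] at hpP hqP
      obtain ⟨τ, a1, a2, a3⟩ := exists_root_of_mul_neg zero_le_one hp
      obtain ⟨τ', b1, b2, b3⟩ := exists_root_of_mul_neg zero_le_one hq
      refine Prod.ext hpq ?_
      by_contra hne
      have h1 := hgap p hpP q hqP hne
      rw [← hpq] at b3
      have h2 : p.2 - q.2 = (τ - τ') * p.1 v := by linarith
      have h3 : |p.1 v| ≤ ‖p.1‖ * ‖v‖ := p.1.le_opNorm v
      have h4 : |τ - τ'| ≤ 1 := abs_le.2 ⟨by linarith, by linarith⟩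
      rw [h2, abs_mul] at h1
      have h5 : |τ - τ'| * |p.1 v| ≤ 1 * |p.1 v| := mul_le_mul_of_nonneg_right h4 (abs_nonneg _)
      have h6 : ‖p.1‖ * ‖v‖ ≤ ‖p.1‖ * δ := mul_le_mul_of_nonneg_left hee'.le (norm_nonneg _)
      have h7 := (hδ p.1 (hPΓ hpP).1).2
      linarith
  simp only [zero_smul, add_zero, one_smul] at hmid
  have hmax : max (((hPfin.toFinset.filter fun p =>
      (p.1 x - p.2 + 0 * p.1 v) * (p.1 x - p.2 + 1 * p.1 v) < 0).card : ℕ) : ℝ) 1 ≤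
      Φ.card + 1 := by
    refine max_le ?_ (by linarith [(Nat.cast_nonneg Φ.card : (0 : ℝ) ≤ _)])
    have : (((hPfin.toFinset.filter fun p =>
      (p.1 x - p.2 + 0 * p.1 v) * (p.1 x - p.2 + 1 * p.1 v) < 0).card : ℕ) : ℝ) ≤ Φ.card := by
      exact_mod_cast hcardle
    linarith
  have hmid' : |f (x, c) - f (x + v, c)| ≤ (Φ.card + 1) * ε₁ :=
    hmid.trans (mul_le_mul_of_nonneg_right hmax hε₁0.le)
  have htot : ε = (Φ.card + 3) * ε₁ := by
    rw [hε₁]; field_simp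
  have t1 := abs_sub_le (f (e, c)) (f (x, c)) (f (e + v, c))
  have t2 := abs_sub_le (f (x, c)) (f (x + v, c)) (f (e + v, c))
  rw [htot]
  linarith

end Core

/-! ### Locally additive functions and functions with finitely many values -/

section LocallyAdditive

variable {E : Type*} [NormedAddCommGroup E] [NormedSpace ℝ E]

/-- A continuous function that is additive near the origin is linear near the origin. -/
theorem exists_linear_of_locally_additive {φ : E → ℝ} {s : ℝ} (hs : 0 < s)
    (hc : ContinuousAt φ 0)
    (hadd : ∀ x v, ‖x‖ < s → ‖v‖ < s → φ (x + v) = φ x + φ v) :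
    ∃ L : E →L[ℝ] ℝ, ∀ x, ‖x‖ < s → φ x = L x := by
  have h0 : φ 0 = 0 := by
    have := hadd 0 0 (by simpa) (by simpa)
    simpa using this
  have hmul : ∀ (m : ℕ) (y : E), ‖(m : ℝ) • y‖ < s → φ ((m : ℝ) • y) = m * φ y := by
    intro m
    induction m with
    | zero => intro y _; simp [h0]
    | succ m ih =>
      intro y hy
      rw [norm_smul, Real.norm_of_nonneg (Nat.cast_nonneg _)] at hy
      push_cast at hy
      have hm : (0 : ℝ) ≤ m * ‖y‖ := by positivity
      have h1 : ‖(m : ℝ) • y‖ < s := by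
        rw [norm_smul, Real.norm_of_nonneg (Nat.cast_nonneg _)]
        linarith [norm_nonneg y]
      have h2 : ‖y‖ < s := by linarith
      push_cast
      rw [add_smul, one_smul, hadd _ _ h1 h2, ih y h1]
      ring
  have hscale : ∀ (x : E) (N : ℕ), N ≠ 0 → ‖x‖ < N * s → ‖((N : ℝ)⁻¹) • x‖ < s := by
    intro x N hN hx
    have hN' : (0 : ℝ) < N := by positivity
    rw [norm_smul, Real.norm_of_nonneg (by positivity), inv_mul_lt_iff₀ hN']
    exact hx
  have hind : ∀ (x : E) (N N' : ℕ), N ≠ 0 → N' ≠ 0 → ‖x‖ < N * s → ‖x‖ < N' * s →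
      N * φ ((N : ℝ)⁻¹ • x) = N' * φ ((N' : ℝ)⁻¹ • x) := by
    have key : ∀ (x : E) (N N' : ℕ), N ≠ 0 → N' ≠ 0 → ‖x‖ < N * s →
        N * φ ((N : ℝ)⁻¹ • x) = N * N' * φ (((N : ℝ) * N')⁻¹ • x) := by
      intro x N N' hN hN' hx
      have e : (N : ℝ)⁻¹ • x = (N' : ℝ) • (((N : ℝ) * N')⁻¹ • x) := by
        rw [smul_smul]
        congr 1
        field_simp
      have h1 := hscale x N hN hx
      rw [e] at h1 ⊢
      rw [hmul _ _ h1]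
      ring
    intro x N N' hN hN' hx hx'
    rw [key x N N' hN hN' hx, key x N' N hN' hN hx', mul_comm (N : ℝ) N']
  have hex : ∀ x : E, ∃ N : ℕ, N ≠ 0 ∧ ‖x‖ < N * s := by
    intro x
    obtain ⟨N, hN⟩ := exists_nat_gt (‖x‖ / s)
    refine ⟨N, ?_, (div_lt_iff₀ hs).1 hN⟩
    rintro rfl
    have : 0 ≤ ‖x‖ / s := by positivity
    simp only [Nat.cast_zero] at hN
    linarith
  choose N hN0 hN using hex
  have hL : ∀ (x : E) (K : ℕ), K ≠ 0 → ‖x‖ < K * s →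
      N x * φ ((N x : ℝ)⁻¹ • x) = K * φ ((K : ℝ)⁻¹ • x) := fun x K hK hx =>
    hind x _ _ (hN0 x) hK (hN x) hx
  -- The extension is L₀ x = N φ(x / N) for any N large enough that x / N lies in the ball; its
  -- value does not depend on N.
  let L₀ : E →+ ℝ := AddMonoidHom.mk' (fun x => N x * φ ((N x : ℝ)⁻¹ • x)) (by
    intro x y
    have hK : N x + N y ≠ 0 := by have := hN0 x; omega
    have hx0 : (0 : ℝ) ≤ N x * s := by positivity
    have hy0 : (0 : ℝ) ≤ N y * s := by positivity
    have hx : ‖x‖ < (N x + N y : ℕ) * s := by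
      push_cast; linarith [hN x]
    have hy : ‖y‖ < (N x + N y : ℕ) * s := by
      push_cast; linarith [hN y]
    have hxy : ‖x + y‖ < (N x + N y : ℕ) * s := by
      push_cast
      exact (norm_add_le _ _).trans_lt (by linarith [hN x, hN y])
    rw [hL (x + y) _ hK hxy, hL x _ hK hx, hL y _ hK hy, smul_add,
      hadd _ _ (hscale _ _ hK hx) (hscale _ _ hK hy)]
    ring)
  have heq : ∀ x, ‖x‖ < s → φ x = L₀ x := by
    intro x hx
    have := hL x 1 one_ne_zero (by simpa using hx)
    simp only [Nat.cast_one, inv_one, one_smul, one_mul] at this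
    exact this.symm
  have hcont : Continuous L₀ := by
    refine continuous_of_continuousAt_zero L₀ (hc.congr ?_)
    filter_upwards [Metric.ball_mem_nhds (0 : E) hs] with x hx
    exact heq x (by simpa using hx)
  exact ⟨L₀.toRealLinearMap hcont, heq⟩

theorem finite_image_of_finite_key {α β γ : Type*} {S : Set α} {g : α → β} {key : α → γ}
    (hk : (key '' S).Finite) (h : ∀ x ∈ S, ∀ y ∈ S, key x = key y → g x = g y) :
    (g '' S).Finite := by
  rcases S.eq_empty_or_nonempty with rfl | ⟨x₀, -⟩
  · simp
  have : Nonempty α := ⟨x₀⟩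
  refine (hk.image fun k => g (Function.invFunOn key S k)).subset ?_
  rintro _ ⟨x, hx, rfl⟩
  have hex : ∃ y ∈ S, key y = key x := ⟨x, hx, rfl⟩
  exact ⟨key x, ⟨x, hx, rfl⟩, h _ (Function.invFunOn_mem hex) _ hx (Function.invFunOn_eq hex)⟩

theorem IsPreconnected.eq_of_finite_image {X : Type*} [TopologicalSpace X] {Z : Set X}
    (hZ : IsPreconnected Z) {g : X → ℝ} (hg : ContinuousOn g Z) (hfin : (g '' Z).Finite)
    {x y : X} (hx : x ∈ Z) (hy : y ∈ Z) : g x = g y := by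
  by_contra hne
  exact (hZ.image g hg).infinite_of_nontrivial ⟨_, ⟨x, hx, rfl⟩, _, ⟨y, hy, rfl⟩, hne⟩ hfin

end LocallyAdditive

/-! ### Local linearity of pattern functions -/

section Core

set_option linter.unusedSectionVars false

variable {d n : ℕ} {C : Type} [AddCommGroup C] [Finite C] [TopologicalSpace C] [DiscreteTopology C]
  {Γ : AddSubgroup ((Eucl n × C) × Eucl d)} {W : Set (Eucl n × C)}
  {Φ : Finset (Eucl n →L[ℝ] ℝ)} {A : Finset ℝ} {e₀ : Eucl n} {f : Eucl n × C → ℝ}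
  {B : Set ((Eucl n →L[ℝ] ℝ) × ℝ)}

/-- The increments of a pattern function along a fixed lattice vector take finitely many values. -/
theorem IsPatternFunction.finite_increments (D : CoveredWindow Γ W Φ A e₀)
    (hf : IsPatternFunction Γ W Φ A f) {γ : (Eucl n × C) × Eucl d} (hγ : γ ∈ Γ) :
    ((fun h => f (h + γ.1) - f h) ''
      {h | h.1 ∈ offHyperplanes Γ Φ A ∧ h ∈ W ∧ h + γ.1 ∈ W}).Finite := by
  obtain ⟨R, hR⟩ := hf.increment ‖γ.2‖
  obtain ⟨w, -, hw⟩ := D.exists_bound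
  have hT := finite_lattice_bounded D.scheme (2 * w) R
  -- The patch that decides the increment is encoded by which of finitely many lattice vectors keep
  -- h in W.
  refine finite_image_of_finite_key (key := fun h => {β ∈ {γ : (Eucl n × C) × Eucl d |
    γ ∈ Γ ∧ ‖γ.1.1‖ ≤ 2 * w ∧ ‖γ.2‖ ≤ R} | h + β.1 ∈ W}) ?_ ?_
  · refine hT.finite_subsets.subset ?_
    rintro _ ⟨h, -, rfl⟩
    exact Set.sep_subset _ _
  · rintro h ⟨h1, h2, h3⟩ h' ⟨h1', h2', h3'⟩ hkey
    refine hR h h' h1 h1' h2 h2' γ hγ le_rfl h3 h3' fun β hβ hβR => ?_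
    have key : ∀ z z' : Eucl n × C, z ∈ W → z + β.1 ∈ W → {β ∈ {γ : (Eucl n × C) × Eucl d |
        γ ∈ Γ ∧ ‖γ.1.1‖ ≤ 2 * w ∧ ‖γ.2‖ ≤ R} | z + β.1 ∈ W} ⊆ {β ∈ {γ : (Eucl n × C) × Eucl d |
        γ ∈ Γ ∧ ‖γ.1.1‖ ≤ 2 * w ∧ ‖γ.2‖ ≤ R} | z' + β.1 ∈ W} → z' + β.1 ∈ W := by
      intro z z' hz hzβ hsub
      have hβw : ‖β.1.1‖ ≤ 2 * w := by
        have : β.1.1 = (z + β.1).1 - z.1 := by simp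
        rw [this]
        exact (norm_sub_le _ _).trans (by linarith [hw _ hz, hw _ hzβ])
      exact (hsub ⟨⟨hβ, hβw, hβR⟩, hzβ⟩).2
    exact ⟨fun hz => key h h' h2 hz hkey.subset, fun hz => key h' h h2' hz hkey.symm.subset⟩

/-- The part of the window off finitely many hyperplanes. -/
def windowOff (W : Set (Eucl n × C)) (B : Set ((Eucl n →L[ℝ] ℝ) × ℝ)) : Set (Eucl n × C) :=
  {h | h ∈ W ∧ ∀ p ∈ B, p.1 h.1 ≠ p.2}

theorem CoveredWindow.exists_ball_windowOff (D : CoveredWindow Γ W Φ A e₀) (hB : B.Finite)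
    (hBA : ∀ l ∈ Φ, ∀ a ∈ A, (l, a) ∈ B) {e : Eucl n} {c : C} (h : (e, c) ∈ windowOff W B) :
    ∃ s : ℝ, 0 < s ∧ ∀ z, ‖z‖ < s → (e + z, c) ∈ windowOff W B ∧ ∀ p ∈ B, SameSide p e (e + z) := by
  have hev : ∀ᶠ z in 𝓝 (0 : Eucl n), ∀ p ∈ B, SameSide p e (e + z) :=
    (Filter.eventually_all_finite hB).2 fun p hp => eventually_sameSide (h.2 p hp)
  obtain ⟨s, hs, hs'⟩ := Metric.eventually_nhds_iff.1 hev
  refine ⟨s, hs, fun z hz => ?_⟩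
  have hside := hs' (y := z) (by simpa using hz)
  refine ⟨⟨(D.mem_iff_of_sameSide fun l hl a ha => hside _ (hBA l hl a ha)).1 h.1, ?_⟩, hside⟩
  intro p hp heq
  have := hside p hp
  unfold SameSide at this
  simp only at heq
  rw [heq, sub_self, mul_zero] at this
  exact lt_irrefl _ this

theorem CoveredWindow.isOpen_windowOff (D : CoveredWindow Γ W Φ A e₀) (hB : B.Finite)
    (hBA : ∀ l ∈ Φ, ∀ a ∈ A, (l, a) ∈ B) : IsOpen (windowOff W B) := by
  refine isOpen_iff_mem_nhds.2 ?_
  rintro ⟨e, c⟩ h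
  obtain ⟨s, hs, hs'⟩ := D.exists_ball_windowOff hB hBA h
  have hmem : Metric.ball e s ×ˢ ({c} : Set C) ∈ 𝓝 (e, c) :=
    prod_mem_nhds (Metric.ball_mem_nhds e hs) ((isOpen_discrete _).mem_nhds rfl)
  refine Filter.mem_of_superset hmem ?_
  rintro ⟨x, c'⟩ ⟨hx, rfl⟩
  have := (hs' (x - e) (by simpa [dist_eq_norm] using hx)).1
  rwa [add_sub_cancel] at this

theorem CoveredWindow.windowOff_nonempty (D : CoveredWindow Γ W Φ A e₀)
    (hBΓ : B ⊆ latticeHyperplanes Γ Φ A) : (windowOff W B).Nonempty := by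
  obtain ⟨e₁, c₁, s, hs, hball⟩ := D.exists_ball
  obtain ⟨e, he, heG⟩ := D.dense_offHyperplanes.inter_open_nonempty _ Metric.isOpen_ball
    ⟨e₁, Metric.mem_ball_self hs⟩
  refine ⟨(e, c₁), hball e ?_, fun p hp => heG p (hBΓ hp)⟩
  have : ‖e - e₁‖ < s := by simpa [dist_eq_norm] using he
  linarith

/-- Every pattern function is the sum of a linear functional of the internal parameter and a
function with finitely many values. -/
theorem IsPatternFunction.exists_linear (D : CoveredWindow Γ W Φ A e₀)
    (hf : IsPatternFunction Γ W Φ A f) : ∃ L : Eucl n →L[ℝ] ℝ,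
      ((fun h => f h - L h.1) '' {h | h ∈ W ∧ h.1 ∈ offHyperplanes Γ Φ A}).Finite := by
  obtain ⟨B, hB, hBΓ, hBA, hmod⟩ := hf.exists_modulus D
  set U := windowOff W B with hU
  have hUo : IsOpen U := D.isOpen_windowOff hB hBA
  set G : Set (Eucl n × C) := {h | h.1 ∈ offHyperplanes Γ Φ A} with hG
  have hGd : Dense G := D.dense_offHyperplanes.preimage isOpenMap_fst
  have hosc : ∀ h ∈ U, ∀ ε : ℝ, 0 < ε → ∃ O ∈ 𝓝 h, ∀ x ∈ O ∩ G, ∀ y ∈ O ∩ G,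
      |f x - f y| ≤ ε := by
    rintro ⟨e, c⟩ h ε hε
    obtain ⟨δ, hδ, hmod⟩ := hmod ε hε
    obtain ⟨s, hs, hs'⟩ := D.exists_ball_windowOff hB hBA h
    have hm : 0 < min s (δ / 2) := lt_min hs (by positivity)
    refine ⟨Metric.ball e (min s (δ / 2)) ×ˢ ({c} : Set C),
      prod_mem_nhds (Metric.ball_mem_nhds e hm) ((isOpen_discrete _).mem_nhds rfl), ?_⟩
    rintro ⟨x, c'⟩ ⟨⟨hx, rfl⟩, hxG⟩ ⟨y, c''⟩ ⟨⟨hy, rfl⟩, hyG⟩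
    have hx' : ‖x - e‖ < min s (δ / 2) := by simpa [dist_eq_norm] using hx
    have hy' : ‖y - e‖ < min s (δ / 2) := by simpa [dist_eq_norm] using hy
    have h1 := hs' (x - e) (hx'.trans_le (min_le_left _ _))
    have h2 := hs' (y - e) (hy'.trans_le (min_le_left _ _))
    rw [add_sub_cancel] at h1 h2
    refine hmod x y _ hxG hyG h1.1.1 h2.1.1 ?_ fun p hp => (h1.2 p hp).symm.trans (h2.2 p hp)
    have e1 : y - x = (y - e) - (x - e) := by abel
    rw [e1]
    have := min_le_right s (δ / 2)
    exact (norm_sub_le _ _).trans_lt (by linarith)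
  have hlim : ∀ h ∈ U, ∃ y, Filter.Tendsto f (𝓝[G] h) (𝓝 y) := by
    intro h hh
    have : (𝓝[G] h).NeBot := mem_closure_iff_nhdsWithin_neBot.1 (hGd h)
    refine cauchy_map_iff_exists_tendsto.1 (cauchy_map_iff'.2 ?_)
    refine Metric.uniformity_basis_dist_le.tendsto_right_iff.2 fun ε hε => ?_
    obtain ⟨O, hO, hO'⟩ := hosc h hh ε hε
    have hOG : O ∩ G ∈ 𝓝[G] h := Filter.inter_mem (mem_nhdsWithin_of_mem_nhds hO)
      self_mem_nhdsWithin
    filter_upwards [Filter.prod_mem_prod hOG hOG] with p hp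
    rw [Real.dist_eq]
    exact hO' _ hp.1 _ hp.2
  -- The small oscillation of f on good parameters gives a continuous extension to U.
  set F := extendFrom G f with hF
  have hFc : ContinuousOn F U := continuousOn_extendFrom (fun h _ => hGd h) hlim
  have hFat : ∀ h ∈ U, ContinuousAt F h := fun h hh => hFc.continuousAt (hUo.mem_nhds hh)
  have hFf : ∀ h ∈ U, h ∈ G → F h = f h := by
    intro h hh hhG
    refine extendFrom_eq (hGd h) (Metric.tendsto_nhds.2 fun ε hε => ?_)
    obtain ⟨O, hO, hO'⟩ := hosc h hh (ε / 2) (by positivity)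
    filter_upwards [mem_nhdsWithin_of_mem_nhds hO, self_mem_nhdsWithin] with x hx hxG
    have := hO' x ⟨hx, hxG⟩ h ⟨mem_of_mem_nhds hO, hhG⟩
    rw [Real.dist_eq]
    linarith
  -- Increments of F are continuous and, as limits from a finite and hence closed set, take finitely
  -- many values; so they are constant on connected sets.
  have hinc : ∀ γ ∈ Γ, ∀ Z : Set (Eucl n × C), IsPreconnected Z → Z ⊆ U →
      (∀ h ∈ Z, h + γ.1 ∈ U) → ∀ x ∈ Z, ∀ y ∈ Z, F (x + γ.1) - F x = F (y + γ.1) - F y := by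
    intro γ hγ Z hZ hZU hZU' x hx y hy
    have hcat : ∀ h, h ∈ U → h + γ.1 ∈ U → ContinuousAt (fun h => F (h + γ.1) - F h) h := by
      intro h h1 h2
      have hadd : ContinuousAt (fun h : Eucl n × C => h + γ.1) h := by fun_prop
      exact (ContinuousAt.comp (f := fun h : Eucl n × C => h + γ.1) (hFat _ h2) hadd).sub (hFat _ h1)
    have hfin := hf.finite_increments D hγ
    refine hZ.eq_of_finite_image (g := fun h => F (h + γ.1) - F h)
      (fun h hh => (hcat h (hZU hh) (hZU' h hh)).continuousWithinAt) (hfin.subset ?_) hx hy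
    rintro _ ⟨h, hh, rfl⟩
    have hcl := hfin.isClosed.closure_eq
    have : (𝓝[G] h).NeBot := mem_closure_iff_nhdsWithin_neBot.1 (hGd h)
    rw [← hcl]
    refine mem_closure_of_tendsto (b := 𝓝[G] h) (f := fun h => F (h + γ.1) - F h)
      ((hcat h (hZU hh) (hZU' h hh)).mono_left nhdsWithin_le_nhds) ?_
    have hadd : ContinuousAt (fun h : Eucl n × C => h + γ.1) h := by fun_prop
    filter_upwards [mem_nhdsWithin_of_mem_nhds (hUo.mem_nhds (hZU hh)), self_mem_nhdsWithin,
      mem_nhdsWithin_of_mem_nhds (hadd.preimage_mem_nhds (hUo.mem_nhds (hZU' h hh)))]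
      with x hx hxG hx'
    have hxG' : x + γ.1 ∈ G := mem_offHyperplanes_add hxG hγ
    rw [hFf x hx hxG, hFf _ hx' hxG']
    exact ⟨x, ⟨hxG, hx.1, hx'.1⟩, rfl⟩
  have hpre : ∀ (e : Eucl n) (c : C) (s : ℝ), IsPreconnected (Metric.ball e s ×ˢ ({c} : Set C)) :=
    fun e c s => (convex_ball e s).isPreconnected.prod isPreconnected_singleton
  obtain ⟨⟨e₁, c₁⟩, h₁⟩ := D.windowOff_nonempty hBΓ
  obtain ⟨s, hs, hs'⟩ := D.exists_ball_windowOff hB hBA h₁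
  have hφc : ∀ z : Eucl n, ‖z‖ < s → ContinuousAt (fun v => F (e₁ + v, c₁)) z := by
    intro z hz
    have hadd : ContinuousAt (fun v : Eucl n => (e₁ + v, c₁)) z := by fun_prop
    exact ContinuousAt.comp (f := fun v : Eucl n => (e₁ + v, c₁)) (hFat _ (hs' z hz).1) hadd
  -- A failure of additivity at v would persist near v, in particular at the internal part of a
  -- lattice vector with trivial C-component, where constancy of increments forbids it.
  have hadd : ∀ x v : Eucl n, ‖x‖ < s / 2 → ‖v‖ < s / 2 →
      F (e₁ + (x + v), c₁) - F (e₁, c₁) =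
        (F (e₁ + x, c₁) - F (e₁, c₁)) + (F (e₁ + v, c₁) - F (e₁, c₁)) := by
    intro x v hx hv
    by_contra hne
    have hc1 : ContinuousAt (fun v => F (e₁ + (x + v), c₁)) v := by
      have h2 : ContinuousAt (fun v => x + v) v := by fun_prop
      refine ContinuousAt.comp (g := fun v => F (e₁ + v, c₁)) (hφc (x + v) ?_) h2
      exact (norm_add_le _ _).trans_lt (by linarith)
    have hc2 := hφc v (by linarith)
    have hev := ((hc1.sub continuousAt_const).sub
      (continuousAt_const.add (hc2.sub continuousAt_const))).eventually_ne (sub_ne_zero.2 hne)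
    obtain ⟨N, hN, hNo, hvN⟩ := mem_nhds_iff.1 (hev.and (Metric.isOpen_ball.mem_nhds
      (show v ∈ Metric.ball (0 : Eucl n) (s / 2) by simpa using hv)))
    obtain ⟨γ, hγ, hγN, hγ0⟩ := exists_lattice_add_mem D.scheme
      (hNo.prod (isOpen_discrete ({0} : Set C))) ⟨(v, 0), hvN, rfl⟩ 0
    rw [add_zero] at hγN hγ0
    have hγ0' : γ.1.2 = 0 := hγ0
    obtain ⟨h1, h2⟩ := hN hγN
    have h2' : ‖γ.1.1‖ < s / 2 := by simpa using h2
    refine h1 ?_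
    have e2 : ∀ y : Eucl n, (y, c₁) + γ.1 = (y + γ.1.1, c₁) := fun y =>
      Prod.ext rfl (by simp [hγ0'])
    have hdiff := hinc γ hγ (Metric.ball e₁ (s / 2) ×ˢ ({c₁} : Set C)) (hpre _ _ _) (by
        rintro ⟨y, c⟩ ⟨hy, rfl⟩
        have := (hs' (y - e₁) (by
          have : ‖y - e₁‖ < s / 2 := by simpa [dist_eq_norm] using hy
          linarith)).1
        rwa [add_sub_cancel] at this) (by
        rintro ⟨y, c⟩ ⟨hy, rfl⟩
        have := (hs' (y - e₁ + γ.1.1) (by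
          have : ‖y - e₁‖ < s / 2 := by simpa [dist_eq_norm] using hy
          exact (norm_add_le _ _).trans_lt (by linarith))).1
        rw [e2]
        convert this using 2
        abel) (e₁ + x, c₁) ⟨by simpa using hx, rfl⟩ (e₁, c₁)
        ⟨Metric.mem_ball_self (by positivity), rfl⟩
    rw [e2, e2] at hdiff
    change F (e₁ + (x + γ.1.1), c₁) - F (e₁, c₁) -
      ((F (e₁ + x, c₁) - F (e₁, c₁)) + (F (e₁ + γ.1.1, c₁) - F (e₁, c₁))) = 0
    rw [← add_assoc]
    linarith
  obtain ⟨L, hL⟩ := exists_linear_of_locally_additive (φ := fun v => F (e₁ + v, c₁) - F (e₁, c₁))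
    (half_pos hs) ((hφc 0 (by simpa)).sub continuousAt_const) hadd
  refine ⟨L, ?_⟩
  -- A lattice vector carries the ball at the base point into any part of U, in any slice, and
  -- changes F there by a constant; so L is the linear part everywhere.
  have hloc : ∀ h ∈ U, ∀ᶠ y in 𝓝 h, F h - L h.1 = F y - L y.1 := by
    rintro ⟨e, c⟩ h
    obtain ⟨t, ht, ht'⟩ := D.exists_ball_windowOff hB hBA h
    have hm : 0 < min (s / 2) (t / 2) := lt_min (by positivity) (by positivity)
    set m := min (s / 2) (t / 2) with hmdef
    obtain ⟨γ, hγ, hγe, hγc⟩ := exists_lattice_add_mem D.scheme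
      ((Metric.isOpen_ball (x := e) (ε := m / 2)).prod (isOpen_discrete ({c} : Set C)))
      ⟨(e, c), Metric.mem_ball_self (by positivity), rfl⟩ (e₁, c₁)
    have hγe' : ‖γ.1.1 + e₁ - e‖ < m / 2 := by simpa [dist_eq_norm] using hγe
    have hγc' : γ.1.2 + c₁ = c := hγc
    have e2 : ∀ y : Eucl n, (y, c₁) + γ.1 = (y + γ.1.1, c) := fun y =>
      Prod.ext rfl (by simpa [add_comm] using hγc')
    have hm1 : m ≤ s / 2 := min_le_left _ _
    have hm2 : m ≤ t / 2 := min_le_right _ _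
    have hdiff := hinc γ hγ (Metric.ball e₁ m ×ˢ ({c₁} : Set C)) (hpre _ _ _) (by
        rintro ⟨y, c'⟩ ⟨hy, rfl⟩
        have := (hs' (y - e₁) (by
          have : ‖y - e₁‖ < m := by simpa [dist_eq_norm] using hy
          linarith)).1
        rwa [add_sub_cancel] at this) (by
        rintro ⟨y, c'⟩ ⟨hy, rfl⟩
        have := (ht' ((y - e₁) + (γ.1.1 + e₁ - e)) (by
          have : ‖y - e₁‖ < m := by simpa [dist_eq_norm] using hy
          exact (norm_add_le _ _).trans_lt (by linarith))).1
        rw [e2]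
        convert this using 2
        abel)
    have hconst : ∀ y : Eucl n, ‖y - e‖ < m / 2 → F (y, c) - L y =
        F (e₁ + γ.1.1, c) - L (e₁ + γ.1.1) := by
      intro y hy
      obtain ⟨x, hx⟩ : ∃ x, x = y - e - (γ.1.1 + e₁ - e) := ⟨_, rfl⟩
      have hxm : ‖x‖ < m := by
        rw [hx]; exact (norm_sub_le _ _).trans_lt (by linarith)
      have h3 := hdiff (e₁ + x, c₁) ⟨by simpa using hxm, rfl⟩ (e₁, c₁)
        ⟨Metric.mem_ball_self hm, rfl⟩
      rw [e2, e2] at h3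
      have h4 : F (e₁ + x, c₁) - F (e₁, c₁) = L x := hL x (hxm.trans_le hm1)
      have h5 : y = e₁ + x + γ.1.1 := by rw [hx]; abel
      rw [h5]
      simp only [map_add]
      linarith
    have hmem : Metric.ball e (m / 2) ×ˢ ({c} : Set C) ∈ 𝓝 (e, c) :=
      prod_mem_nhds (Metric.ball_mem_nhds e (by positivity)) ((isOpen_discrete _).mem_nhds rfl)
    filter_upwards [hmem] with y hy
    obtain ⟨y, c'⟩ := y
    obtain ⟨hy, rfl⟩ := hy
    have hy' : ‖y - e‖ < m / 2 := by simpa [dist_eq_norm] using hy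
    rw [hconst e (by simpa using half_pos hm), hconst y hy']
  -- A cell is given by the sides of the finitely many hyperplanes in B and the slice. It is convex,
  -- so the locally constant F - L is constant on it.
  refine finite_image_of_finite_key
    (key := fun h : Eucl n × C => ({p ∈ B | p.2 < p.1 h.1}, h.2)) ?_ ?_
  · refine (hB.finite_subsets.prod (Set.finite_univ (α := C))).subset ?_
    rintro _ ⟨h, -, rfl⟩
    exact ⟨Set.sep_subset _ _, trivial⟩
  · rintro ⟨e, c⟩ ⟨hW, heG⟩ ⟨e', c'⟩ ⟨hW', heG'⟩ hkey
    obtain ⟨hkey, rfl⟩ := Prod.mk.inj hkey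
    have hside : ∀ p ∈ B, SameSide p e e' := by
      intro p hp
      have h1 : p.2 < p.1 e ↔ p.2 < p.1 e' := by
        have := Set.ext_iff.1 hkey p
        simpa [hp] using this
      have h2 := heG p (hBΓ hp)
      have h3 := heG' p (hBΓ hp)
      simp only at h2 h3
      unfold SameSide
      rcases lt_or_gt_of_ne h2 with h | h
      · have h' : p.1 e' < p.2 := lt_of_le_of_ne (not_lt.1 fun h4 => (h1.2 h4).not_gt h) h3
        exact mul_pos_of_neg_of_neg (sub_neg.2 h) (sub_neg.2 h')
      · exact mul_pos (sub_pos.2 h) (sub_pos.2 (h1.1 h))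
    have hUe : (e, c) ∈ U := ⟨hW, fun p hp => heG p (hBΓ hp)⟩
    have hUe' : (e', c) ∈ U := ⟨hW', fun p hp => heG' p (hBΓ hp)⟩
    have hsegU : segment ℝ e e' ×ˢ ({c} : Set C) ⊆ U := by
      rintro ⟨x, c'⟩ ⟨hx, rfl⟩
      refine ⟨?_, fun p hp => (hside p hp).ne_zero_of_mem_segment hx⟩
      rw [segment_eq_image'] at hx
      obtain ⟨θ, ⟨h0, h1⟩, rfl⟩ := hx
      refine (D.mem_iff_of_sameSide fun l hl a ha => ?_).1 hW
      refine SameSide.add_smul ?_ h0 h1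
      rw [add_sub_cancel]
      exact hside _ (hBA l hl a ha)
    have hsegpre : IsPreconnected (segment ℝ e e' ×ˢ ({c} : Set C)) :=
      (convex_segment e e').isPreconnected.prod isPreconnected_singleton
    have hfinal := hsegpre.induction₂ (fun x y => F x - L x.1 = F y - L y.1)
      (fun x hx => mem_nhdsWithin_of_mem_nhds (hloc x (hsegU hx)))
      (fun x y z _ _ _ h1 h2 => h1.trans h2) (fun x y _ _ h => h.symm)
      (x := (e, c)) (y := (e', c)) ⟨left_mem_segment _ _ _, rfl⟩ ⟨right_mem_segment _ _ _, rfl⟩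
    simp only at hfinal ⊢
    rw [← hFf _ hUe heG, ← hFf _ hUe' heG']
    exact hfinal

end Core

/-! ### From the window back to the model set -/

section Reprojection

set_option linter.unusedSectionVars false

variable {d n : ℕ} {C : Type} [AddCommGroup C] [Finite C] [TopologicalSpace C] [DiscreteTopology C]
  {Γ : AddSubgroup ((Eucl n × C) × Eucl d)} {W : Set (Eucl n × C)} {M : Set (Eucl d)}
  {Φ : Finset (Eucl n →L[ℝ] ℝ)} {A : Finset ℝ} {e₀ : Eucl n}

theorem CoveredWindow.nonSingular (D : CoveredWindow Γ W Φ A e₀) {h : Eucl n × C}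
    (hh : h.1 ∈ offHyperplanes Γ Φ A) : NonSingular Γ W (h, 0) := by
  intro γ hγ hfr
  obtain ⟨l, hl, a, ha, heq⟩ := D.frontier_subset _ hfr
  refine hh (l, a - l γ.1.1) ⟨hl, a, ha, γ, hγ, rfl⟩ ?_
  simp only
  rw [← heq]
  simp

theorem SamePatch.agreeTo {ρ : ℝ} {h h' : Eucl n × C} (H : SamePatch Γ W ρ h h') :
    AgreeTo ρ (projSet Γ W (h, 0)) (projSet Γ W (h', 0)) := by
  refine agreeTo_iff.2 fun y hy => ?_
  rw [mem_projSet_zero, mem_projSet_zero]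
  constructor
  · rintro ⟨β, hβ, hβW, rfl⟩
    exact ⟨β, hβ, by rw [add_comm] at hβW ⊢; exact (H β hβ hy).1 hβW, rfl⟩
  · rintro ⟨β, hβ, hβW, rfl⟩
    exact ⟨β, hβ, by rw [add_comm] at hβW ⊢; exact (H β hβ hy).2 hβW, rfl⟩

theorem shift_projSet_zero (h : Eucl n × C) {γ : (Eucl n × C) × Eucl d} (hγ : γ ∈ Γ) :
    shift (projSet Γ W (h, 0)) γ.2 = projSet Γ W (h + γ.1, 0) := by
  rw [shift_projSet, ← projSet_add hγ]
  congr 1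
  ext1 <;> simp [add_comm]

/-- The function of the internal parameter defined by a function on the transversal. -/
noncomputable def parameterFunction (Γ : AddSubgroup ((Eucl n × C) × Eucl d))
    (W : Set (Eucl n × C)) (Ft : Transversal M → ℝ) (h : Eucl n × C) : ℝ :=
  Function.extend Subtype.val Ft 0 (projSet Γ W (h, 0))

theorem parameterFunction_eq {Ft : Transversal M → ℝ} {h : Eucl n × C}
    (hh : projSet Γ W (h, 0) ∈ Transversal M) : parameterFunction Γ W Ft h = Ft ⟨_, hh⟩ :=
  Subtype.val_injective.extend_apply Ft 0 ⟨_, hh⟩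

theorem CoveredWindow.projSet_mem_transversal (D : CoveredWindow Γ W Φ A e₀)
    (hM : IsModelSet Γ W M) {h : Eucl n × C} (hh : h.1 ∈ offHyperplanes Γ Φ A) (hhW : h ∈ W) :
    projSet Γ W (h, 0) ∈ Transversal M :=
  _root_.projSet_mem_transversal D.scheme D.window.compact hM (D.nonSingular hh) hhW

/-- The increments of an inducing function are approximated at points of the model set. -/
theorem CoveredWindow.exists_increment_near (D : CoveredWindow Γ W Φ A e₀)
    (hM : IsModelSet Γ W M) {F : M → ℝ} {Ft : Transversal M → ℝ} (hF : Induces M Ft F)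
    {h : Eucl n × C} (hh : h.1 ∈ offHyperplanes Γ Φ A) (hhW : h ∈ W)
    {γ : (Eucl n × C) × Eucl d} (hγ : γ ∈ Γ) (hγW : h + γ.1 ∈ W) (R : ℝ) {ε : ℝ} (hε : 0 < ε) :
    ∃ x y : M, (y : Eucl d) - x = γ.2 ∧ AgreeTo R (projSet Γ W (h, 0)) (shift M x) ∧
      |(parameterFunction Γ W Ft (h + γ.1) - parameterFunction Γ W Ft h) - (F y - F x)| < ε := by
  obtain ⟨ρ, hρ, hunif⟩ := exists_agreeTo_abs_sub_lt
    (isCompact_transversal D.scheme D.window.compact hM) hF.1 (half_pos hε)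
  -- The radius also covers a patch of radius ρ around γ.2, the other end of the edge.
  obtain ⟨x, hx, hag⟩ := exists_agreeTo_projSet D.scheme D.window.compact hM (D.nonSingular hh)
    hhW (max R (ρ + ‖γ.2‖))
  have hγmem : γ.2 + x ∈ M := (agreeTo_iff.1 hag γ.2 ((by linarith : ‖γ.2‖ ≤ ρ + ‖γ.2‖).trans
    (le_max_right _ _))).1 (mem_projSet_zero.2 ⟨γ, hγ, by rwa [add_comm], rfl⟩)
  have hag2 := hag.shift (R' := ρ) (x := γ.2) (le_max_right _ _)
  rw [shift_projSet_zero h hγ, shift_shift] at hag2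
  have hag1 : AgreeTo ρ (projSet Γ W (h, 0)) (shift M x) :=
    hag.mono ((by linarith [norm_nonneg γ.2] : ρ ≤ ρ + ‖γ.2‖).trans (le_max_right _ _))
  have hmem := D.projSet_mem_transversal hM hh hhW
  have hmem' := D.projSet_mem_transversal hM (h := h + γ.1) (mem_offHyperplanes_add hh hγ) hγW
  refine ⟨⟨x, hx⟩, ⟨γ.2 + x, hγmem⟩, by simp, hag.mono (le_max_left _ _), ?_⟩
  have h1 := hunif ⟨_, hmem⟩ ⟨_, shift_mem_transversal hx⟩ hag1
  have h2 := hunif ⟨_, hmem'⟩ ⟨_, shift_mem_transversal hγmem⟩ hag2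
  rw [parameterFunction_eq hmem, parameterFunction_eq hmem', hF.2, hF.2]
  rw [abs_lt] at *
  constructor <;> linarith [h1.1, h1.2, h2.1, h2.2]

/-- Continuity on the compact transversal gives approximation by patches. Increments are limits of
values of the cocycle δF on edges of M, which the patch determines exactly. -/
theorem CoveredWindow.isPatternFunction (D : CoveredWindow Γ W Φ A e₀) (hM : IsModelSet Γ W M)
    {F : M → ℝ} {Ft : Transversal M → ℝ} (hF : Induces M Ft F)
    (hc : coboundary M F ∈ PECocycle M) :
    IsPatternFunction Γ W Φ A (parameterFunction Γ W Ft) where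
  approx ε hε := by
    obtain ⟨ρ, -, h⟩ := exists_agreeTo_abs_sub_lt
      (isCompact_transversal D.scheme D.window.compact hM) hF.1 hε
    refine ⟨ρ, fun h₁ h₂ ho₁ ho₂ hW₁ hW₂ hs => ?_⟩
    rw [parameterFunction_eq (D.projSet_mem_transversal hM ho₁ hW₁),
      parameterFunction_eq (D.projSet_mem_transversal hM ho₂ hW₂)]
    exact (h _ _ hs.agreeTo).le
  increment r := by
    obtain ⟨R, -, hR⟩ := hc.1 r
    refine ⟨R, fun h h' ho ho' hW hW' γ hγ hγr hγW hγW' hs => ?_⟩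
    refine eq_of_forall_dist_le fun ε hε => ?_
    obtain ⟨x, y, hxy, hag, hlt⟩ :=
      D.exists_increment_near hM hF ho hW hγ hγW R (half_pos hε)
    obtain ⟨x', y', hxy', hag', hlt'⟩ :=
      D.exists_increment_near hM hF ho' hW' hγ hγW' R (half_pos hε)
    have heq : F y - F x = F y' - F x' := hR x y x' y' (by rwa [hxy]) (by rw [hxy, hxy'])
      (hag.symm.trans (hs.agreeTo.trans hag'))
    rw [Real.dist_eq]
    rw [abs_lt] at hlt hlt'
    rw [abs_le]
    constructor <;> linarith [hlt.1, hlt.2, hlt'.1, hlt'.2]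

/-- A continuous function with finitely many values on the transversal induces a strongly pattern
equivariant function. -/
theorem Induces.mem_spe_of_finite_range {Λ : Set (Eucl d)} (hΛ : IsCompact (Transversal Λ))
    {F : Λ → ℝ} {Ft : Transversal Λ → ℝ} (hF : Induces Λ Ft F) (hfin : (Set.range Ft).Finite) :
    F ∈ SPE Λ := by
  obtain ⟨ε, hε, hsep⟩ : ∃ ε : ℝ, 0 < ε ∧ ∀ a ∈ Set.range Ft, ∀ b ∈ Set.range Ft,
      |a - b| < ε → a = b := by
    have hev : ∀ p ∈ Set.range Ft ×ˢ Set.range Ft, ∀ᶠ ε in 𝓝[>] (0 : ℝ),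
        |p.1 - p.2| < ε → p.1 = p.2 := by
      rintro ⟨a, b⟩ -
      by_cases hab : a = b
      · exact Filter.Eventually.of_forall fun _ _ => hab
      · filter_upwards [mem_nhdsWithin_of_mem_nhds
          (gt_mem_nhds (abs_pos.2 (sub_ne_zero.2 hab)))] with ε hε hlt
        exact absurd hlt hε.not_gt
    obtain ⟨ε, h1, h2⟩ := (((Filter.eventually_all_finite (hfin.prod hfin)).2 hev).and
      self_mem_nhdsWithin).exists
    exact ⟨ε, h2, fun a ha b hb => h1 (a, b) ⟨ha, hb⟩⟩
  obtain ⟨R, hR, h⟩ := exists_agreeTo_abs_sub_lt hΛ hF.1 hε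
  refine ⟨R, hR, fun x y hxy => ?_⟩
  rw [hF.2, hF.2]
  exact hsep _ ⟨_, rfl⟩ _ ⟨_, rfl⟩ (h _ _ hxy)

theorem induces_starMap (hΓ : IsCutProjectScheme Γ) (hW : IsWindow W) (hM : IsModelSet Γ W M)
    {L : Eucl n × C → ℝ} (hL : Continuous L) :
    Induces M (fun A => L (starMap Γ W (A : Set (Eucl d)) 0)) fun x => L (starMap Γ W M x) := by
  refine ⟨hL.comp (continuous_starMap_zero hΓ hW hM), fun x => ?_⟩
  have h0 : (0 : Eucl d) + x ∈ M := by simp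
  simp only
  rw [starMap_shift hΓ hW hM h0, zero_add]

/-- The difference of the star values at x and y is the internal part of the lattice vector over y -
x, so the cocycle depends on y - x alone. -/
theorem coboundary_reprojection_mem (hΓ : IsCutProjectScheme Γ) (hW : IsWindow W)
    (hM : IsModelSet Γ W M) (L : Eucl n × C →+ ℝ) :
    coboundary M (fun x => L (starMap Γ W M x)) ∈ PECocycle M := by
  refine ⟨fun r => ⟨1, one_pos, fun x y x' y' _ hd _ => ?_⟩, fun x y z => ?_⟩
  · obtain ⟨γ, hγ, h1, h2⟩ := exists_lattice_of_mem hΓ hW hM x.2 y.2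
    obtain ⟨β, hβ, h3, h4⟩ := exists_lattice_of_mem hΓ hW hM x'.2 y'.2
    have : γ = β := snd_injOn hΓ hγ hβ (by rw [h1, h3, hd])
    change L _ - L _ = L _ - L _
    rw [← map_sub, ← map_sub, ← h2, ← h4, this]
  · change (L _ - L _) - (L _ - L _) + (L _ - L _) = 0
    ring

/-- On the patterns with good parameter h the inducing function of the difference is f h - L h,
which has finitely many values; density extends this to the transversal. -/
theorem CoveredWindow.exists_sub_reprojection_mem_spe (D : CoveredWindow Γ W Φ A e₀)
    (hM : IsModelSet Γ W M) {F : M → ℝ} (hF : F ∈ WPE M) (hc : coboundary M F ∈ PECocycle M) :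
    ∃ L : Eucl n × C →+ ℝ, Continuous L ∧ (F - fun x : M => L (starMap Γ W M x)) ∈ SPE M := by
  obtain ⟨Ft, hF⟩ := hF
  obtain ⟨L, hL⟩ := (D.isPatternFunction hM hF hc).exists_linear D
  have hcont : Continuous (L.toLinearMap.toAddMonoidHom.comp (AddMonoidHom.fst (Eucl n) C)) :=
    L.continuous.comp continuous_fst
  refine ⟨L.toLinearMap.toAddMonoidHom.comp (AddMonoidHom.fst _ _), hcont, ?_⟩
  have hI := induces_starMap D.scheme D.window hM hcont
  have hG : Induces M (fun A => Ft A - L (starMap Γ W (A : Set (Eucl d)) 0).1)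
      (F - fun x : M => L (starMap Γ W M x).1) :=
    ⟨hF.1.sub hI.1, fun x => congrArg₂ (· - ·) (hF.2 x) (hI.2 x)⟩
  refine hG.mem_spe_of_finite_range (isCompact_transversal D.scheme D.window.compact hM)
    (hL.subset ?_)
  have hdense : Dense {h : Eucl n × C | h.1 ∈ offHyperplanes Γ Φ A} :=
    D.dense_offHyperplanes.preimage isOpenMap_fst
  rintro _ ⟨B, rfl⟩
  have hB : B ∈ closure (Subtype.val ⁻¹' {P : Set (Eucl d) | ∃ h ∈ {h : Eucl n × C |
      h.1 ∈ offHyperplanes Γ Φ A}, h ∈ W ∧ P = projSet Γ W (h, 0)} : Set (Transversal M)) := by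
    rw [closure_subtype, Subtype.image_preimage_coe, Set.inter_eq_right.2]
    · exact transversal_subset_closure D.scheme D.window.compact hM hdense B.2
    · rintro _ ⟨h, ho, hhW, rfl⟩
      exact D.projSet_mem_transversal hM ho hhW
  -- The finite set of values is closed, so its preimage contains the closure of the good patterns.
  refine (hL.isClosed.preimage hG.1).closure_subset_iff.2 ?_ hB
  rintro ⟨_, hA⟩ ⟨h, ho, hhW, rfl⟩
  refine ⟨h, ⟨hhW, ho⟩, ?_⟩
  simp only
  rw [parameterFunction_eq hA, starMap_eq D.scheme D.window
    (hM.of_mem_hull (transversal_subset_hull M hA)) (sandwiched_projSet (h, 0)) (u := h)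
    (by rw [sub_self]; exact Γ.zero_mem)]

theorem CoveredWindow.h1an_le_h1repr (D : CoveredWindow Γ W Φ A e₀) (hM : IsModelSet Γ W M) :
    H1an M ≤ H1repr Γ W M := by
  rintro _ ⟨c, ⟨F, hF, hFc⟩, rfl⟩
  have hFc' : coboundary M F = c := hFc
  obtain ⟨L, hL, hS⟩ := D.exists_sub_reprojection_mem_spe hM hF (hFc' ▸ c.2)
  refine ⟨⟨_, coboundary_reprojection_mem D.scheme D.window hM L⟩,
    ⟨_, ⟨L, hL, fun _ => rfl⟩, rfl⟩, ?_⟩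
  have hmem : c - ⟨_, coboundary_reprojection_mem D.scheme D.window hM L⟩ ∈
      cocyclesOf M (SPE M) := by
    refine ⟨_, hS, ?_⟩
    rw [map_sub, hFc']
    rfl
  exact ((Submodule.Quotient.eq _).2 hmem).symm

end Reprojection

/-! ### The three subgroups coincide -/

theorem theorem1p2 (d n : ℕ) (C : Type) [AddCommGroup C] [Finite C] [TopologicalSpace C]
    [DiscreteTopology C] (Γ : AddSubgroup ((Eucl n × C) × Eucl d)) (hΓ : IsCutProjectScheme Γ)
    (W : Set (Eucl n × C)) (hW : IsWindow W) (hpoly : IsPolyhedral W)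
    (M : Set (Eucl d)) (hM : IsModelSet Γ W M) :
    H1repr Γ W M = H1ns M ∧ H1ns M = H1an M := by
  obtain ⟨Φ, A, e₀, hn, hfr⟩ := hpoly.exists_hyperplanes
  have D : CoveredWindow Γ W Φ A e₀ := ⟨hΓ, hW, hn, hfr⟩
  have h1 : H1repr Γ W M ≤ H1ns M := classesOf_mono M (reprojection_le_nonslip hΓ hW hM)
  have h2 : H1ns M ≤ H1an M := classesOf_mono M (nonslip_le_wpe M)
  have h3 := D.h1an_le_h1repr hM
  exact ⟨le_antisymm h1 (h2.trans h3), le_antisymm h2 (h3.trans h1)⟩
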